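/- Let $\mathbb F$ be an algebraically closed field of characteristic $p\neq 2$. Put $\mathbb I=\mathbb Z_{\ge 0}$ if $p=0$, $\mathbb I=\{0,1,\dots,\frac{p-1}{2}\}$ if $p\ge 3$, and $q(i)=i(i+1)$. The affine Hecke-Clifford algebra $\mathfrak H^{\mathfrak c}_n$ is the superalgebra with even generators $s_1,\dots,s_{n-1},x_1,\dots,x_n$, odd generators $c_1,\dots,c_n$ and the relations: $s_i^2=1$, $s_is_{i+1}s_i=s_{i+1}s_is_{i+1}$, $s_is_j=s_js_i$ for $|i-j|>1$; $x_ix_j=x_jx_i$; $c_i^2=1$, $c_ic_j=-c_jc_i$ for $i\ne j$; $x_ic_i=-c_ix_i$, $x_ic_j=c_jx_i$ for $i\neq j$; $s_ix_i=x_{i+1}s_i-(1+c_ic_{i+1})$, $s_ic_i=c_{i+1}s_i$, $s_ic_{i+1}=c_is_i$, and $s_ix_j=x_js_i$, $s_ic_j=c_js_i$ for $j\ne i,i+1$. Let $\mathcal P^{\mathfrak c}_n$ be its subalgebra generated by all $x_k,c_k$, and let $\mathfrak H^{\mathfrak c}_{2,1}$, $\mathfrak H^{\mathfrak c}_{1,2}$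 be the subalgebras of $\mathfrak H^{\mathfrak c}_3$ generated by $\mathcal P^{\mathfrak c}_3$ and $s_1$, respectively $s_2$. Modules are $\mathbb Z_2$-graded, irreducibility refers to graded submodules, and isomorphisms may be even or odd. An $\mathfrak H^{\mathfrak c}_n$-module is integral if it is finite dimensional and all eigenvalues of $x_1^2,\dots,x_n^2$ have the form $q(i)$, $i\in\mathbb I$; it is completely splittable if $x_1,\dots,x_n$ act semisimply. For irreducible $V,W$ let $V\boxtimes W$ be the outer tensor product and $V\circledast W$ an irreducible component of it (unique up to isomorphism). For $i\in\mathbb I$ let $L(i)$ be the $\mathcal P^{\mathfrak c}_1$-module with basis $v_0$ (even), $v_1$ (odd) and $x_1v_0=\sqrt{q(i)}\,v_0$, $x_1v_1=-\sqrt{q(i)}\,v_1$, $c_1v_0=v_1$, $c_1v_1=v_0$; put $L(\underline i)=L(i_1)\circledast\cdots\circledast L(i_n)$ for $\underline i\in\mathbb I^n$, and $V(0,0)=\mathrm{ind}_{\mathcal P^{\mathfrak c}_2}^{\mathfrak H^{\mathfrak c}_2}L(0)\circledast L(0)$. On a space on which $x_k^2$, $x_{k+1}^2$ act by the scalars $q(a)\neq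 q(b)$ put $$\Xi_k=-\Big(\frac{x_k+x_{k+1}}{q(a)-q(b)}+c_kc_{k+1}\frac{x_k-x_{k+1}}{q(a)-q(b)}\Big),\qquad \Omega_k=\sqrt{1-\frac{2(q(a)+q(b))}{(q(a)-q(b))^2}}$$ (with a fixed choice of square roots in $\mathbb F$). Let $V(0,0,1)$ be the $\mathfrak H^{\mathfrak c}_{2,1}$-module $V(0,0)\circledast L(1)$ with $s_2$ acting as $\Xi_2$, and $V(1,0,0)$ the $\mathfrak H^{\mathfrak c}_{1,2}$-module $L(1)\circledast V(0,0)$ with $s_1$ acting as $\Xi_1$. Let $W'(\mathfrak H^{\mathfrak c}_n)$ be the set of $\underline i\in\mathbb I^n$ such that for all $k<l$ with $i_k=i_l=u$: if $u=0$, then $1\in\{i_{k+1},\dots,i_{l-1}\}$; if $u\ge1$ and $p=0$, then $\{u-1,u+1\}\subseteq\{i_{k+1},\dots,i_{l-1}\}$; if $u\geq 1$ and $p\ge3$, then $\{u-1,u+1\}\subseteq\{i_{k+1},\dots,i_{l-1}\}$, or $u\le\frac{p-3}{2}$ and, with $d=\frac{p-3}{2}-u$, there are $k\le r_0<\dots<r_d<e<t_d<\dots<t_0\le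 l$ with $i_e=\frac{p-1}{2}$ and, for $0\le j\le d$, $i_{r_j}=i_{t_j}=u+j$ and $u+j$ does not occur strictly between the positions $r_j$ and $t_j$. The simple transposition $s_k$ is admissible for $\underline i$ if $i_k\neq i_{k+1}\pm1$; $P_{\underline i}$ is the set of all $\tau=s_{k_t}\cdots s_{k_1}\in S_n$ ($t\ge 0$) with each $s_{k_l}$ admissible for $s_{k_{l-1}}\cdots s_{k_1}\cdot\underline i$, where $\tau\cdot\underline i=(i_{\tau^{-1}(1)},\dots,i_{\tau^{-1}(n)})$. For $\underline i\in W'(\mathfrak H^{\mathfrak c}_n)$ let $D^{\underline i}=\bigoplus_{\tau\in P_{\underline i}}\{z^\tau: z\in L(\underline i)\}$ with $x_kz^\tau=(x_{\tau^{-1}(k)}z)^\tau$, $c_kz^\tau=(c_{\tau^{-1}(k)}z)^\tau$, and $s_kz^\tau=\Xi_kz^\tau+\Omega_kz^{s_k\tau}$ if $s_k$ is admissible for $\tau\cdot\underline i$, $s_kz^\tau=\Xi_kz^\tau$ otherwise. Proposition. Every irreducible integral $\mathfrak H^{\mathfrak c}_3$-module on which $x_1^2,x_2^2,x_3^2$ act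 semisimply is isomorphic to one of the following: (1) a completely splittable module $D^{\underline i}$ with $\underline i\in W'(\mathfrak H^{\mathfrak c}_3)$; (2) $V(0,0,1)$; (3) $V(1,0,0)$; (4) $\mathrm{ind}_{\mathfrak H^{\mathfrak c}_{2,1}}^{\mathfrak H^{\mathfrak c}_3}V(0,0)\circledast L(j)$ for some $j\in\mathbb I$ with $j\neq0,1$. -/

import Mathlib

open scoped TensorProduct

universe u v w

namespace HeckeClifford

/-! ### Parameters: the set `𝕀`, the function `q`, square roots, signs -/

/-- `𝕀 = ℤ₊` if `p = 0` and `𝕀 = {0, 1, …, (p-1)/2}` if `p ≥ 3`. -/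
def II (p : ℕ) : Set ℕ := {i | p = 0 ∨ i ≤ (p - 1) / 2}

/-- `q(i) = i (i + 1)`, as an element of the field. -/
def q (F : Type u) [Field F] (i : ℕ) : F := (i : F) * ((i : F) + 1)

theorem exists_sq_eq {F : Type u} [Field F] [IsAlgClosed F] (a : F) : ∃ z : F, z ^ 2 = a :=
  IsAlgClosed.exists_pow_nat_eq a (by norm_num)

/-- A fixed square root of each element of an algebraically closed field. -/
noncomputable def root {F : Type u} [Field F] [IsAlgClosed F] (a : F) : F :=
  Classical.choose (exists_sq_eq a)

/-- The sign `(-1)^a` of a parity `a`. -/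
def sgn (F : Type u) [Field F] (a : ZMod 2) : F := if a = 0 then 1 else -1

theorem sgn_zero (F : Type u) [Field F] : sgn F 0 = 1 := by simp [sgn]

theorem sgn_one (F : Type u) [Field F] : sgn F 1 = -1 := by simp [sgn]

theorem sgn_add (F : Type u) [Field F] (a b : ZMod 2) :
    sgn F (a + b) = sgn F a * sgn F b := by
  have h2 : (1 + 1 : ZMod 2) = 0 := by decide
  rcases (by decide : ∀ c : ZMod 2, c = 0 ∨ c = 1) a with rfl | rfl <;>
  rcases (by decide : ∀ c : ZMod 2, c = 0 ∨ c = 1) b with rfl | rfl <;>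
  simp [sgn_zero, sgn_one, h2]

theorem sgn_mul_self (F : Type u) [Field F] (a : ZMod 2) : sgn F a * sgn F a = 1 := by
  unfold sgn; split_ifs <;> simp

/-! ### The affine Hecke-Clifford algebra -/

/-- The generators `x_k`, `c_k` (`k : Fin n`) and `s_k` (for `k + 1 < n` and `k ∈ J`), all
indices counted from `0`, so that `s_k` is the simple transposition of `k` and `k + 1`.
`J = Set.univ` gives the generators of `ℌᶜ_n`, `J = ∅` those of `𝒫ᶜ_n`, and
`J = levi m` those of `ℌᶜ_{(m, n - m)}`. -/
inductive Gen (n : ℕ) (J : Set ℕ) : Type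
  | x (k : Fin n) : Gen n J
  | c (k : Fin n) : Gen n J
  | s (k : ℕ) (hk : k + 1 < n) (hJ : k ∈ J) : Gen n J

/-- The simple transpositions of `S_m × S_{n-m}`: all `s_k` but the one that moves
`m - 1` and `m`. -/
def levi (m : ℕ) : Set ℕ := {k | k + 1 ≠ m}

/-- The parity of a generator: the `c_k` are odd, the `x_k` and `s_k` are even. -/
def Gen.par {n : ℕ} {J : Set ℕ} : Gen n J → ZMod 2
  | .x _ => 0
  | .c _ => 1
  | .s _ _ _ => 0

/-- A generator of a parabolic subalgebra, regarded as a generator of `ℌᶜ_n`. -/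
def Gen.incl {n : ℕ} {J : Set ℕ} : Gen n J → Gen n Set.univ
  | .x k => .x k
  | .c k => .c k
  | .s k hk _ => .s k hk (Set.mem_univ k)

section Algebra

variable (F : Type u) [Field F] (n : ℕ)

/-- The free generators. -/
def fx (k : Fin n) : FreeAlgebra F (Gen n Set.univ) := FreeAlgebra.ι F (.x k)
/-- The free generators. -/
def fc (k : Fin n) : FreeAlgebra F (Gen n Set.univ) := FreeAlgebra.ι F (.c k)
/-- The free generators. -/
def fs (k : ℕ) (hk : k + 1 < n) : FreeAlgebra F (Gen n Set.univ) :=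
  FreeAlgebra.ι F (.s k hk (Set.mem_univ k))

/-- The defining relations of the affine Hecke-Clifford algebra. -/
inductive Rel : FreeAlgebra F (Gen n Set.univ) → FreeAlgebra F (Gen n Set.univ) → Prop
  | s_sq (k : ℕ) (hk : k + 1 < n) : Rel (fs F n k hk * fs F n k hk) 1
  | s_comm (k l : ℕ) (hk : k + 1 < n) (hl : l + 1 < n) (h : k + 1 < l) :
      Rel (fs F n k hk * fs F n l hl) (fs F n l hl * fs F n k hk)
  | braid (k : ℕ) (hk : k + 1 < n) (hk' : k + 1 + 1 < n) :
      Rel (fs F n k hk * fs F n (k + 1) hk' * fs F n k hk)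
        (fs F n (k + 1) hk' * fs F n k hk * fs F n (k + 1) hk')
  | x_comm (i j : Fin n) : Rel (fx F n i * fx F n j) (fx F n j * fx F n i)
  | c_sq (i : Fin n) : Rel (fc F n i * fc F n i) 1
  | c_anti (i j : Fin n) (h : i ≠ j) : Rel (fc F n i * fc F n j) (-(fc F n j * fc F n i))
  | s_x (k : ℕ) (hk : k + 1 < n) :
      Rel (fs F n k hk * fx F n ⟨k, by omega⟩)
        (fx F n ⟨k + 1, hk⟩ * fs F n k hk
          - (1 + fc F n ⟨k, by omega⟩ * fc F n ⟨k + 1, hk⟩))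
  | s_x_far (k : ℕ) (hk : k + 1 < n) (j : Fin n) (h : (j : ℕ) ≠ k) (h' : (j : ℕ) ≠ k + 1) :
      Rel (fs F n k hk * fx F n j) (fx F n j * fs F n k hk)
  | s_c (k : ℕ) (hk : k + 1 < n) :
      Rel (fs F n k hk * fc F n ⟨k, by omega⟩) (fc F n ⟨k + 1, hk⟩ * fs F n k hk)
  | s_c' (k : ℕ) (hk : k + 1 < n) :
      Rel (fs F n k hk * fc F n ⟨k + 1, hk⟩) (fc F n ⟨k, by omega⟩ * fs F n k hk)
  | s_c_far (k : ℕ) (hk : k + 1 < n) (j : Fin n) (h : (j : ℕ) ≠ k) (h' : (j : ℕ) ≠ k + 1) :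
      Rel (fs F n k hk * fc F n j) (fc F n j * fs F n k hk)
  | x_c (i : Fin n) : Rel (fx F n i * fc F n i) (-(fc F n i * fx F n i))
  | x_c_far (i j : Fin n) (h : i ≠ j) : Rel (fx F n i * fc F n j) (fc F n j * fx F n i)

/-- The affine Hecke-Clifford algebra `ℌᶜ_n`. -/
def Hc : Type u := RingQuot (Rel F n)

noncomputable instance : Ring (Hc F n) := inferInstanceAs (Ring (RingQuot (Rel F n)))

noncomputable instance : Algebra F (Hc F n) :=
  inferInstanceAs (Algebra F (RingQuot (Rel F n)))

/-- The projection from the free algebra. -/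
noncomputable def Hc.mk : FreeAlgebra F (Gen n Set.univ) →ₐ[F] Hc F n :=
  RingQuot.mkAlgHom F (Rel F n)

theorem Hc.mk_rel {a b : FreeAlgebra F (Gen n Set.univ)} (h : Rel F n a b) :
    Hc.mk F n a = Hc.mk F n b := RingQuot.mkAlgHom_rel F h

variable {F n} in
/-- The universal property of `ℌᶜ_n`. -/
noncomputable def Hc.lift {B : Type v} [Ring B] [Algebra F B]
    (f : FreeAlgebra F (Gen n Set.univ) →ₐ[F] B) (hf : ∀ ⦃a b⦄, Rel F n a b → f a = f b) :
    Hc F n →ₐ[F] B :=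
  RingQuot.liftAlgHom F ⟨f, hf⟩

variable {F n} in
theorem Hc.lift_mk {B : Type v} [Ring B] [Algebra F B]
    (f : FreeAlgebra F (Gen n Set.univ) →ₐ[F] B) (hf : ∀ ⦃a b⦄, Rel F n a b → f a = f b)
    (a : FreeAlgebra F (Gen n Set.univ)) : Hc.lift f hf (Hc.mk F n a) = f a :=
  RingQuot.liftAlgHom_mkAlgHom_apply F f hf a

end Algebra

/-- The generators, as elements of `ℌᶜ_n`. -/
noncomputable def gen (F : Type u) [Field F] {n : ℕ} (g : Gen n Set.univ) : Hc F n :=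
  Hc.mk F n (FreeAlgebra.ι F g)

/-- The parity automorphism of the free superalgebra. -/
noncomputable def freePar (F : Type u) [Field F] (n : ℕ) :
    FreeAlgebra F (Gen n Set.univ) →ₐ[F] FreeAlgebra F (Gen n Set.univ) :=
  FreeAlgebra.lift F fun g => sgn F g.par • FreeAlgebra.ι F g

theorem freePar_rel (F : Type u) [Field F] (n : ℕ) ⦃a b : FreeAlgebra F (Gen n Set.univ)⦄
    (h : Rel F n a b) :
    ((Hc.mk F n).comp (freePar F n)) a = ((Hc.mk F n).comp (freePar F n)) b := by
  have hx (k : Fin n) : freePar F n (fx F n k) = fx F n k := by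
    simp [freePar, fx, Gen.par, sgn]
  have hc (k : Fin n) : freePar F n (fc F n k) = -fc F n k := by
    simp [freePar, fc, Gen.par, sgn]
  have hs (k : ℕ) (hk : k + 1 < n) : freePar F n (fs F n k hk) = fs F n k hk := by
    simp [freePar, fs, Gen.par, sgn]
  have key := Hc.mk_rel F n h
  cases h <;>
    simp only [AlgHom.comp_apply, map_mul, map_neg, map_sub, map_add, map_one, hx, hc, hs,
      neg_mul, mul_neg, neg_neg] at key ⊢ <;>
    first
    | exact key
    | exact congrArg (- ·) key
    | (rw [key, neg_neg]; done)

/-- The parity automorphism of `ℌᶜ_n`: it fixes the `x_k`, `s_k` and negates the `c_k`. -/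
noncomputable def Hc.parity (F : Type u) [Field F] (n : ℕ) : Hc F n →ₐ[F] Hc F n :=
  Hc.lift ((Hc.mk F n).comp (freePar F n)) (freePar_rel F n)

theorem Hc.parity_gen (F : Type u) [Field F] (n : ℕ) (g : Gen n Set.univ) :
    Hc.parity F n (gen F g) = sgn F g.par • gen F g := by
  simp [Hc.parity, gen, Hc.lift_mk, freePar]

theorem Hc.parity_parity (F : Type u) [Field F] (n : ℕ) (h : Hc F n) :
    Hc.parity F n (Hc.parity F n h) = h := by
  have : (Hc.parity F n).comp (Hc.parity F n) = AlgHom.id F (Hc F n) := by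
    refine RingQuot.ringQuot_ext' _ _ _ ?_
    apply FreeAlgebra.hom_ext
    funext g
    change Hc.parity F n (Hc.parity F n (gen F g)) = gen F g
    rw [Hc.parity_gen, map_smul, Hc.parity_gen, smul_smul, sgn_mul_self, one_smul]
  exact DFunLike.congr_fun this h

/-- The homogeneous component of parity `a` of the superalgebra `ℌᶜ_n` (in characteristic
different from `2`). -/
def Hc.deg (F : Type u) [Field F] (n : ℕ) (a : ZMod 2) : Set (Hc F n) :=
  {h | Hc.parity F n h = sgn F a • h}

/-! ### Modules over the superalgebra -/

/-- `gr` makes the `ℌᶜ_n`-module `M` into a `ℤ₂`-graded module over the superalgebra. -/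
structure IsSupermodule (F : Type u) [Field F] (n : ℕ) {M : Type v} [AddCommGroup M]
    [Module F M] [Module (Hc F n) M] (gr : ZMod 2 → Submodule F M) : Prop where
  compl : IsCompl (gr 0) (gr 1)
  smul_mem : ∀ (a b : ZMod 2) (h : Hc F n) (m : M),
    h ∈ Hc.deg F n a → m ∈ gr b → h • m ∈ gr (a + b)

/-- Irreducibility: `M` is nonzero and has no graded submodules but `0` and `M`. -/
def IsIrreducible (F : Type u) [Field F] (n : ℕ) {M : Type v} [AddCommGroup M] [Module F M]
    [Module (Hc F n) M] (gr : ZMod 2 → Submodule F M) : Prop :=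
  Nontrivial M ∧ ∀ N : Submodule (Hc F n) M,
    (∀ m ∈ N, ∃ m₀ ∈ N, ∃ m₁ ∈ N, m₀ ∈ gr 0 ∧ m₁ ∈ gr 1 ∧ m₀ + m₁ = m) → N = ⊥ ∨ N = ⊤

/-- The linear operator on `M` given by the action of an element of `ℌᶜ_n`. -/
noncomputable def act (F : Type u) [Field F] {n : ℕ} (M : Type v) [AddCommGroup M] [Module F M]
    [Module (Hc F n) M] [IsScalarTower F (Hc F n) M] (h : Hc F n) : Module.End F M :=
  Algebra.lsmul F F M h

/-- Membership in `Rep_𝕀 ℌᶜ_n`: `M` is finite dimensional and all eigenvalues of all `x_k²`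
are of the form `q(i)` with `i ∈ 𝕀`. -/
def IsIntegralModule (F : Type u) [Field F] (p n : ℕ) (M : Type v) [AddCommGroup M]
    [Module F M] [Module (Hc F n) M] [IsScalarTower F (Hc F n) M] : Prop :=
  Module.Finite F M ∧ ∀ (k : Fin n) (μ : F),
    (act F M (gen F (Gen.x k) ^ 2 : Hc F n)).HasEigenvalue μ → ∃ i ∈ II p, μ = q F i

/-- `M` is completely splittable: all `x_k` act semisimply. -/
def IsCompletelySplittable (F : Type u) [Field F] (n : ℕ) (M : Type v) [AddCommGroup M]
    [Module F M] [Module (Hc F n) M] [IsScalarTower F (Hc F n) M] : Prop :=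
  ∀ k : Fin n, (act F M (gen F (Gen.x k) : Hc F n)).IsSemisimple

/-! ### Superspaces with operators

Concrete modules are given by a superspace together with the operators by which the
generators act. -/

/-- A superspace with homogeneous operators indexed by the generators `Gen n J`, each of the
parity of its generator. As `2 ≠ 0`, the `ℤ₂`-grading is recorded by the involution `θ` which
is `(-1)^a` on the component of parity `a`. -/
structure SuperRep (F : Type u) [Field F] (n : ℕ) (J : Set ℕ) where
  V : Type v
  [addCommGroup : AddCommGroup V]
  [module : Module F V]
  θ : Module.End F V
  op : Gen n J → Module.End F V
  θ_θ : ∀ v, θ (θ v) = v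
  θ_op : ∀ g v, θ (op g v) = sgn F g.par • op g (θ v)

attribute [instance] SuperRep.addCommGroup SuperRep.module

namespace SuperRep

variable {F : Type u} [Field F] {n : ℕ} {J : Set ℕ}

/-- The homogeneous component of parity `a`. -/
def gr (A : SuperRep.{u, v} F n J) (a : ZMod 2) : Submodule F A.V where
  carrier := {v | A.θ v = sgn F a • v}
  zero_mem' := by simp
  add_mem' := by
    intro v w hv hw
    simp only [Set.mem_ofPred_eq] at hv hw ⊢
    rw [map_add, hv, hw, smul_add]
  smul_mem' := by
    intro r v hv
    simp only [Set.mem_ofPred_eq] at hv ⊢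
    rw [map_smul, hv, smul_comm]

/-- A graded subspace that is stable under the operators. -/
structure Sub (A : SuperRep.{u, v} F n J) where
  N : Submodule F A.V
  θ_mem : ∀ v ∈ N, A.θ v ∈ N
  op_mem : ∀ g, ∀ v ∈ N, A.op g v ∈ N

/-- A stable graded subspace with the restricted operators. -/
def Sub.rep {A : SuperRep.{u, v} F n J} (S : A.Sub) : SuperRep.{u, v} F n J where
  V := S.N
  θ := A.θ.restrict S.θ_mem
  op g := (A.op g).restrict (S.op_mem g)
  θ_θ v := Subtype.ext (A.θ_θ v)
  θ_op g v := Subtype.ext (A.θ_op g v)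

/-- Irreducibility in the graded sense. -/
def Irreducible (A : SuperRep.{u, v} F n J) : Prop :=
  Nontrivial A.V ∧ ∀ S : A.Sub, S.N = ⊥ ∨ S.N = ⊤

/-- `C` is an irreducible component of `A`. -/
def IsComponent (C A : SuperRep.{u, v} F n J) : Prop :=
  C.Irreducible ∧ ∃ S : A.Sub, C = S.rep

/-- The generators of `ℌᶜ_{(m,n)} ≅ ℌᶜ_m ⊗ ℌᶜ_n`, sorted by tensor factors. -/
def split (m n : ℕ) : Gen (m + n) (levi m) → Gen m Set.univ ⊕ Gen n Set.univ
  | .x k => if h : (k : ℕ) < m then .inl (.x ⟨k, h⟩) else .inr (.x ⟨k - m, by omega⟩)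
  | .c k => if h : (k : ℕ) < m then .inl (.c ⟨k, h⟩) else .inr (.c ⟨k - m, by omega⟩)
  | .s k hk hJ =>
      if h : k + 1 < m then .inl (.s k h (Set.mem_univ k))
      else .inr (.s (k - m) (by have : k + 1 ≠ m := hJ; omega) (Set.mem_univ _))

theorem par_split (m n : ℕ) (g : Gen (m + n) (levi m)) :
    Sum.elim Gen.par Gen.par (split m n g) = g.par := by
  cases g <;> simp only [split] <;> split_ifs <;> rfl

/-- The outer tensor product `A ⊠ B` over `ℌᶜ_{(m,n)}`:
`(a ⊗ b)(v ⊗ w) = (-1)^{|b||v|} a v ⊗ b w`. -/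
noncomputable def box {m n : ℕ} (A : SuperRep.{u, v} F m Set.univ)
    (B : SuperRep.{u, w} F n Set.univ) : SuperRep.{u, max v w} F (m + n) (levi m) where
  V := A.V ⊗[F] B.V
  θ := TensorProduct.map A.θ B.θ
  op g := match split m n g with
    | .inl a => TensorProduct.map (A.op a) LinearMap.id
    | .inr b => TensorProduct.map (if b.par = 0 then LinearMap.id else A.θ) (B.op b)
  θ_θ t := by
    induction t with
    | zero => simp
    | tmul v w => simp [A.θ_θ, B.θ_θ]
    | add t t' h h' => rw [map_add, map_add, h, h']
  θ_op g t := by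
    rw [← par_split m n g]
    induction t with
    | zero => simp
    | tmul v w =>
      rcases split m n g with a | b
      · simp [A.θ_op, TensorProduct.smul_tmul']
      · by_cases hb : b.par = 0 <;> simp [hb, B.θ_op, TensorProduct.tmul_smul]
    | add t t' h h' => simp only [map_add, smul_add, h, h']

/-- The relations `h g ⊗ v = h ⊗ g v`, for `g` in the parabolic subalgebra, in `ℌᶜ_n ⊗ A`. -/
noncomputable def indRel (A : SuperRep.{u, v} F n J) : Submodule F (Hc F n ⊗[F] A.V) :=
  Submodule.span F {t | ∃ (h : Hc F n) (g : Gen n J) (z : A.V),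
    t = (h * gen F g.incl) ⊗ₜ[F] z - h ⊗ₜ[F] A.op g z}

theorem par_incl (g : Gen n J) : g.incl.par = g.par := by cases g <;> rfl

theorem indRel_mul (A : SuperRep.{u, v} F n J) (y : Hc F n) :
    A.indRel ≤ A.indRel.comap (TensorProduct.map (LinearMap.mulLeft F y) LinearMap.id) := by
  refine Submodule.span_le.2 ?_
  rintro _ ⟨h, g, z, rfl⟩
  refine Submodule.subset_span ⟨y * h, g, z, ?_⟩
  simp [mul_assoc]

theorem indRel_θ (A : SuperRep.{u, v} F n J) :
    A.indRel ≤ A.indRel.comap (TensorProduct.map (Hc.parity F n).toLinearMap A.θ) := by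
  refine Submodule.span_le.2 ?_
  rintro _ ⟨h, g, z, rfl⟩
  have : TensorProduct.map (Hc.parity F n).toLinearMap A.θ
      ((h * gen F g.incl) ⊗ₜ[F] z - h ⊗ₜ[F] A.op g z)
      = sgn F g.par • ((Hc.parity F n h * gen F g.incl) ⊗ₜ[F] A.θ z
        - Hc.parity F n h ⊗ₜ[F] A.op g (A.θ z)) := by
    simp [Hc.parity_gen, par_incl, A.θ_op, smul_sub, TensorProduct.smul_tmul']
  change _ ∈ A.indRel
  rw [this]
  exact A.indRel.smul_mem _ (Submodule.subset_span ⟨_, _, _, rfl⟩)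

/-- The induced module `ℌᶜ_n ⊗_H A`, where `H` is the subalgebra generated by `Gen n J`. -/
noncomputable def ind (A : SuperRep.{u, v} F n J) : SuperRep.{u, max u v} F n Set.univ where
  V := (Hc F n ⊗[F] A.V) ⧸ A.indRel
  θ := Submodule.mapQ _ _ (TensorProduct.map (Hc.parity F n).toLinearMap A.θ) A.indRel_θ
  op g := Submodule.mapQ _ _ (TensorProduct.map (LinearMap.mulLeft F (gen F g)) LinearMap.id)
    (A.indRel_mul (gen F g))
  θ_θ t := by
    obtain ⟨t, rfl⟩ := Submodule.Quotient.mk_surjective _ t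
    simp only [Submodule.mapQ_apply]
    congr 1
    induction t with
    | zero => simp
    | tmul h z => simp [A.θ_θ, Hc.parity_parity]
    | add t t' h h' => rw [map_add, map_add, h, h']
  θ_op g t := by
    obtain ⟨t, rfl⟩ := Submodule.Quotient.mk_surjective _ t
    simp only [Submodule.mapQ_apply, ← Submodule.Quotient.mk_smul]
    congr 1
    induction t with
    | zero => simp
    | tmul h z => simp [Hc.parity_gen, TensorProduct.smul_tmul']
    | add t t' h h' => simp only [map_add, smul_add, h, h']

/-- The operator
`Ξ = -((x_a + x_b) / d + c_a c_b (x_a - x_b) / d)`,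
where `d` is the scalar by which `x_a² - x_b²` acts. -/
def Xi (A : SuperRep.{u, v} F n J) (a b : Fin n) (d : F) : Module.End F A.V :=
  -(d⁻¹ • (A.op (.x a) + A.op (.x b))
    + d⁻¹ • (A.op (.c a) * A.op (.c b) * (A.op (.x a) - A.op (.x b))))

theorem θ_Xi (A : SuperRep.{u, v} F n J) (a b : Fin n) (d : F) (z : A.V) :
    A.θ (A.Xi a b d z) = A.Xi a b d (A.θ z) := by
  simp [Xi, A.θ_op, Gen.par, sgn]

/-- The operators of `ℌᶜ_{(m, n-m)}` on `A`, extended to `ℌᶜ_n` by letting the remaining simple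
transposition, of `m - 1` and `m`, act as `Ξ`, where `d` is the scalar by which
`x_{m-1}² - x_m²` acts. -/
def extend {m : ℕ} (A : SuperRep.{u, v} F n (levi m)) (d : F) :
    SuperRep.{u, v} F n Set.univ where
  V := A.V
  θ := A.θ
  op
    | .x k => A.op (.x k)
    | .c k => A.op (.c k)
    | .s k hk _ =>
        if h : k + 1 = m then A.Xi ⟨k, by omega⟩ ⟨k + 1, hk⟩ d else A.op (.s k hk h)
  θ_θ := A.θ_θ
  θ_op g z := by
    cases g with
    | x k => exact A.θ_op _ _
    | c k => exact A.θ_op _ _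
    | s k hk hJ =>
      by_cases h : k + 1 = m
      · simp [h, Gen.par, sgn, θ_Xi]
      · simp only [h, dite_false]
        exact A.θ_op (.s k hk h) z

end SuperRep

/-- The supermodule `(M, gr)` over `ℌᶜ_n` is isomorphic to `A`, by an isomorphism `f` that is
homogeneous, of parity `ε`: `f (a m) = (-1)^{ε |a|} a f(m)`. For irreducible finite dimensional
`M` the existence of any isomorphism implies that of a homogeneous one. -/
def IsoTo {F : Type u} [Field F] {n : ℕ} {M : Type v} [AddCommGroup M] [Module F M]
    [Module (Hc F n) M] (gr : ZMod 2 → Submodule F M) (A : SuperRep.{u, w} F n Set.univ) :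
    Prop :=
  ∃ (ε : ZMod 2) (f : M ≃ₗ[F] A.V),
    (∀ a, (gr a).map (f : M →ₗ[F] A.V) = A.gr (a + ε)) ∧
    ∀ (g : Gen n Set.univ) (m : M), f (gen F g • m) = sgn F (ε * g.par) • A.op g (f m)

/-! ### The modules of the classification -/

/-- `L(i_1) ⊠ ⋯ ⊠ L(i_n)`. Here `L(i)` has the basis `v_0` (even), `v_1` (odd) with
`x v_0 = √q(i) v_0`, `x v_1 = -√q(i) v_1`, `c v_0 = v_1`, `c v_1 = v_0`, and a function `f`
stands for `∑ f(b) v_{b_1} ⊗ ⋯ ⊗ v_{b_n}`; the sign in `c_k` comes from moving `c_k` past the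
first factors. The `s_k` do not act (`J = ∅`, or `n = 1`). -/
noncomputable def outerL (F : Type u) [Field F] [IsAlgClosed F] {n : ℕ} (J : Set ℕ)
    (hJ : ∀ k ∈ J, n ≤ k + 1) (i : Fin n → ℕ) : SuperRep.{u, u} F n J where
  V := (Fin n → ZMod 2) → F
  θ := LinearMap.pi fun b => sgn F (∑ l, b l) • LinearMap.proj b
  op
    | .x k => LinearMap.pi fun b => (sgn F (b k) * root (q F (i k))) • LinearMap.proj b
    | .c k => LinearMap.pi fun b =>
        sgn F (∑ l ∈ Finset.univ.filter (· < k), b l) • LinearMap.proj (b + Pi.single k 1)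
    | .s k hk h => absurd hk (Nat.not_lt.2 (hJ k h))
  θ_θ f := by
    funext b
    simp [← mul_assoc, sgn_mul_self]
  θ_op g f := by
    funext b
    cases g with
    | x k => simp [Gen.par, sgn_zero]; ring
    | c k =>
      simp [Gen.par, sgn_one, Finset.sum_add_distrib, sgn_add]
      ring
    | s k hk h => exact absurd hk (Nat.not_lt.2 (hJ k h))

/-- `C` is the irreducible `𝒫ᶜ_n`-module `L(i) = L(i_1) ⊛ ⋯ ⊛ L(i_n)`: an irreducible component
of `L(i_1) ⊠ ⋯ ⊠ L(i_n)`. -/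
def IsL {F : Type u} [Field F] [IsAlgClosed F] {n : ℕ} (i : Fin n → ℕ)
    (C : SuperRep.{u, u} F n ∅) : Prop :=
  C.IsComponent (outerL F ∅ (fun k hk => absurd hk (Set.notMem_empty k)) i)

/-- The module `L(j)` over `𝒫ᶜ_1 = ℌᶜ_1`. -/
noncomputable def L1 (F : Type u) [Field F] [IsAlgClosed F] (j : ℕ) :
    SuperRep.{u, u} F 1 Set.univ :=
  outerL F Set.univ (fun _ _ => by omega) (fun _ => j)

/-- `A` is `V(0,0) = ind L(0) ⊛ L(0)`, induced from `𝒫ᶜ_2` to `ℌᶜ_2`. -/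
def IsV00 {F : Type u} [Field F] [IsAlgClosed F] (A : SuperRep.{u, u} F 2 Set.univ) : Prop :=
  ∃ C : SuperRep.{u, u} F 2 ∅, IsL (fun _ => 0) C ∧ A = C.ind

/-- `A` is `V(0,0) ⊛ L(j)`, an `ℌᶜ_{(2,1)}`-module. -/
def IsV00L {F : Type u} [Field F] [IsAlgClosed F] (j : ℕ) (A : SuperRep.{u, u} F 3 (levi 2)) :
    Prop :=
  ∃ B : SuperRep.{u, u} F 2 Set.univ, IsV00 B ∧ A.IsComponent (B.box (L1 F j))

/-- `A` is `L(j) ⊛ V(0,0)`, an `ℌᶜ_{(1,2)}`-module. -/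
def IsLV00 {F : Type u} [Field F] [IsAlgClosed F] (j : ℕ) (A : SuperRep.{u, u} F 3 (levi 1)) :
    Prop :=
  ∃ B : SuperRep.{u, u} F 2 Set.univ, IsV00 B ∧ A.IsComponent ((L1 F j).box B)

/-! ### Completely splittable modules -/

/-- The simple transposition `s_k`. -/
def simple {n : ℕ} (k : ℕ) (hk : k + 1 < n) : Equiv.Perm (Fin n) :=
  Equiv.swap ⟨k, by omega⟩ ⟨k + 1, hk⟩

/-- The place permutation `τ · i = (i_{τ⁻¹(1)}, …, i_{τ⁻¹(n)})`. -/
def permAct {n : ℕ} (τ : Equiv.Perm (Fin n)) (i : Fin n → ℕ) : Fin n → ℕ := fun k => i (τ⁻¹ k)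

/-- `s_k` is admissible with respect to `i`: `i_k ≠ i_{k+1} ± 1`. -/
def Admissible {n : ℕ} (i : Fin n → ℕ) (k : ℕ) (hk : k + 1 < n) : Prop :=
  i ⟨k, by omega⟩ ≠ i ⟨k + 1, hk⟩ + 1 ∧ i ⟨k, by omega⟩ + 1 ≠ i ⟨k + 1, hk⟩

/-- `τ ∈ P_i`: `τ = s_{k_t} ⋯ s_{k_1}` with each `s_{k_l}` admissible with respect to
`s_{k_{l-1}} ⋯ s_{k_1} · i`. -/
inductive InP {n : ℕ} (i : Fin n → ℕ) : Equiv.Perm (Fin n) → Prop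
  | one : InP i 1
  | step (τ : Equiv.Perm (Fin n)) (k : ℕ) (hk : k + 1 < n) (hτ : InP i τ)
      (h : Admissible (permAct τ i) k hk) : InP i (simple k hk * τ)

/-- The set `W'(ℌᶜ_n)`. -/
structure InW' (p n : ℕ) (i : Fin n → ℕ) : Prop where
  mem : ∀ k, i k ∈ II p
  zero : ∀ k l, k < l → i k = 0 → i l = 0 → ∃ m, k < m ∧ m < l ∧ i m = 1
  char_zero : p = 0 → ∀ k l, k < l → i k = i l → 1 ≤ i k →
    (∃ m, k < m ∧ m < l ∧ i m + 1 = i k) ∧ (∃ m, k < m ∧ m < l ∧ i m = i k + 1)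
  char_pos : 3 ≤ p → ∀ k l, k < l → i k = i l → 1 ≤ i k →
    ((∃ m, k < m ∧ m < l ∧ i m + 1 = i k) ∧ (∃ m, k < m ∧ m < l ∧ i m = i k + 1)) ∨
    ∃ (d : ℕ) (r t : Fin (d + 1) → Fin n) (e : Fin n),
      i k + d = (p - 3) / 2 ∧ StrictMono r ∧ StrictAnti t ∧
      k ≤ r 0 ∧ r (Fin.last d) < e ∧ e < t (Fin.last d) ∧ t 0 ≤ l ∧
      i e = (p - 1) / 2 ∧
      ∀ j : Fin (d + 1), i (r j) = i k + j ∧ i (t j) = i k + j ∧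
        ∀ m, r j < m → m < t j → i m ≠ i k + j

/-- The scalar by which `Ω` acts on a weight space on which the two weights are `a`, `b`. -/
noncomputable def Om (F : Type u) [Field F] [IsAlgClosed F] (a b : ℕ) : F :=
  root (1 - 2 * (q F a + q F b) / (q F a - q F b) ^ 2)

open Classical in
/-- The module `D^i = ⨁_{τ ∈ P_i} L(i)^τ`, where `C = L(i)` and `z^τ` is `Finsupp.single τ z`:
`x_k z^τ = (x_{τ⁻¹(k)} z)^τ`, `c_k z^τ = (c_{τ⁻¹(k)} z)^τ`, and `s_k z^τ` is
`Ξ_k z^τ + Ω_k z^{s_k τ}` or `Ξ_k z^τ` as `s_k` is admissible with respect to `τ · i` or not. -/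
noncomputable def D {F : Type u} [Field F] [IsAlgClosed F] {n : ℕ} (i : Fin n → ℕ)
    (C : SuperRep.{u, v} F n ∅) : SuperRep.{u, v} F n Set.univ where
  V := {τ // InP i τ} →₀ C.V
  θ := Finsupp.lsum F fun τ => Finsupp.lsingle τ ∘ₗ C.θ
  op
    | .x k => Finsupp.lsum F fun τ => Finsupp.lsingle τ ∘ₗ C.op (.x (τ.1⁻¹ k))
    | .c k => Finsupp.lsum F fun τ => Finsupp.lsingle τ ∘ₗ C.op (.c (τ.1⁻¹ k))
    | .s k hk _ => Finsupp.lsum F fun τ =>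
        Finsupp.lsingle τ ∘ₗ C.Xi (τ.1⁻¹ ⟨k, by omega⟩) (τ.1⁻¹ ⟨k + 1, hk⟩)
          (q F (permAct τ.1 i ⟨k, by omega⟩) - q F (permAct τ.1 i ⟨k + 1, hk⟩)) +
        if h : Admissible (permAct τ.1 i) k hk then
          Om F (permAct τ.1 i ⟨k, by omega⟩) (permAct τ.1 i ⟨k + 1, hk⟩) •
            Finsupp.lsingle ⟨simple k hk * τ.1, InP.step τ.1 k hk τ.2 h⟩
        else 0
  θ_θ f := by
    induction f using Finsupp.induction_linear with
    | zero => simp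
    | add f g hf hg => rw [map_add, map_add, hf, hg]
    | single τ z => simp [C.θ_θ]
  θ_op g f := by
    induction f using Finsupp.induction_linear with
    | zero => simp
    | add f g hf hg => simp only [map_add, smul_add, hf, hg]
    | single τ z =>
      cases g with
      | x k => simp [C.θ_op, Gen.par]
      | c k => simp [C.θ_op, Gen.par]
      | s k hk hJ =>
        by_cases h : Admissible (permAct τ.1 i) k hk
        · simp only [h, dite_true, Finsupp.lsum_single, LinearMap.add_apply, map_add,
            LinearMap.comp_apply, Finsupp.lsingle_apply, LinearMap.smul_apply, map_smul,
            SuperRep.θ_Xi, Gen.par, sgn_zero, one_smul]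
        · simp [h, SuperRep.θ_Xi, Gen.par, sgn_zero]

end HeckeClifford

set_option linter.unusedSimpArgs false
set_option linter.unusedSectionVars false

/-! The module is read off from its weights, the joint eigenvalues of the commuting operators
`x_k²`. The tool is the intertwiner `R_k = s_k + (a - b)⁻¹ ν_k`, where `ν_k = x_k + x_{k+1} + c_k
c_{k+1} (x_k - x_{k+1})` and `a ≠ b` are the adjacent entries of a weight. It exchanges the roles of
the indices `k` and `k + 1` in the `x`'s and `c`'s, so it maps the weight space to the one with the
two entries interchanged, and going there and back is the scalar `1 - 2(a + b)/(a - b)²`, the square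
of Ω. For `a = q(i)`, `b = q(j)` with `i ≠ j` in 𝕀 this scalar vanishes exactly when `i = j ± 1`:
admissible transpositions give isomorphisms of weight spaces.

If the scalar vanishes, irreducibility makes `R_k` itself vanish (`R_eq_zero_of_injective`,
`R_eq_zero_of_eq`): the image of `R_k` generates a submodule in which the original weight does not
occur. The proof of this needs a braid relation for intertwiners, obtained by comparing the two
sides of the braid relation of the `s_k` in a single weight space. Where `R_k = 0`, the operator
`s_k` is Ξ.

Equal neighbours are controlled by semisimplicity. The operator `ν_k` is the failure of `s_k` to
exchange `x_k²` and `x_{k+1}²`, so on a weight with two equal adjacent entries it would produce a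
Jordan block; hence it is zero there, and `ν_k² = 2(x_k² + x_{k+1}²)` forces the common entry to be
`0` (`eq_zero_of_adjacent`). The weight with all entries zero is impossible (`wt_zero_eq_bot`).
There remain the labels `(0,0,j)` and `(j,0,0)` with `j ≠ 0`. For `j = 1` the intertwiner vanishes
and the module is a single weight space, which gives V(0,0,1) or V(1,0,0). For `j ≠ 1` the
intertwiners are injective, `(j,0,0)` is moved to `(0,0,j)`, and the module is induced
(`exists_ind`).

If no weight has equal neighbours, take a weight of the module. When its entries are distinct,
normalized intertwiners composed along reduced words identify the module with some D^i
(`word_family`, `Family.exists_equiv`). When it has the shape `(a,b,a)`, either swap would create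
equal neighbours, so both intertwiners vanish; the braid relation between the two Ξ's then says `a =
0` or `3b + a = 0` (`three_mul_add_eq_zero`), and arithmetic in 𝕀 turns this into membership in W'
(`InW'.of_three_mul`).

The concrete modules are recognized inside the given one: a minimal subspace stable under the
polynomial-Clifford part is embedded into an outer tensor product of L's by the matrix coefficients
of an eigenvector in its dual (`exists_component`), and V(0,0) and its outer products are built from
there by the universal property of induction. -/

namespace HeckeClifford

/-! ### Rank one: the element ν and the intertwiner of two adjacent indices -/

section RankOne

variable {F : Type u} [Field F] {M : Type v} [AddCommGroup M] [Module F M]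

/-- Operators satisfying the relations between `x_k, x_{k+1}, c_k, c_{k+1}, s_k`. -/
structure Pair (x y c d s : Module.End F M) : Prop where
  xy : ∀ v, y (x v) = x (y v)
  cc : ∀ v, c (c v) = v
  dd : ∀ v, d (d v) = v
  cd : ∀ v, d (c v) = -c (d v)
  xc : ∀ v, x (c v) = -c (x v)
  xd : ∀ v, x (d v) = d (x v)
  yc : ∀ v, y (c v) = c (y v)
  yd : ∀ v, y (d v) = -d (y v)
  ss : ∀ v, s (s v) = v
  sx : ∀ v, s (x v) = y (s v) - (v + c (d v))
  sc : ∀ v, s (c v) = d (s v)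
  sd : ∀ v, s (d v) = c (s v)

/-- The operator `x + y + c d (x - y)`. -/
def nu (x y c d : Module.End F M) : Module.End F M := x + y + c * d * (x - y)

theorem nu_apply (x y c d : Module.End F M) (v : M) :
    nu x y c d v = x v + y v + c (d (x v - y v)) := rfl

namespace Pair

variable {x y c d s : Module.End F M} (h : Pair x y c d s)
include h

theorem sy (v : M) : s (y v) = x (s v) + (v - c (d v)) := by
  have := congrArg s (h.sx (s v))
  simp only [h.ss, map_sub, map_add, h.sc, h.sd, h.cd] at this
  rw [this]; abel

/-- The product `c d` anticommutes with `x` and with `y` and squares to `-1`, so the mixed terms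
cancel and `(x + y)² + (x - y)²` is left. This is the source of the radicand of Ω. -/
theorem nu_nu (v : M) :
    nu x y c d (nu x y c d v) = (2 : F) • (x (x v) + y (y v)) := by
  simp only [nu_apply, map_add, map_sub, map_neg, h.xy, h.cc, h.dd, h.cd, h.xc, h.xd, h.yc, h.yd]
  module

theorem s_nu (v : M) : s (nu x y c d v) = nu x y c d (s v) := by
  simp only [nu_apply, map_add, map_sub, map_neg, h.sx, h.sy, h.sc, h.sd, h.cc, h.dd, h.cd]
  module

theorem nu_c (v : M) : nu x y c d (c v) = d (nu x y c d v) := by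
  simp only [nu_apply, map_add, map_sub, map_neg, h.cc, h.dd, h.cd, h.xc, h.xd, h.yc, h.yd]
  module

theorem nu_d (v : M) : nu x y c d (d v) = c (nu x y c d v) := by
  simp only [nu_apply, map_add, map_sub, map_neg, h.cc, h.dd, h.cd, h.xc, h.xd, h.yc, h.yd]
  module

/-- Here `ν` appears as the obstruction to `s` exchanging the two squares; this is what links
semisimplicity of the squares to the vanishing of `ν`. -/
theorem s_xx (v : M) : s (x (x v)) = y (y (s v)) - nu x y c d v := by
  simp only [nu_apply, map_add, map_sub, map_neg, h.sx, h.xc, h.xd, h.yc, h.yd]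
  module

theorem s_yy (v : M) : s (y (y v)) = x (x (s v)) + nu x y c d v := by
  simp only [nu_apply, map_add, map_sub, map_neg, h.sy, h.xc, h.xd, h.yc, h.yd]
  module

/-- The intertwiner `s + t (x + y + c d (x - y))`. -/
def _root_.HeckeClifford.twine (x y c d s : Module.End F M) (t : F) : Module.End F M :=
  s + t • nu x y c d

omit h in
theorem _root_.HeckeClifford.twine_apply (x y c d s : Module.End F M) (t : F) (v : M) :
    twine x y c d s t v = s v + t • nu x y c d v := rfl

theorem twine_c (t : F) (v : M) : twine x y c d s t (c v) = d (twine x y c d s t v) := by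
  simp only [twine_apply, h.sc, h.nu_c, map_add, map_smul]

theorem twine_d (t : F) (v : M) : twine x y c d s t (d v) = c (twine x y c d s t v) := by
  simp only [twine_apply, h.sd, h.nu_d, map_add, map_smul]

/-- On a weight vector `ν x - y ν` is `(a - b)(1 + c d)`, which for `t = (a - b)⁻¹` cancels the
error term of the relation between `s` and `x`. -/
theorem twine_x {a b t : F} {v : M} (hx : x (x v) = a • v) (hy : y (y v) = b • v)
    (ht : t * (a - b) = 1) : twine x y c d s t (x v) = y (twine x y c d s t v) := by
  have : nu x y c d (x v) = y (nu x y c d v) + (a - b) • (v + c (d v)) := by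
    simp only [nu_apply, map_add, map_sub, map_neg, h.xy, h.cc, h.dd, h.cd, h.xc, h.xd, h.yc,
      h.yd, hx, hy, map_smul]
    module
  simp only [twine_apply, h.sx, this, map_add, map_smul, smul_add, smul_smul, ht]
  module

theorem twine_y {a b t : F} {v : M} (hx : x (x v) = a • v) (hy : y (y v) = b • v)
    (ht : t * (a - b) = 1) : twine x y c d s t (y v) = x (twine x y c d s t v) := by
  have : nu x y c d (y v) = x (nu x y c d v) - (a - b) • (v - c (d v)) := by
    simp only [nu_apply, map_add, map_sub, map_neg, h.xy, h.cc, h.dd, h.cd, h.xc, h.xd, h.yc,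
      h.yd, hx, hy, map_smul]
    module
  simp only [twine_apply, h.sy, this, map_add, map_smul, smul_sub, smul_smul, ht]
  module

/-- The outer factor carries `-t` because the first intertwiner has interchanged the two weights,
which changes the sign of `(a - b)⁻¹`. As `s` commutes with `ν`, the product is a difference of
squares. -/
theorem twine_twine {a b t : F} {v : M} (hx : x (x v) = a • v) (hy : y (y v) = b • v) :
    twine x y c d s (-t) (twine x y c d s t v) = (1 - t ^ 2 * (2 * (a + b))) • v := by
  simp only [twine_apply, map_add, map_smul, h.ss, h.s_nu, h.nu_nu, hx, hy]
  module

end Pair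

end RankOne

end HeckeClifford

/-! ### Weight spaces and intertwiners for three indices -/

namespace HeckeClifford

/-- The adjacent transpositions in `S_3`. -/
def tr (k : Fin 2) : Equiv.Perm (Fin 3) := Equiv.swap k.castSucc k.succ

/-- A superspace with operators satisfying the relations of `ℌᶜ_3`; the grading is given by
the involution `θ`. -/
structure Sys (F : Type u) [Field F] (M : Type v) [AddCommGroup M] [Module F M] where
  x : Fin 3 → Module.End F M
  c : Fin 3 → Module.End F M
  s : Fin 2 → Module.End F M
  θ : Module.End F M
  xx : ∀ i j v, x i (x j v) = x j (x i v)
  cc : ∀ i v, c i (c i v) = v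
  cd : ∀ i j, i ≠ j → ∀ v, c i (c j v) = -c j (c i v)
  xc : ∀ i v, x i (c i v) = -c i (x i v)
  xd : ∀ i j, i ≠ j → ∀ v, x i (c j v) = c j (x i v)
  ss : ∀ k v, s k (s k v) = v
  sx : ∀ k v, s k (x k.castSucc v) =
    x k.succ (s k v) - (v + c k.castSucc (c k.succ v))
  sc : ∀ k v, s k (c k.castSucc v) = c k.succ (s k v)
  sd : ∀ k v, s k (c k.succ v) = c k.castSucc (s k v)
  sx_far : ∀ k j, j ≠ k.castSucc → j ≠ k.succ → ∀ v, s k (x j v) = x j (s k v)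
  sc_far : ∀ k j, j ≠ k.castSucc → j ≠ k.succ → ∀ v, s k (c j v) = c j (s k v)
  braid : ∀ v, s 0 (s 1 (s 0 v)) = s 1 (s 0 (s 1 v))
  θθ : ∀ v, θ (θ v) = v
  θx : ∀ i v, θ (x i v) = x i (θ v)
  θc : ∀ i v, θ (c i v) = -c i (θ v)
  θs : ∀ k v, θ (s k v) = s k (θ v)

namespace Sys

variable {F : Type u} [Field F] {M : Type v} [AddCommGroup M] [Module F M] (S : Sys F M)

theorem pair (k : Fin 2) :
    Pair (S.x k.castSucc) (S.x k.succ) (S.c k.castSucc) (S.c k.succ) (S.s k) := by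
  have hne : k.castSucc ≠ k.succ := k.castSucc_lt_succ.ne
  exact
  { xy := fun v => S.xx _ _ v
    cc := S.cc _
    dd := S.cc _
    cd := S.cd _ _ hne.symm
    xc := S.xc _
    xd := S.xd _ _ hne
    yc := S.xd _ _ hne.symm
    yd := S.xc _
    ss := S.ss k
    sx := S.sx k
    sc := S.sc k
    sd := S.sd k }

theorem braid' {k l : Fin 2} (h : k ≠ l) (v : M) :
    S.s k (S.s l (S.s k v)) = S.s l (S.s k (S.s l v)) := by
  fin_cases k <;> fin_cases l <;> first | exact absurd rfl h | exact S.braid v |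
    exact (S.braid v).symm

/-- Graded subspaces stable under the `x_k` and the `c_k`. -/
structure PStable (N : Submodule F M) : Prop where
  x : ∀ k, ∀ v ∈ N, S.x k v ∈ N
  c : ∀ k, ∀ v ∈ N, S.c k v ∈ N
  θ : ∀ v ∈ N, S.θ v ∈ N

/-- `M` has no proper nonzero graded stable subspaces. -/
def Irr : Prop := Nontrivial M ∧
  ∀ N : Submodule F M, S.PStable N → (∀ k, ∀ v ∈ N, S.s k v ∈ N) → N = ⊥ ∨ N = ⊤

/-- The `x_k ^ 2` have no Jordan blocks of size two. -/
def SS : Prop := ∀ k (a : F) (v w : M),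
  S.x k (S.x k v) = a • v + w → S.x k (S.x k w) = a • w → w = 0

/-- The joint eigenspaces of the `x_k ^ 2`. -/
def wt (β : Fin 3 → F) : Submodule F M where
  carrier := {v | ∀ k, S.x k (S.x k v) = β k • v}
  zero_mem' := by simp
  add_mem' := by
    intro v w hv hw k
    rw [map_add, map_add, hv k, hw k, smul_add]
  smul_mem' := by
    intro r v hv k
    rw [map_smul, map_smul, hv k, smul_comm]

variable {S}

theorem wt_pstable (β : Fin 3 → F) : S.PStable (S.wt β) where
  x k v hv m := by rw [S.xx m k, S.xx m k, hv m, map_smul]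
  c k v hv m := by
    by_cases h : m = k
    · subst h; rw [S.xc, map_neg, S.xc, neg_neg, hv m, map_smul]
    · rw [S.xd _ _ h, S.xd _ _ h, hv m, map_smul]
  θ v hv m := by rw [← S.θx, ← S.θx, hv m, map_smul]

theorem PStable.sup {N N' : Submodule F M} (h : S.PStable N) (h' : S.PStable N') :
    S.PStable (N ⊔ N') := by
  have aux (f : Module.End F M) (hN : ∀ v ∈ N, f v ∈ N) (hN' : ∀ v ∈ N', f v ∈ N') :
      ∀ v ∈ N ⊔ N', f v ∈ N ⊔ N' := by
    intro v hv
    obtain ⟨a, ha, b, hb, rfl⟩ := Submodule.mem_sup.1 hv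
    rw [map_add]
    exact Submodule.add_mem_sup (hN a ha) (hN' b hb)
  exact ⟨fun k => aux _ (h.x k) (h'.x k), fun k => aux _ (h.c k) (h'.c k), aux _ h.θ h'.θ⟩

theorem PStable.nu {N : Submodule F M} (h : S.PStable N) (a b : Fin 3) {v : M} (hv : v ∈ N) :
    nu (S.x a) (S.x b) (S.c a) (S.c b) v ∈ N := by
  rw [nu_apply]
  exact N.add_mem (N.add_mem (h.x _ _ hv) (h.x _ _ hv))
    (h.c _ _ (h.c _ _ (N.sub_mem (h.x _ _ hv) (h.x _ _ hv))))

variable (S) in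
/-- The operator `x_k + x_{k+1} + c_k c_{k+1} (x_k - x_{k+1})`. -/
def ν (k : Fin 2) : Module.End F M :=
  HeckeClifford.nu (S.x k.castSucc) (S.x k.succ) (S.c k.castSucc) (S.c k.succ)

variable (S) in
/-- The intertwiner on the weight space of weight `β`. -/
def R (k : Fin 2) (β : Fin 3 → F) : Module.End F M :=
  twine (S.x k.castSucc) (S.x k.succ) (S.c k.castSucc) (S.c k.succ) (S.s k)
    (β k.castSucc - β k.succ)⁻¹

theorem R_apply (k : Fin 2) (β : Fin 3 → F) (v : M) :
    S.R k β v = S.s k v + (β k.castSucc - β k.succ)⁻¹ • S.ν k v := rfl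

theorem s_eq (k : Fin 2) (β : Fin 3 → F) (v : M) :
    S.s k v = S.R k β v - (β k.castSucc - β k.succ)⁻¹ • S.ν k v := by
  rw [R_apply, add_sub_cancel_right]

theorem PStable.ν {N : Submodule F M} (h : S.PStable N) (k : Fin 2) {v : M} (hv : v ∈ N) :
    S.ν k v ∈ N := h.nu _ _ hv

theorem PStable.s_mem {N : Submodule F M} (h : S.PStable N) {k : Fin 2} {β : Fin 3 → F} {v : M}
    (hv : v ∈ N) (hR : S.R k β v ∈ N) : S.s k v ∈ N := by
  rw [s_eq k β]
  exact N.sub_mem hR (N.smul_mem _ (h.ν k hv))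

theorem tr_castSucc (k : Fin 2) : tr k k.castSucc = k.succ := Equiv.swap_apply_left _ _
theorem tr_succ (k : Fin 2) : tr k k.succ = k.castSucc := Equiv.swap_apply_right _ _
theorem tr_far {k : Fin 2} {m : Fin 3} (h : m ≠ k.castSucc) (h' : m ≠ k.succ) : tr k m = m :=
  Equiv.swap_apply_of_ne_of_ne h h'

theorem R_c (k : Fin 2) (β : Fin 3 → F) (m : Fin 3) (v : M) :
    S.R k β (S.c m v) = S.c (tr k m) (S.R k β v) := by
  by_cases h : m = k.castSucc
  · subst h; rw [tr_castSucc]; exact (S.pair k).twine_c _ v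
  by_cases h' : m = k.succ
  · subst h'; rw [tr_succ]; exact (S.pair k).twine_d _ v
  · rw [tr_far h h']
    simp only [R_apply, ν, nu_apply, map_add, map_sub, map_smul, S.sc_far k m h h',
      S.xd _ _ (Ne.symm h), S.xd _ _ (Ne.symm h'), S.cd m _ h, S.cd m _ h', map_neg, neg_neg]

theorem R_x (k : Fin 2) {β : Fin 3 → F} (hβ : β k.castSucc ≠ β k.succ) (m : Fin 3) {v : M}
    (hv : v ∈ S.wt β) : S.R k β (S.x m v) = S.x (tr k m) (S.R k β v) := by
  have ht := inv_mul_cancel₀ (sub_ne_zero.2 hβ)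
  by_cases h : m = k.castSucc
  · subst h; rw [tr_castSucc]; exact (S.pair k).twine_x (hv _) (hv _) ht
  by_cases h' : m = k.succ
  · subst h'; rw [tr_succ]; exact (S.pair k).twine_y (hv _) (hv _) ht
  · rw [tr_far h h']
    simp only [R_apply, ν, nu_apply, map_add, map_sub, map_smul, S.sx_far k m h h',
      S.xd _ _ h, S.xd _ _ h', S.xx m]

theorem R_θ (k : Fin 2) (β : Fin 3 → F) (v : M) : S.R k β (S.θ v) = S.θ (S.R k β v) := by
  simp only [R_apply, ν, nu_apply, map_add, map_sub, map_smul, S.θs, S.θx, S.θc, map_neg, neg_neg]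

theorem R_mem (k : Fin 2) {β : Fin 3 → F} (hβ : β k.castSucc ≠ β k.succ) {v : M}
    (hv : v ∈ S.wt β) : S.R k β v ∈ S.wt (β ∘ tr k) := by
  intro m
  have h2 : tr k (tr k m) = m := Equiv.swap_apply_self _ _ _
  have := R_x k hβ (tr k m) ((wt_pstable β).x (tr k m) v hv)
  rw [R_x k hβ (tr k m) hv, h2] at this
  rw [← this, hv, map_smul, Function.comp]

theorem R_R (k : Fin 2) {β : Fin 3 → F} {v : M} (hv : v ∈ S.wt β) :
    S.R k (β ∘ tr k) (S.R k β v) =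
      (1 - 2 * (β k.castSucc + β k.succ) / (β k.castSucc - β k.succ) ^ 2) • v := by
  have := (S.pair k).twine_twine (t := (β k.castSucc - β k.succ)⁻¹) (hv k.castSucc) (hv k.succ)
  have e : -(β k.castSucc - β k.succ)⁻¹ = ((β ∘ tr k) k.castSucc - (β ∘ tr k) k.succ)⁻¹ := by
    simp only [Function.comp, tr_castSucc, tr_succ]
    rw [← inv_neg, neg_sub]
  rw [e] at this
  unfold R
  rw [this]
  congr 1
  rw [inv_pow]; ring

theorem s_mem (k : Fin 2) {β : Fin 3 → F} (hβ : β k.castSucc ≠ β k.succ) {v : M}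
    (hv : v ∈ S.wt β) : S.s k v ∈ S.wt β ⊔ S.wt (β ∘ tr k) := by
  rw [s_eq k β]
  exact Submodule.sub_mem _ (Submodule.mem_sup_right (R_mem k hβ hv))
    (Submodule.mem_sup_left (Submodule.smul_mem _ _ ((wt_pstable β).ν k hv)))

/-- On a weight space with equal adjacent weights, `ν` vanishes. -/
theorem ν_eq_zero (hS : S.SS) {k : Fin 2} {β : Fin 3 → F} (hβ : β k.castSucc = β k.succ) {v : M}
    (hv : v ∈ S.wt β) : S.ν k v = 0 := by
  have hν := (wt_pstable β).ν k hv
  -- By `s_xx`, the vectors `s v` and `ν v` would span a Jordan block of `x_{k+1}²`, up to the sign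
  -- of `ν v`.
  refine hS k.succ (β k.succ) (S.s k v) _ ?_ (hν _)
  have := (S.pair k).s_xx v
  rw [hv, map_smul, hβ] at this
  rw [this]
  exact (sub_add_cancel _ _).symm

/-- With `ν v = 0` the operator `s_k` exchanges the two squares on `v` exactly, and their
eigenvalues agree. -/
theorem s_mem_of_eq (hS : S.SS) {k : Fin 2} {β : Fin 3 → F} (hβ : β k.castSucc = β k.succ)
    {v : M} (hv : v ∈ S.wt β) : S.s k v ∈ S.wt β := by
  have h0 : HeckeClifford.nu _ _ _ _ v = 0 := ν_eq_zero hS hβ hv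
  have h1 := (S.pair k).s_xx v
  have h2 := (S.pair k).s_yy v
  rw [h0, sub_zero, hv, map_smul] at h1
  rw [h0, add_zero, hv, map_smul] at h2
  intro m
  by_cases h : m = k.castSucc
  · subst h; rw [← h2, hβ]
  by_cases h' : m = k.succ
  · subst h'; rw [← h1, hβ]
  · rw [← S.sx_far k m h h', ← S.sx_far k m h h', hv, map_smul]

/-- Since `ν` vanishes, so does its square, which acts on `v` as four times the common entry. -/
theorem eq_zero_of_adjacent (hS : S.SS) (h2 : (2 : F) ≠ 0) {k : Fin 2} {β : Fin 3 → F}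
    (hβ : β k.castSucc = β k.succ) {v : M} (hv : v ∈ S.wt β) (hv0 : v ≠ 0) :
    β k.castSucc = 0 := by
  have h0 : HeckeClifford.nu _ _ _ _ v = 0 := ν_eq_zero hS hβ hv
  have := (S.pair k).nu_nu v
  rw [h0, map_zero, hv, hv, ← hβ, ← two_smul F, smul_smul, smul_smul] at this
  simpa [hv0, h2] using this.symm

/-- `x_k = c_k c_{k+1} x_{k+1}` on a weight space with equal adjacent weights. -/
theorem x_eq_of_adjacent (hS : S.SS) (h2 : (2 : F) ≠ 0) {k : Fin 2} {β : Fin 3 → F}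
    (hβ : β k.castSucc = β k.succ) {v : M} (hv : v ∈ S.wt β) :
    S.x k.castSucc v = S.c k.castSucc (S.c k.succ (S.x k.succ v)) := by
  have h0 : HeckeClifford.nu _ _ _ _ v = 0 := ν_eq_zero hS hβ hv
  have h := S.pair k
  have e1 := congrArg (fun w => w - S.c k.castSucc (S.c k.succ w)) h0
  simp only [nu_apply, map_sub, map_add, h.cc, h.dd, h.cd, map_neg, map_zero, sub_zero] at e1
  have : (2 : F) • (S.x k.castSucc v - S.c k.castSucc (S.c k.succ (S.x k.succ v))) = 0 := by
    rw [← e1]; module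
  exact sub_eq_zero.1 ((smul_eq_zero.1 this).resolve_left h2)

variable (S) in
/-- The sum of all weight spaces but one. -/
def off (β : Fin 3 → F) : Submodule F M := ⨆ γ, ⨆ _ : γ ≠ β, S.wt γ

theorem wt_le_off {β γ : Fin 3 → F} (h : γ ≠ β) : S.wt γ ≤ S.off β :=
  le_iSup₂_of_le γ h le_rfl

/-- Joint generalized eigenspaces of commuting operators are independent. All later arguments that
compare components of one weight pass through this. -/
theorem wt_disjoint_off (β : Fin 3 → F) : Disjoint (S.wt β) (S.off β) := by
  have comm : ∀ i j φ, Set.MapsTo (S.x i ^ 2 : Module.End F M)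
      ((S.x j ^ 2 : Module.End F M).maxGenEigenspace φ)
      ((S.x j ^ 2 : Module.End F M).maxGenEigenspace φ) := fun i j φ =>
    Module.End.mapsTo_maxGenEigenspace_of_comm
      (Commute.pow_pow (LinearMap.ext fun v => S.xx j i v) 2 2) φ
  have hind := Module.End.independent_iInf_maxGenEigenspace_of_forall_mapsTo
    (fun k => (S.x k ^ 2 : Module.End F M)) comm
  have hle (γ : Fin 3 → F) :
      S.wt γ ≤ ⨅ k, (S.x k ^ 2 : Module.End F M).maxGenEigenspace (γ k) := by
    intro v hv
    rw [Submodule.mem_iInf]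
    intro k
    refine Module.End.mem_maxGenEigenspace _ _ _ |>.2 ⟨1, ?_⟩
    rw [pow_one, LinearMap.sub_apply, pow_two, Module.End.mul_apply, hv k]
    simp
  exact (hind β).mono (hle β) (iSup₂_mono fun γ _ => hle γ)

theorem eq_zero_of_mem_off {β : Fin 3 → F} {v : M} (hv : v ∈ S.wt β) (hv' : v ∈ S.off β) :
    v = 0 := Submodule.disjoint_def.1 (wt_disjoint_off β) v hv hv'

end Sys

end HeckeClifford

/-! ### Braid relations and the vanishing of intertwiners -/

namespace HeckeClifford

theorem tr_tr (k : Fin 2) : tr k * tr k = 1 := Equiv.swap_mul_self _ _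

theorem comp_tr_tr {α : Type*} (β : Fin 3 → α) (k : Fin 2) : (β ∘ tr k) ∘ tr k = β := by
  rw [Function.comp_assoc, ← Equiv.Perm.coe_mul, tr_tr]; rfl

theorem tr_braid {k l : Fin 2} (h : k ≠ l) : tr k * tr l * tr k = tr l * tr k * tr l := by
  revert k l; decide

theorem comp_braid {α : Type*} (β : Fin 3 → α) {k l : Fin 2} (h : k ≠ l) :
    ((β ∘ tr k) ∘ tr l) ∘ tr k = ((β ∘ tr l) ∘ tr k) ∘ tr l := by
  change β ∘ ⇑(tr k * tr l * tr k) = β ∘ ⇑(tr l * tr k * tr l)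
  rw [tr_braid h]

theorem tr_word_ne {k l : Fin 2} (h : k ≠ l) :
    1 ≠ tr k * tr l * tr k ∧ 1 * tr k ≠ tr k * tr l * tr k ∧ 1 * tr l ≠ tr k * tr l * tr k ∧
    1 * tr l * tr k ≠ tr k * tr l * tr k ∧ tr k ≠ tr k * tr l * tr k ∧
    tr k * tr k ≠ tr k * tr l * tr k ∧ tr k * tr l ≠ tr k * tr l * tr k := by
  revert k l; decide

theorem tr_ne_one (k : Fin 2) : tr k ≠ 1 := by revert k; decide

theorem tr_mul_tr_ne_one {k l : Fin 2} (h : k ≠ l) : tr k * tr l ≠ 1 := by revert k l; decide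

theorem exists_ne_index (k : Fin 2) : ∃ l, k ≠ l := by revert k; decide

theorem eq_or_eq_of_ne {k l : Fin 2} (h : k ≠ l) (m : Fin 2) : m = k ∨ m = l := by
  revert k l m; decide

theorem adjacent_eq_of_comp {α : Type*} {β : Fin 3 → α} {k : Fin 2} (h : β ∘ tr k = β) :
    β k.castSucc = β k.succ := by
  have := congrFun h k.succ
  rwa [Function.comp, Sys.tr_succ] at this

theorem comp_tr_of_eq {α : Type*} {β : Fin 3 → α} {k : Fin 2} (h : β k.castSucc = β k.succ) :
    β ∘ tr k = β := by
  funext m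
  by_cases h1 : m = k.castSucc
  · subst h1; rw [Function.comp, Sys.tr_castSucc, h]
  by_cases h2 : m = k.succ
  · subst h2; rw [Function.comp, Sys.tr_succ, h]
  · rw [Function.comp, Sys.tr_far h1 h2]

namespace Sys

variable {F : Type u} [Field F] {M : Type v} [AddCommGroup M] [Module F M] {S : Sys F M}

theorem adjacent_ne {α : Fin 3 → F} (hα : Function.Injective α) (k : Fin 2) :
    α k.castSucc ≠ α k.succ := fun h => k.castSucc_lt_succ.ne (hα h)

theorem injective_comp_tr {α : Fin 3 → F} (hα : Function.Injective α) (k : Fin 2) :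
    Function.Injective (α ∘ tr k) := hα.comp (tr k).injective

/-- Replacing each intertwiner by `s` plus a multiple of `ν` leaves the word in the `s`'s and terms
with at least one `ν`. Since `ν` preserves weights, such a term moves the weight by at most two
transpositions and cannot reach the weight belonging to the longest permutation. -/
theorem R_word_sub_mem_off {α : Fin 3 → F} (hα : Function.Injective α) {k l : Fin 2}
    (h : k ≠ l) {z : M} (hz : z ∈ S.wt α) :
    S.R k ((α ∘ tr k) ∘ tr l) (S.R l (α ∘ tr k) (S.R k α z)) - S.s k (S.s l (S.s k z)) ∈
      S.off (((α ∘ tr k) ∘ tr l) ∘ tr k) := by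
  have key (π : Equiv.Perm (Fin 3)) (hπ : π ≠ tr k * tr l * tr k) :
      S.wt (α ∘ ⇑π) ≤ S.off (((α ∘ tr k) ∘ tr l) ∘ tr k) := by
    refine wt_le_off fun he => hπ ?_
    ext1 m
    exact hα (congrFun he m)
  have hs (m : Fin 2) (π : Equiv.Perm (Fin 3)) {v : M} (hv : v ∈ S.wt (α ∘ ⇑π)) :
      S.s m v ∈ S.wt (α ∘ ⇑π) ⊔ S.wt (α ∘ ⇑(π * tr m)) :=
    S.s_mem m (adjacent_ne (hα.comp π.injective) m) hv
  have hs' (m : Fin 2) (π : Equiv.Perm (Fin 3)) (h1 : π ≠ tr k * tr l * tr k)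
      (h2 : π * tr m ≠ tr k * tr l * tr k) {v : M} (hv : v ∈ S.wt (α ∘ ⇑π)) :
      S.s m v ∈ S.off (((α ∘ tr k) ∘ tr l) ∘ tr k) :=
    sup_le (key _ h1) (key _ h2) (hs m π hv)
  have ha : S.R k α z ∈ S.wt (α ∘ ⇑(tr k)) := R_mem k (adjacent_ne hα k) hz
  have hb : S.R l (α ∘ tr k) (S.R k α z) ∈ S.wt (α ∘ ⇑(tr k * tr l)) :=
    R_mem l (adjacent_ne (injective_comp_tr hα k) l) ha
  have hc : S.ν k z ∈ S.wt (α ∘ ⇑(1 : Equiv.Perm (Fin 3))) := (wt_pstable α).ν k hz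
  obtain ⟨p, hp, q, hq, hpq⟩ := Submodule.mem_sup.1 (hs l 1 hc)
  obtain ⟨d1, d2, d3, d4, d5, d6, d7⟩ := tr_word_ne h
  have m1 : S.s k (S.s l (S.ν k z)) ∈ S.off (((α ∘ tr k) ∘ tr l) ∘ tr k) := by
    rw [← hpq, map_add]
    exact Submodule.add_mem _ (hs' k 1 d1 d2 hp) (hs' k _ d3 d4 hq)
  have m2 : S.s k (S.ν l (S.R k α z)) ∈ S.off (((α ∘ tr k) ∘ tr l) ∘ tr k) :=
    hs' k _ d5 d6 ((wt_pstable _).ν l ha)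
  have m3 : S.ν k (S.R l (α ∘ tr k) (S.R k α z)) ∈ S.off (((α ∘ tr k) ∘ tr l) ∘ tr k) :=
    key _ d7 ((wt_pstable _).ν k hb)
  have e : S.R k ((α ∘ tr k) ∘ tr l) (S.R l (α ∘ tr k) (S.R k α z)) - S.s k (S.s l (S.s k z)) =
      (α k.castSucc - α k.succ)⁻¹ • S.s k (S.s l (S.ν k z)) +
      ((α ∘ tr k) l.castSucc - (α ∘ tr k) l.succ)⁻¹ • S.s k (S.ν l (S.R k α z)) +
      (((α ∘ tr k) ∘ tr l) k.castSucc - ((α ∘ tr k) ∘ tr l) k.succ)⁻¹ •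
        S.ν k (S.R l (α ∘ tr k) (S.R k α z)) := by
    rw [R_apply k ((α ∘ tr k) ∘ tr l)]
    nth_rewrite 1 [R_apply l (α ∘ tr k)]
    rw [map_add, map_smul]
    nth_rewrite 1 [R_apply k α]
    rw [map_add, map_add, map_smul, map_smul]
    abel
  rw [e]
  exact Submodule.add_mem _ (Submodule.add_mem _ (Submodule.smul_mem _ _ m1)
    (Submodule.smul_mem _ _ m2)) (Submodule.smul_mem _ _ m3)

/-- The intertwiners satisfy the braid relation on weight spaces of distinct weights. -/
theorem R_braid {α : Fin 3 → F} (hα : Function.Injective α) {k l : Fin 2}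
    (h : k ≠ l) {z : M} (hz : z ∈ S.wt α) :
    S.R k ((α ∘ tr k) ∘ tr l) (S.R l (α ∘ tr k) (S.R k α z)) =
      S.R l ((α ∘ tr l) ∘ tr k) (S.R k (α ∘ tr l) (S.R l α z)) := by
  have h1 := R_word_sub_mem_off hα h hz
  have h2 := R_word_sub_mem_off hα h.symm hz
  rw [← comp_braid α h, ← S.braid' h] at h2
  -- Both words in the intertwiners are congruent to the same word in the `s`'s, so their difference
  -- lies both in the target weight space and in the sum of the others.
  have h3 := Submodule.sub_mem _ h1 h2
  rw [sub_sub_sub_cancel_right] at h3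
  have w (k l : Fin 2) : S.R k ((α ∘ tr k) ∘ tr l) (S.R l (α ∘ tr k) (S.R k α z)) ∈
      S.wt (((α ∘ tr k) ∘ tr l) ∘ tr k) :=
    R_mem k (adjacent_ne (injective_comp_tr (injective_comp_tr hα k) l) k)
      (R_mem l (adjacent_ne (injective_comp_tr hα k) l) (R_mem k (adjacent_ne hα k) hz))
  have w' := w l k
  rw [← comp_braid α h] at w'
  exact sub_eq_zero.1 (eq_zero_of_mem_off (Submodule.sub_mem _ (w k l) w') h3)

theorem PStable.map_R {N : Submodule F M} (h : S.PStable N) {k : Fin 2} {β : Fin 3 → F}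
    (hβ : β k.castSucc ≠ β k.succ) (hN : N ≤ S.wt β) : S.PStable (N.map (S.R k β)) where
  x m := by
    rintro _ ⟨v, hv, rfl⟩
    refine ⟨S.x (tr k m) v, h.x _ _ hv, ?_⟩
    rw [R_x k hβ _ (hN hv), ← Equiv.Perm.mul_apply, tr_tr, Equiv.Perm.one_apply]
  c m := by
    rintro _ ⟨v, hv, rfl⟩
    refine ⟨S.c (tr k m) v, h.c _ _ hv, ?_⟩
    rw [R_c k, ← Equiv.Perm.mul_apply, tr_tr, Equiv.Perm.one_apply]
  θ := by
    rintro _ ⟨v, hv, rfl⟩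
    exact ⟨S.θ v, h.θ _ hv, R_θ _ _ _⟩

theorem map_R_le {N : Submodule F M} {k : Fin 2} {β : Fin 3 → F}
    (hβ : β k.castSucc ≠ β k.succ) (hN : N ≤ S.wt β) :
    N.map (S.R k β) ≤ S.wt (β ∘ tr k) := by
  rintro _ ⟨v, hv, rfl⟩
  exact R_mem k hβ (hN hv)

theorem R_R_eq_zero {k : Fin 2} {β : Fin 3 → F} (hβ : β k.castSucc ≠ β k.succ)
    (hΩ : 2 * (β k.castSucc + β k.succ) = (β k.castSucc - β k.succ) ^ 2) {v : M}
    (hv : v ∈ S.wt β) : S.R k (β ∘ tr k) (S.R k β v) = 0 := by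
  rw [R_R k hv, hΩ, div_self (pow_ne_zero 2 (sub_ne_zero.2 hβ)), sub_self, zero_smul]

/-- If the square of an intertwiner vanishes on a weight space of distinct weights, then so does
the intertwiner. -/
theorem R_eq_zero_of_injective (hirr : S.Irr) {α : Fin 3 → F} (hα : Function.Injective α)
    {k : Fin 2} (hΩ : 2 * (α k.castSucc + α k.succ) = (α k.castSucc - α k.succ) ^ 2) {z : M}
    (hz : z ∈ S.wt α) : S.R k α z = 0 := by
  obtain ⟨l, h⟩ : ∃ l, k ≠ l := exists_ne_index k
  have n0 := adjacent_ne hα k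
  have n1 := adjacent_ne (injective_comp_tr hα k)
  have n2 := adjacent_ne (injective_comp_tr (injective_comp_tr hα k) l)
  -- `U`, `V`, `W` are the successive images under `R_k`, `R_l`, `R_k`. Their sum is a submodule:
  -- `R_k` kills `U`, going back along the chain is a scalar, and `R_l` kills `W` because the braid
  -- relation pulls `R_k R_k = 0` to the front. None of the three weights is `α`, so the sum is zero
  -- or the space of weight `α` is.
  set U := (S.wt α).map (S.R k α) with hU
  have Uw : U ≤ S.wt (α ∘ tr k) := map_R_le n0 le_rfl
  have Up : S.PStable U := (wt_pstable α).map_R n0 le_rfl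
  set V := U.map (S.R l (α ∘ tr k)) with hV
  have Vw : V ≤ S.wt ((α ∘ tr k) ∘ tr l) := map_R_le (n1 l) Uw
  have Vp : S.PStable V := Up.map_R (n1 l) Uw
  set W := V.map (S.R k ((α ∘ tr k) ∘ tr l)) with hW
  have Ww : W ≤ S.wt (((α ∘ tr k) ∘ tr l) ∘ tr k) := map_R_le (n2 k) Vw
  have Wp : S.PStable W := Vp.map_R (n2 k) Vw
  have Yp : S.PStable (U ⊔ V ⊔ W) := (Up.sup Vp).sup Wp
  have lU : U ≤ U ⊔ V ⊔ W := le_sup_left.trans le_sup_left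
  have lV : V ≤ U ⊔ V ⊔ W := le_sup_right.trans le_sup_left
  have lW : W ≤ U ⊔ V ⊔ W := le_sup_right
  have ks : U ⊔ V ⊔ W ≤ (U ⊔ V ⊔ W).comap (S.s k) := by
    refine sup_le (sup_le ?_ ?_) ?_
    · rintro _ ⟨v, hv, rfl⟩
      refine Yp.s_mem (β := α ∘ tr k) (lU ⟨v, hv, rfl⟩) ?_
      rw [R_R_eq_zero n0 hΩ hv]
      exact zero_mem _
    · intro v hv
      exact Yp.s_mem (β := (α ∘ tr k) ∘ tr l) (lV hv) (lW ⟨v, hv, rfl⟩)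
    · rintro _ ⟨v, hv, rfl⟩
      refine Yp.s_mem (β := ((α ∘ tr k) ∘ tr l) ∘ tr k) (lW ⟨v, hv, rfl⟩) ?_
      rw [R_R k (Vw hv)]
      exact Submodule.smul_mem _ _ (lV hv)
  have ls : U ⊔ V ⊔ W ≤ (U ⊔ V ⊔ W).comap (S.s l) := by
    refine sup_le (sup_le ?_ ?_) ?_
    · intro v hv
      exact Yp.s_mem (β := α ∘ tr k) (lU hv) (lV ⟨v, hv, rfl⟩)
    · rintro _ ⟨v, hv, rfl⟩
      refine Yp.s_mem (β := (α ∘ tr k) ∘ tr l) (lV ⟨v, hv, rfl⟩) ?_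
      rw [R_R l (Uw hv)]
      exact Submodule.smul_mem _ _ (lU hv)
    · rintro _ ⟨_, ⟨v, hv, rfl⟩, rfl⟩
      refine Yp.s_mem (β := ((α ∘ tr k) ∘ tr l) ∘ tr k) (lW ⟨_, ⟨v, hv, rfl⟩, rfl⟩) ?_
      rw [R_braid (injective_comp_tr hα k) h.symm (Uw hv)]
      obtain ⟨v, hv, rfl⟩ := hv
      rw [R_R_eq_zero n0 hΩ hv, map_zero, map_zero]
      exact zero_mem _
  have hs (m : Fin 2) : ∀ v ∈ U ⊔ V ⊔ W, S.s m v ∈ U ⊔ V ⊔ W := by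
    rcases eq_or_eq_of_ne h m with rfl | rfl
    exacts [ks, ls]
  have key (π : Equiv.Perm (Fin 3)) (hπ : π ≠ 1) : S.wt (α ∘ ⇑π) ≤ S.off α := by
    refine wt_le_off fun he => hπ ?_
    ext1 m
    exact hα (congrFun he m)
  have hoff : U ⊔ V ⊔ W ≤ S.off α :=
    sup_le (sup_le (Uw.trans (key (tr k) (tr_ne_one k)))
      (Vw.trans (key (tr k * tr l) (tr_mul_tr_ne_one h))))
      (Ww.trans (key (tr k * tr l * tr k) (tr_word_ne h).1.symm))
  rcases hirr.2 _ Yp hs with h0 | h1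
  · have : S.R k α z ∈ U ⊔ V ⊔ W := lU ⟨z, hz, rfl⟩
    rw [h0] at this
    exact (Submodule.mem_bot F).1 this
  · rw [eq_zero_of_mem_off hz (hoff (h1 ▸ Submodule.mem_top)), map_zero]

/-- Commuting `x` or `c` past `s_k` costs only vectors of `N`. -/
theorem PStable.sup_map_s {N : Submodule F M} (h : S.PStable N) (k : Fin 2) :
    S.PStable (N ⊔ N.map (S.s k)) := by
  have P := S.pair k
  have lN : N ≤ N ⊔ N.map (S.s k) := le_sup_left
  have lS : ∀ v ∈ N, S.s k v ∈ N ⊔ N.map (S.s k) := fun v hv =>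
    Submodule.mem_sup_right ⟨v, hv, rfl⟩
  have ex (m : Fin 3) : N ⊔ N.map (S.s k) ≤ (N ⊔ N.map (S.s k)).comap (S.x m) := by
    refine sup_le (fun v hv => lN (h.x m v hv)) ?_
    rintro _ ⟨v, hv, rfl⟩
    rw [Submodule.mem_comap]
    by_cases h1 : m = k.castSucc
    · subst h1
      rw [eq_sub_of_add_eq (P.sy v).symm]
      exact Submodule.sub_mem _ (lS _ (h.x _ _ hv))
        (lN (N.sub_mem hv (h.c _ _ (h.c _ _ hv))))
    by_cases h2 : m = k.succ
    · subst h2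
      rw [← eq_add_of_sub_eq (P.sx v).symm |>.symm]
      exact Submodule.add_mem _ (lS _ (h.x _ _ hv))
        (lN (N.add_mem hv (h.c _ _ (h.c _ _ hv))))
    · rw [← S.sx_far k m h1 h2]
      exact lS _ (h.x _ _ hv)
  have ec (m : Fin 3) : N ⊔ N.map (S.s k) ≤ (N ⊔ N.map (S.s k)).comap (S.c m) := by
    refine sup_le (fun v hv => lN (h.c m v hv)) ?_
    rintro _ ⟨v, hv, rfl⟩
    rw [Submodule.mem_comap]
    by_cases h1 : m = k.castSucc
    · subst h1
      rw [← P.sd]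
      exact lS _ (h.c _ _ hv)
    by_cases h2 : m = k.succ
    · subst h2
      rw [← P.sc]
      exact lS _ (h.c _ _ hv)
    · rw [← S.sc_far k m h1 h2]
      exact lS _ (h.c _ _ hv)
  have et : N ⊔ N.map (S.s k) ≤ (N ⊔ N.map (S.s k)).comap S.θ := by
    refine sup_le (fun v hv => lN (h.θ v hv)) ?_
    rintro _ ⟨v, hv, rfl⟩
    rw [Submodule.mem_comap]
    rw [S.θs]
    exact lS _ (h.θ _ hv)
  exact ⟨fun m v hv => ex m hv, fun m v hv => ec m hv, fun v hv => et hv⟩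

theorem s_sup_map_s (N : Submodule F M) (k : Fin 2) :
    ∀ v ∈ N ⊔ N.map (S.s k), S.s k v ∈ N ⊔ N.map (S.s k) := by
  have : N ⊔ N.map (S.s k) ≤ (N ⊔ N.map (S.s k)).comap (S.s k) := by
    refine sup_le (fun v hv => Submodule.mem_sup_right ⟨v, hv, rfl⟩) ?_
    rintro _ ⟨v, hv, rfl⟩
    rw [Submodule.mem_comap]
    rw [S.ss]
    exact Submodule.mem_sup_left hv
  exact fun v hv => this hv

section Equal

variable {β : Fin 3 → F} {k l : Fin 2}

theorem comp_tr_ne (hk : β k.castSucc ≠ β k.succ) : β ∘ tr k ≠ β :=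
  fun h => hk (adjacent_eq_of_comp h)

theorem comp_tr_tr_comp_tr (h : k ≠ l) (hl : β l.castSucc = β l.succ) :
    ((β ∘ tr k) ∘ tr l) ∘ tr k = (β ∘ tr k) ∘ tr l := by
  rw [comp_braid β h, comp_tr_of_eq hl]

theorem comp_tr_tr_ne (hl : β l.castSucc = β l.succ) (hk : β k.castSucc ≠ β k.succ) :
    (β ∘ tr k) ∘ tr l ≠ β := by
  intro he
  have := congrArg (· ∘ tr l) he
  simp only [comp_tr_tr] at this
  exact comp_tr_ne hk (this.trans (comp_tr_of_eq hl))

theorem comp_tr_tr_ne' (h : k ≠ l) (hl : β l.castSucc = β l.succ)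
    (hk : β k.castSucc ≠ β k.succ) : (β ∘ tr k) ∘ tr l ≠ β ∘ tr k := by
  intro he
  have h1 := comp_tr_tr_comp_tr h hl
  rw [he, comp_tr_tr] at h1
  exact comp_tr_ne hk h1.symm

/-- This replaces the braid relation when entries repeat. At the two ends of the path of weights an
adjacent pair is equal, so there the plain `s_k` or `s_l` preserves the weight space and plays the
part of the missing intertwiner. The identity is the component of weight `β` of `s_k s_l s_k = s_l
s_k s_l`. -/
theorem R_R_s (hS : S.SS) (h : k ≠ l) (hl : β l.castSucc = β l.succ)
    (hk : β k.castSucc ≠ β k.succ) {w : M} (hw : w ∈ S.wt ((β ∘ tr k) ∘ tr l)) :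
    S.R k (β ∘ tr k) (S.R l ((β ∘ tr k) ∘ tr l) (S.s k w)) =
      S.s l (S.R k (β ∘ tr k) (S.R l ((β ∘ tr k) ∘ tr l) w)) := by
  have n1 : (β ∘ tr k) l.castSucc ≠ (β ∘ tr k) l.succ := fun e =>
    comp_tr_tr_ne' h hl hk (comp_tr_of_eq e)
  have n2 : ((β ∘ tr k) ∘ tr l) l.castSucc ≠ ((β ∘ tr k) ∘ tr l) l.succ := fun e => by
    have := comp_tr_of_eq e
    rw [comp_tr_tr] at this
    exact comp_tr_tr_ne' h hl hk this.symm
  have n3 : (β ∘ tr k) k.castSucc ≠ (β ∘ tr k) k.succ := fun e => by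
    have := comp_tr_of_eq e
    rw [comp_tr_tr] at this
    exact comp_tr_ne hk this.symm
  have e2 : ((β ∘ tr k) ∘ tr l) k.castSucc = ((β ∘ tr k) ∘ tr l) k.succ :=
    adjacent_eq_of_comp (comp_tr_tr_comp_tr h hl)
  have Rl {v : M} (hv : v ∈ S.wt ((β ∘ tr k) ∘ tr l)) :
      S.R l ((β ∘ tr k) ∘ tr l) v ∈ S.wt (β ∘ tr k) := by
    have := R_mem l n2 hv
    rwa [comp_tr_tr] at this
  have Rk {v : M} (hv : v ∈ S.wt (β ∘ tr k)) : S.R k (β ∘ tr k) v ∈ S.wt β := by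
    have := R_mem k n3 hv
    rwa [comp_tr_tr] at this
  have o1 : S.wt (β ∘ tr k) ≤ S.off β := wt_le_off (comp_tr_ne hk)
  have o2 : S.wt ((β ∘ tr k) ∘ tr l) ≤ S.off β := wt_le_off (comp_tr_tr_ne hl hk)
  have sk {v : M} (hv : v ∈ S.wt ((β ∘ tr k) ∘ tr l)) : S.s k v ∈ S.wt ((β ∘ tr k) ∘ tr l) :=
    s_mem_of_eq hS e2 hv
  have sl {v : M} (hv : v ∈ S.wt ((β ∘ tr k) ∘ tr l)) : S.s l v ∈ S.off β := by
    have := s_mem l n2 hv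
    rw [comp_tr_tr] at this
    exact sup_le o2 o1 this
  have sl' {v : M} (hv : v ∈ S.wt (β ∘ tr k)) : S.s l v ∈ S.off β :=
    sup_le o1 o2 (s_mem l n1 hv)
  set γ := (β ∘ tr k) ∘ tr l with hγ
  set δ := β ∘ tr k with hδ
  set a := (γ l.castSucc - γ l.succ)⁻¹ with ha
  set b := (δ k.castSucc - δ k.succ)⁻¹ with hb
  have lhs : S.s k (S.s l (S.s k w)) = S.R k δ (S.R l γ (S.s k w)) -
      (b • S.ν k (S.R l γ (S.s k w)) + a • S.s k (S.ν l (S.s k w))) := by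
    rw [s_eq l γ (S.s k w), map_sub, s_eq k δ (S.R l γ (S.s k w)), map_smul]
    abel
  have rhs : S.s l (S.s k (S.s l w)) = S.s l (S.R k δ (S.R l γ w)) -
      (b • S.s l (S.ν k (S.R l γ w)) + a • S.s l (S.s k (S.ν l w))) := by
    rw [s_eq l γ w, map_sub, map_sub, s_eq k δ (S.R l γ w), map_sub, map_smul, map_smul,
      map_smul]
    abel
  have m1 : b • S.ν k (S.R l γ (S.s k w)) + a • S.s k (S.ν l (S.s k w)) ∈ S.off β :=
    Submodule.add_mem _
      (Submodule.smul_mem _ _ (o1 ((wt_pstable _).ν k (Rl (sk hw)))))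
      (Submodule.smul_mem _ _ (o2 (sk ((wt_pstable _).ν l (sk hw)))))
  have m2 : b • S.s l (S.ν k (S.R l γ w)) + a • S.s l (S.s k (S.ν l w)) ∈ S.off β :=
    Submodule.add_mem _
      (Submodule.smul_mem _ _ (sl' ((wt_pstable _).ν k (Rl hw))))
      (Submodule.smul_mem _ _ (sl (sk ((wt_pstable _).ν l hw))))
  rw [S.braid' h, rhs] at lhs
  have m3 : S.R k δ (S.R l γ (S.s k w)) - S.s l (S.R k δ (S.R l γ w)) ∈ S.off β := by
    have : S.R k δ (S.R l γ (S.s k w)) - S.s l (S.R k δ (S.R l γ w)) =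
        (b • S.ν k (S.R l γ (S.s k w)) + a • S.s k (S.ν l (S.s k w))) -
        (b • S.s l (S.ν k (S.R l γ w)) + a • S.s l (S.s k (S.ν l w))) := by
      rw [sub_eq_sub_iff_add_eq_add] at lhs ⊢
      rw [← sub_eq_zero] at lhs ⊢
      rw [← neg_eq_zero, ← lhs]
      abel
    rw [this]
    exact Submodule.sub_mem _ m1 m2
  exact sub_eq_zero.1 (eq_zero_of_mem_off (Submodule.sub_mem _ (Rk (Rl (sk hw)))
    (s_mem_of_eq hS hl (Rk (Rl hw)))) m3)

/-- If the square of an intertwiner vanishes on a weight space whose weight has two equal adjacent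
entries, then so does the intertwiner. -/
theorem R_eq_zero_of_eq (hS : S.SS) (hirr : S.Irr) (h : k ≠ l) (hl : β l.castSucc = β l.succ)
    (hk : β k.castSucc ≠ β k.succ)
    (hΩ : 2 * (β k.castSucc + β k.succ) = (β k.castSucc - β k.succ) ^ 2) {z : M}
    (hz : z ∈ S.wt β) : S.R k β z = 0 := by
  have n1 : (β ∘ tr k) l.castSucc ≠ (β ∘ tr k) l.succ := fun e =>
    comp_tr_tr_ne' h hl hk (comp_tr_of_eq e)
  have n2 : ((β ∘ tr k) ∘ tr l) l.castSucc ≠ ((β ∘ tr k) ∘ tr l) l.succ := fun e => by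
    have := comp_tr_of_eq e
    rw [comp_tr_tr] at this
    exact comp_tr_tr_ne' h hl hk this.symm
  have e2 : ((β ∘ tr k) ∘ tr l) k.castSucc = ((β ∘ tr k) ∘ tr l) k.succ :=
    adjacent_eq_of_comp (comp_tr_tr_comp_tr h hl)
  -- As `β` repeats an entry at `l`, the pair met at `l` after the swap consists of the same two
  -- values as the pair at `k` before it.
  have hΩ' : 2 * ((β ∘ tr k) l.castSucc + (β ∘ tr k) l.succ) =
      ((β ∘ tr k) l.castSucc - (β ∘ tr k) l.succ) ^ 2 := by
    have t0 : tr 0 2 = 2 := by decide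
    have t1 : tr 1 0 = 0 := by decide
    have t2 : tr 0 1 = 0 := by decide
    have t3 : tr 1 1 = 2 := by decide
    fin_cases k <;> fin_cases l <;> simp_all
  have hΩ'' : 2 * (((β ∘ tr k) ∘ tr l) l.castSucc + ((β ∘ tr k) ∘ tr l) l.succ) =
      (((β ∘ tr k) ∘ tr l) l.castSucc - ((β ∘ tr k) ∘ tr l) l.succ) ^ 2 := by
    rw [Function.comp_apply (f := β ∘ tr k), Function.comp_apply (f := β ∘ tr k),
      tr_castSucc, tr_succ, add_comm, hΩ']
    ring
  -- For weights of shape `(a,a,b)` or its reverse, `Y` and `Z` have weight `(a,b,a)` and `U` has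
  -- the weight with `b` at the other end. There `s_k` preserves the weight space, so `V` has to be
  -- enlarged by its image under `s_k`. None of these weights is `β`.
  set Y := (S.wt β).map (S.R k β) with hY
  have Yw : Y ≤ S.wt (β ∘ tr k) := map_R_le hk le_rfl
  have Yp : S.PStable Y := (wt_pstable β).map_R hk le_rfl
  set V := Y.map (S.R l (β ∘ tr k)) with hV
  have Vw : V ≤ S.wt ((β ∘ tr k) ∘ tr l) := map_R_le n1 Yw
  have Vp : S.PStable V := Yp.map_R n1 Yw
  set U := V ⊔ V.map (S.s k) with hU
  have Uw : U ≤ S.wt ((β ∘ tr k) ∘ tr l) := by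
    refine sup_le Vw ?_
    rintro _ ⟨v, hv, rfl⟩
    exact s_mem_of_eq hS e2 (Vw hv)
  have Up : S.PStable U := Vp.sup_map_s k
  set Z := U.map (S.R l ((β ∘ tr k) ∘ tr l)) with hZ
  have Zw : Z ≤ S.wt (β ∘ tr k) := by
    have := map_R_le n2 Uw
    rwa [comp_tr_tr] at this
  have Zp : S.PStable Z := Up.map_R n2 Uw
  have Kp : S.PStable (Y ⊔ U ⊔ Z) := (Yp.sup Up).sup Zp
  have lY : Y ≤ Y ⊔ U ⊔ Z := le_sup_left.trans le_sup_left
  have lU : U ≤ Y ⊔ U ⊔ Z := le_sup_right.trans le_sup_left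
  have lZ : Z ≤ Y ⊔ U ⊔ Z := le_sup_right
  have RV {v : M} (hv : v ∈ V) : S.R l ((β ∘ tr k) ∘ tr l) v = 0 := by
    obtain ⟨y, hy, rfl⟩ := hv
    exact R_R_eq_zero n1 hΩ' (Yw hy)
  -- This is the point where a vector of weight `β` could reappear. On the `V` part already `R_l R_l
  -- = 0`; on its image under `s_k`, `R_R_s` moves the simple transposition to the outside.
  have RZ : Z ≤ (⊥ : Submodule F M).comap (S.R k (β ∘ tr k)) := by
    rw [hZ, Submodule.map_le_iff_le_comap, hU]
    refine sup_le (fun v hv => ?_) ?_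
    · rw [Submodule.mem_comap, Submodule.mem_comap]
      rw [RV hv, map_zero]
      exact zero_mem _
    · rintro _ ⟨v, hv, rfl⟩
      rw [Submodule.mem_comap, Submodule.mem_comap]
      rw [R_R_s hS h hl hk (Vw hv), RV hv, map_zero, map_zero]
      exact zero_mem _
  have ks : Y ⊔ U ⊔ Z ≤ (Y ⊔ U ⊔ Z).comap (S.s k) := by
    refine sup_le (sup_le ?_ ?_) ?_
    · rintro _ ⟨v, hv, rfl⟩
      refine Kp.s_mem (β := β ∘ tr k) (lY ⟨v, hv, rfl⟩) ?_
      rw [R_R_eq_zero hk hΩ hv]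
      exact zero_mem _
    · exact fun v hv => lU (s_sup_map_s V k v hv)
    · intro v hv
      refine Kp.s_mem (β := β ∘ tr k) (lZ hv) ?_
      rw [(Submodule.mem_bot F).1 (RZ hv)]
      exact zero_mem _
  have ls : Y ⊔ U ⊔ Z ≤ (Y ⊔ U ⊔ Z).comap (S.s l) := by
    refine sup_le (sup_le ?_ ?_) ?_
    · intro v hv
      exact Kp.s_mem (β := β ∘ tr k) (lY hv) (lU (Submodule.mem_sup_left ⟨v, hv, rfl⟩))
    · intro v hv
      exact Kp.s_mem (β := (β ∘ tr k) ∘ tr l) (lU hv) (lZ ⟨v, hv, rfl⟩)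
    · rintro _ ⟨v, hv, rfl⟩
      refine Kp.s_mem (β := ((β ∘ tr k) ∘ tr l) ∘ tr l) (lZ ⟨v, hv, rfl⟩) ?_
      rw [R_R_eq_zero n2 hΩ'' (Uw hv)]
      exact zero_mem _
  have hs (m : Fin 2) : ∀ v ∈ Y ⊔ U ⊔ Z, S.s m v ∈ Y ⊔ U ⊔ Z := by
    rcases eq_or_eq_of_ne h m with rfl | rfl
    exacts [ks, ls]
  have hoff : Y ⊔ U ⊔ Z ≤ S.off β :=
    sup_le (sup_le (Yw.trans (wt_le_off (comp_tr_ne hk)))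
      (Uw.trans (wt_le_off (comp_tr_tr_ne hl hk))))
      (Zw.trans (wt_le_off (comp_tr_ne hk)))
  rcases hirr.2 _ Kp hs with h0 | h1
  · have : S.R k β z ∈ Y ⊔ U ⊔ Z := lY ⟨z, hz, rfl⟩
    rw [h0] at this
    exact (Submodule.mem_bot F).1 this
  · rw [eq_zero_of_mem_off hz (hoff (h1 ▸ Submodule.mem_top)), map_zero]

end Equal

end Sys

end HeckeClifford

/-! ### Arithmetic of q on 𝕀 and the zeros of Ω -/

namespace HeckeClifford

section Numbers

variable {F : Type u} [Field F] {p : ℕ} [CharP F p]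

theorem char_eq_zero_or_three_le (F : Type u) [Field F] (p : ℕ) [CharP F p] (hp : p ≠ 2) :
    p = 0 ∨ 3 ≤ p := by
  rcases CharP.char_is_prime_or_zero F p with h | h
  · have := h.two_le; omega
  · exact Or.inl h

theorem two_ne_zero_of_char (F : Type u) [Field F] (p : ℕ) [CharP F p] (hp : p ≠ 2) :
    (2 : F) ≠ 0 := by
  intro h
  have h' : ((2 : ℕ) : F) = 0 := by exact_mod_cast h
  rw [CharP.cast_eq_zero_iff F p] at h'
  rcases char_eq_zero_or_three_le F p hp with h0 | h0
  · subst h0; simp at h'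
  · have := Nat.le_of_dvd (by norm_num) h'; omega

theorem cast_ne_zero_of_lt {n : ℕ} (h0 : n ≠ 0) (h : p = 0 ∨ n < p) : (n : F) ≠ 0 := by
  intro hn
  rw [CharP.cast_eq_zero_iff F p] at hn
  rcases h with rfl | h
  · exact h0 (by simpa using hn)
  · exact h0 (Nat.eq_zero_of_dvd_of_lt hn h)

variable (hp : p ≠ 2)
include hp

/-- The difference factors as `(b - a)(a + b + 1)`, and the bound `b ≤ (p - 1)/2` keeps both factors
strictly between `0` and `p`. -/
theorem q_ne_of_lt {a b : ℕ} (hb : b ∈ II p) (h : a < b) : q F a ≠ q F b := by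
  obtain ⟨d, rfl⟩ := Nat.exists_eq_add_of_lt h
  have hp' := char_eq_zero_or_three_le F p hp
  have hb' : p = 0 ∨ a + d + 1 ≤ (p - 1) / 2 := hb
  have e : q F (a + d + 1) - q F a = ((d + 1 : ℕ) : F) * ((2 * a + d + 2 : ℕ) : F) := by
    simp only [q]; push_cast; ring
  intro hq
  rw [← hq, sub_self] at e
  rcases mul_eq_zero.1 e.symm with h1 | h1
  · exact cast_ne_zero_of_lt (p := p) (by omega) (by omega) h1
  · exact cast_ne_zero_of_lt (p := p) (by omega) (by omega) h1

theorem q_injOn {a b : ℕ} (ha : a ∈ II p) (hb : b ∈ II p) (h : q F a = q F b) : a = b := by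
  rcases lt_trichotomy a b with h1 | h1 | h1
  · exact absurd h (q_ne_of_lt hp hb h1)
  · exact h1
  · exact absurd h.symm (q_ne_of_lt hp ha h1)

theorem q_eq_zero {a : ℕ} (ha : a ∈ II p) (h : q F a = 0) : a = 0 :=
  q_injOn (F := F) hp ha (by simp [II]) (by rw [h]; simp [q])

omit hp [CharP F p] in
theorem q_discriminant (a b : F) :
    (a * (a + 1) - b * (b + 1)) ^ 2 - 2 * (a * (a + 1) + b * (b + 1)) =
      (a - b - 1) * (a - b + 1) * (a + b) * (a + b + 2) := by ring

omit hp [CharP F p] in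
theorem discriminant_eq_zero {a b : ℕ} (h : ¬(a ≠ b + 1 ∧ a + 1 ≠ b)) :
    2 * (q F a + q F b) = (q F a - q F b) ^ 2 := by
  have := q_discriminant (a : F) b
  have h0 : ((a : F) - b - 1) * (a - b + 1) = 0 := by
    rcases Classical.or_iff_not_imp_left.2 (fun h1 => not_not.1 fun h2 => h ⟨h1, h2⟩) with h1 | h1
    · rw [h1]; push_cast; ring
    · rw [← h1]; push_cast; ring
  rw [h0, zero_mul, zero_mul, sub_eq_zero] at this
  exact this.symm

/-- With `b = a + d + 1` the discriminant is `d (d + 2)(2a + d + 1)(2a + d + 3)`. Since `b` is not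
`a + 1`, `d` is at least `1`, and this is also what keeps the last factor below `p`. -/
theorem discriminant_ne_zero_of_lt {a b : ℕ} (hb : b ∈ II p) (hlt : a < b) (h' : a + 1 ≠ b) :
    2 * (q F b + q F a) ≠ (q F b - q F a) ^ 2 := by
  obtain ⟨d, rfl⟩ := Nat.exists_eq_add_of_lt hlt
  have hp' := char_eq_zero_or_three_le F p hp
  have hb' : p = 0 ∨ a + d + 1 ≤ (p - 1) / 2 := hb
  have e : (q F (a + d + 1) - q F a) ^ 2 - 2 * (q F (a + d + 1) + q F a) =
      ((d : ℕ) : F) * ((d + 2 : ℕ) : F) * ((2 * a + d + 1 : ℕ) : F) * ((2 * a + d + 3 : ℕ) : F) := by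
    simp only [q]; push_cast; ring
  intro hq
  rw [hq, sub_self] at e
  have h1 := cast_ne_zero_of_lt (F := F) (p := p) (n := d) (by omega) (by omega)
  have h2 := cast_ne_zero_of_lt (F := F) (p := p) (n := d + 2) (by omega) (by omega)
  have h3 := cast_ne_zero_of_lt (F := F) (p := p) (n := 2 * a + d + 1) (by omega) (by omega)
  have h4 := cast_ne_zero_of_lt (F := F) (p := p) (n := 2 * a + d + 3) (by omega) (by omega)
  exact mul_ne_zero (mul_ne_zero (mul_ne_zero h1 h2) h3) h4 e.symm

theorem discriminant_ne_zero {a b : ℕ} (ha : a ∈ II p) (hb : b ∈ II p) (hne : a ≠ b)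
    (h : a ≠ b + 1 ∧ a + 1 ≠ b) : 2 * (q F a + q F b) ≠ (q F a - q F b) ^ 2 := by
  rcases lt_or_gt_of_ne hne with h1 | h1
  · have := discriminant_ne_zero_of_lt (F := F) hp hb h1 h.2
    intro e
    exact this (by rw [add_comm, e]; ring)
  · exact discriminant_ne_zero_of_lt (F := F) hp ha h1 h.1.symm

omit hp [CharP F p] in
theorem root_sq [IsAlgClosed F] (a : F) : root a ^ 2 = a :=
  Classical.choose_spec (exists_sq_eq a)

omit hp [CharP F p] in
theorem Om_comm [IsAlgClosed F] (a b : ℕ) : Om F a b = Om F b a := by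
  unfold Om
  congr 1
  rw [add_comm (q F a), ← neg_sub (q F b) (q F a), neg_sq]

theorem Om_ne_zero [IsAlgClosed F] {a b : ℕ} (ha : a ∈ II p) (hb : b ∈ II p) (hne : a ≠ b)
    (h : a ≠ b + 1 ∧ a + 1 ≠ b) : Om F a b ≠ 0 := by
  intro h0
  have := root_sq (1 - 2 * (q F a + q F b) / (q F a - q F b) ^ 2)
  change Om F a b ^ 2 = _ at this
  rw [h0, zero_pow two_ne_zero, eq_comm, sub_eq_zero, eq_comm, div_eq_one_iff_eq] at this
  · exact discriminant_ne_zero hp ha hb hne h this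
  · exact pow_ne_zero 2 (sub_ne_zero.2 fun e => hne (q_injOn hp ha hb e))

end Numbers

/-! ### Normalized intertwiners along reduced words -/

/-- The sequence `q(i_1), …, q(i_n)`. -/
def qs (F : Type u) [Field F] {n : ℕ} (i : Fin n → ℕ) : Fin n → F := fun k => q F (i k)

theorem qs_comp (F : Type u) [Field F] (i : Fin 3 → ℕ) (τ : Equiv.Perm (Fin 3)) :
    qs F (i ∘ τ) = qs F i ∘ τ := rfl

theorem permAct_tr_mul (k : Fin 2) (τ : Equiv.Perm (Fin 3)) (i : Fin 3 → ℕ) :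
    permAct (tr k * τ) i = permAct τ i ∘ tr k := by
  funext m
  simp [permAct, mul_inv_rev, tr]

theorem permAct_injective {i : Fin 3 → ℕ} (hi : Function.Injective i) (τ : Equiv.Perm (Fin 3)) :
    Function.Injective (permAct τ i) := fun _ _ h => τ⁻¹.injective (hi h)

/-- Admissibility of the simple transposition `k`. -/
def Adm (i : Fin 3 → ℕ) (k : Fin 2) : Prop :=
  i k.castSucc ≠ i k.succ + 1 ∧ i k.castSucc + 1 ≠ i k.succ

theorem InP.rec_tr {i : Fin 3 → ℕ} {P : Equiv.Perm (Fin 3) → Prop} (h1 : P 1)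
    (hs : ∀ τ k, InP i τ → P τ → Adm (permAct τ i) k → P (tr k * τ)) {τ : Equiv.Perm (Fin 3)}
    (hτ : InP i τ) : P τ := by
  induction hτ with
  | one => exact h1
  | step τ k hk hτ h ih => exact hs τ ⟨k, by omega⟩ hτ ih h

namespace Sys

variable {F : Type u} [Field F] [IsAlgClosed F] {p : ℕ} [CharP F p]
  {M : Type v} [AddCommGroup M] [Module F M] {S : Sys F M}

variable (S) in
/-- The normalized intertwiner. -/
noncomputable def T (k : Fin 2) (i : Fin 3 → ℕ) : Module.End F M :=
  (Om F (i k.castSucc) (i k.succ))⁻¹ • S.R k (qs F i)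

theorem T_apply (k : Fin 2) (i : Fin 3 → ℕ) (v : M) :
    S.T k i v = (Om F (i k.castSucc) (i k.succ))⁻¹ • S.R k (qs F i) v := rfl

theorem T_mem {k : Fin 2} {i : Fin 3 → ℕ} (h : qs F i k.castSucc ≠ qs F i k.succ) {v : M}
    (hv : v ∈ S.wt (qs F i)) : S.T k i v ∈ S.wt (qs F (i ∘ tr k)) :=
  Submodule.smul_mem _ _ (R_mem k h hv)

/-- Dividing by Ω on both trips cancels the scalar of `R_R`, because Ω is symmetric in its two
arguments. -/
theorem T_T {k : Fin 2} {i : Fin 3 → ℕ} (h : Om F (i k.castSucc) (i k.succ) ≠ 0)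
    {v : M} (hv : v ∈ S.wt (qs F i)) : S.T k (i ∘ tr k) (S.T k i v) = v := by
  rw [T_apply, T_apply, map_smul, qs_comp, R_R k hv, smul_smul, smul_smul]
  have e : (i ∘ tr k) k.castSucc = i k.succ := congrArg i (tr_castSucc k)
  have e' : (i ∘ tr k) k.succ = i k.castSucc := congrArg i (tr_succ k)
  rw [e, e', Om_comm (i k.succ)]
  have := root_sq (1 - 2 * (q F (i k.castSucc) + q F (i k.succ)) /
    (q F (i k.castSucc) - q F (i k.succ)) ^ 2)
  change Om F _ _ ^ 2 = _ at this
  change ((Om F _ _)⁻¹ * (Om F _ _)⁻¹ * (1 - 2 * (q F (i k.castSucc) + q F (i k.succ)) /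
    (q F (i k.castSucc) - q F (i k.succ)) ^ 2)) • v = v
  rw [← this, pow_two, ← mul_inv, inv_mul_cancel₀ (mul_ne_zero h h), one_smul]

theorem T_braid {i : Fin 3 → ℕ} (hi : Function.Injective (qs F i)) {v : M}
    (hv : v ∈ S.wt (qs F i)) :
    S.T 0 ((i ∘ tr 0) ∘ tr 1) (S.T 1 (i ∘ tr 0) (S.T 0 i v)) =
      S.T 1 ((i ∘ tr 1) ∘ tr 0) (S.T 0 (i ∘ tr 1) (S.T 1 i v)) := by
  simp only [T_apply, map_smul, qs_comp, smul_smul]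
  rw [R_braid hi (by decide : (0 : Fin 2) ≠ 1) hv]
  congr 1
  have a1 : tr 0 0 = 1 := by decide
  have a2 : tr 0 1 = 0 := by decide
  have a3 : tr 0 2 = 2 := by decide
  have a4 : tr 1 0 = 0 := by decide
  have a5 : tr 1 1 = 2 := by decide
  have a6 : tr 1 2 = 1 := by decide
  simp [a1, a2, a3, a4, a5, a6]
  ring

/-- The composites of normalized intertwiners along reduced words. -/
noncomputable def word (S : Sys F M) (i : Fin 3 → ℕ) (τ : Equiv.Perm (Fin 3)) : Module.End F M :=
  if τ = 1 then 1
  else if τ = tr 0 then S.T 0 i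
  else if τ = tr 1 then S.T 1 i
  else if τ = tr 1 * tr 0 then S.T 1 (i ∘ tr 0) * S.T 0 i
  else if τ = tr 0 * tr 1 then S.T 0 (i ∘ tr 1) * S.T 1 i
  -- Only the longest permutation is left; it has two reduced words and one of them is chosen.
  else S.T 0 ((i ∘ tr 0) ∘ tr 1) * (S.T 1 (i ∘ tr 0) * S.T 0 i)

theorem word_one (i : Fin 3 → ℕ) : S.word i 1 = 1 := if_pos rfl

/-- Twelve cases. If the length goes up, the claim is the definition of `word`; if it goes down, it
is `T_T`. The other reduced word of the longest permutation is brought in by `T_braid`, once in each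
direction. Admissibility is used only when the length goes down, to make Ω invertible. -/
theorem word_tr_mul (hp : p ≠ 2) {i : Fin 3 → ℕ} (hi : Function.Injective i)
    (hI : ∀ k, i k ∈ II p) {τ : Equiv.Perm (Fin 3)} {k : Fin 2} (hk : Adm (permAct τ i) k) {z : M}
    (hz : z ∈ S.wt (qs F i)) : S.word i (tr k * τ) z = S.T k (permAct τ i) (S.word i τ z) := by
  have qi (τ : Equiv.Perm (Fin 3)) : Function.Injective (qs F (i ∘ τ)) := fun _ _ h =>
    τ.injective (hi (q_injOn hp (hI _) (hI _) h))
  have qi1 : Function.Injective (qs F i) := qi 1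
  have qn (τ : Equiv.Perm (Fin 3)) (k : Fin 2) := adjacent_ne (qi τ) k
  have m0 : S.T 0 i z ∈ S.wt (qs F (i ∘ tr 0)) := T_mem (qn 1 0) hz
  have m1 : S.T 1 i z ∈ S.wt (qs F (i ∘ tr 1)) := T_mem (qn 1 1) hz
  have m10 : S.T 1 (i ∘ tr 0) (S.T 0 i z) ∈ S.wt (qs F ((i ∘ tr 0) ∘ tr 1)) :=
    T_mem (qn (tr 0) 1) m0
  have m01 : S.T 0 (i ∘ tr 1) (S.T 1 i z) ∈ S.wt (qs F ((i ∘ tr 1) ∘ tr 0)) :=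
    T_mem (qn (tr 1) 0) m1
  have hO (j : Fin 3 → ℕ) (hj : ∃ σ : Equiv.Perm (Fin 3), j = i ∘ σ) (k : Fin 2) (h : Adm j k) :
      Om F (j k.castSucc) (j k.succ) ≠ 0 := by
    obtain ⟨σ, rfl⟩ := hj
    exact Om_ne_zero hp (hI _) (hI _)
      (adjacent_ne (F := F) (qi σ) k ∘ fun e => congrArg (q F) e) h
  have hadm (σ : Fin 3 → ℕ) (k : Fin 2) (h : Adm (σ ∘ tr k) k) : Adm σ k := by
    simp only [Adm, Function.comp, tr_castSucc, tr_succ] at h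
    exact ⟨h.2.symm, h.1.symm⟩
  have hcases : τ = 1 ∨ τ = tr 0 ∨ τ = tr 1 ∨ τ = tr 1 * tr 0 ∨ τ = tr 0 * tr 1 ∨
      τ = tr 0 * (tr 1 * tr 0) := by
    clear hk; revert τ; decide
  have w0 : S.word i (tr 0) = S.T 0 i := by
    rw [word, if_neg (by decide), if_pos rfl]
  have w1 : S.word i (tr 1) = S.T 1 i := by
    rw [word, if_neg (by decide), if_neg (by decide), if_pos rfl]
  have w10 : S.word i (tr 1 * tr 0) = S.T 1 (i ∘ tr 0) * S.T 0 i := by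
    rw [word, if_neg (by decide), if_neg (by decide), if_neg (by decide), if_pos rfl]
  have w01 : S.word i (tr 0 * tr 1) = S.T 0 (i ∘ tr 1) * S.T 1 i := by
    rw [word, if_neg (by decide), if_neg (by decide), if_neg (by decide), if_neg (by decide),
      if_pos rfl]
  have w010 : S.word i (tr 0 * (tr 1 * tr 0)) =
      S.T 0 ((i ∘ tr 0) ∘ tr 1) * (S.T 1 (i ∘ tr 0) * S.T 0 i) := by
    rw [word, if_neg (by decide), if_neg (by decide), if_neg (by decide), if_neg (by decide),
      if_neg (by decide)]
  have p0 : permAct (tr 0) i = i ∘ tr 0 := permAct_tr_mul 0 1 i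
  have p1 : permAct (tr 1) i = i ∘ tr 1 := permAct_tr_mul 1 1 i
  have p10 : permAct (tr 1 * tr 0) i = (i ∘ tr 0) ∘ tr 1 := by rw [permAct_tr_mul, p0]
  have p01 : permAct (tr 0 * tr 1) i = (i ∘ tr 1) ∘ tr 0 := by rw [permAct_tr_mul, p1]
  have p010 : permAct (tr 0 * (tr 1 * tr 0)) i = ((i ∘ tr 0) ∘ tr 1) ∘ tr 0 := by
    rw [permAct_tr_mul, p10]
  have pb : ((i ∘ tr 0) ∘ tr 1) ∘ tr 0 = ((i ∘ tr 1) ∘ tr 0) ∘ tr 1 :=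
    comp_braid i (by decide)
  have tk (k : Fin 2) (τ : Equiv.Perm (Fin 3)) : tr k * (tr k * τ) = τ := by
    rw [← mul_assoc, tr_tr, one_mul]
  have tb : tr 1 * (tr 0 * tr 1) = tr 0 * (tr 1 * tr 0) := by decide
  have tb' : tr 1 * (tr 0 * (tr 1 * tr 0)) = tr 0 * tr 1 := by decide
  have hk2 : k = 0 ∨ k = 1 := by clear hk; revert k; decide
  rcases hcases with rfl | rfl | rfl | rfl | rfl | rfl <;> rcases hk2 with rfl | rfl
  · rw [mul_one, w0, word_one]; rfl
  · rw [mul_one, w1, word_one]; rfl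
  · rw [p0] at hk ⊢
    rw [tr_tr, word_one, w0, T_T (i := i) (hO i ⟨1, rfl⟩ 0 (hadm _ _ hk)) hz]; rfl
  · rw [w10, w0, p0]; rfl
  · rw [w01, w1, p1]; rfl
  · rw [p1] at hk ⊢
    rw [tr_tr, word_one, w1, T_T (i := i) (hO i ⟨1, rfl⟩ 1 (hadm _ _ hk)) hz]; rfl
  · rw [w010, w10, p10]; rfl
  · rw [p10] at hk ⊢
    rw [tk, w0, w10, Module.End.mul_apply, T_T (hO _ ⟨(tr 0), rfl⟩ 1 (hadm _ _ hk)) m0]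
  · rw [p01] at hk ⊢
    rw [tk, w1, w01, Module.End.mul_apply, T_T (hO _ ⟨(tr 1), rfl⟩ 0 (hadm _ _ hk)) m1]
  · rw [tb, w010, w01, p01, Module.End.mul_apply, Module.End.mul_apply, Module.End.mul_apply,
      T_braid qi1 hz]
  · rw [p010] at hk ⊢
    rw [tk, w10, w010, Module.End.mul_apply, Module.End.mul_apply, Module.End.mul_apply,
      T_T (i := (i ∘ tr 0) ∘ tr 1)
        (hO ((i ∘ tr 0) ∘ tr 1) ⟨tr 0 * tr 1, rfl⟩ 0 (hadm _ _ hk)) m10]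
  · rw [p010, pb] at hk ⊢
    rw [tb', w01, w010, Module.End.mul_apply, Module.End.mul_apply, Module.End.mul_apply,
      T_braid qi1 hz, T_T (i := (i ∘ tr 1) ∘ tr 0)
        (hO ((i ∘ tr 1) ∘ tr 0) ⟨tr 1 * tr 0, rfl⟩ 1 (hadm _ _ hk)) m01]

end Sys

end HeckeClifford

/-! ### Homomorphisms, and the modules D^i from families of intertwiners -/

namespace HeckeClifford

namespace Sys

variable {F : Type u} [Field F] {M : Type v} [AddCommGroup M] [Module F M] {S : Sys F M}

variable (S) in
/-- The operators by which the generators act. -/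
def op : Gen 3 Set.univ → Module.End F M
  | .x k => S.x k
  | .c k => S.c k
  | .s k _ _ => S.s ⟨k, by omega⟩

variable (S) in
/-- Linear maps commuting with the operators, and with `θ` up to the sign `σ`. -/
structure Hom {J : Set ℕ} (A : SuperRep.{u, w} F 3 J) (f : A.V →ₗ[F] M) (σ : F) : Prop where
  op : ∀ g v, f (A.op g v) = S.op g.incl (f v)
  θ : ∀ v, f (A.θ v) = σ • S.θ (f v)
  sign : σ = 1 ∨ σ = -1

section Hom

variable {J : Set ℕ} {A : SuperRep.{u, w} F 3 J} {f : A.V →ₗ[F] M} {σ : F}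

theorem Hom.x (h : S.Hom A f σ) (k : Fin 3) (v : A.V) : f (A.op (.x k) v) = S.x k (f v) :=
  h.op _ _

theorem Hom.c (h : S.Hom A f σ) (k : Fin 3) (v : A.V) : f (A.op (.c k) v) = S.c k (f v) :=
  h.op _ _

theorem Hom.θ_apply (h : S.Hom A f σ) (v : A.V) : S.θ (f v) = f (σ • A.θ v) := by
  rw [map_smul, h.θ, smul_smul]
  rcases h.sign with rfl | rfl <;> simp

theorem Hom.range_pstable (h : S.Hom A f σ) : S.PStable (LinearMap.range f) where
  x k := by rintro _ ⟨v, rfl⟩; exact ⟨_, h.x k v⟩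
  c k := by rintro _ ⟨v, rfl⟩; exact ⟨_, h.c k v⟩
  θ := by rintro _ ⟨v, rfl⟩; exact ⟨_, (h.θ_apply v).symm⟩

end Hom

theorem Hom.surjective {A : SuperRep.{u, w} F 3 Set.univ} {f : A.V →ₗ[F] M} {σ : F}
    (h : S.Hom A f σ) (hirr : S.Irr) (h0 : f ≠ 0) : Function.Surjective f := by
  rw [← LinearMap.range_eq_top]
  refine (hirr.2 _ h.range_pstable ?_).resolve_left (mt LinearMap.range_eq_bot.1 h0)
  rintro k _ ⟨v, rfl⟩
  exact ⟨_, h.op (.s k.val (by omega) (Set.mem_univ _)) v⟩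

theorem Hom.Xi {J : Set ℕ} {A : SuperRep.{u, w} F 3 J} {f : A.V →ₗ[F] M} {σ : F}
    (h : S.Hom A f σ) (a b : Fin 3) (d : F) (v : A.V) :
    f (A.Xi a b d v) = -(d⁻¹ • nu (S.x a) (S.x b) (S.c a) (S.c b) (f v)) := by
  simp [SuperRep.Xi, nu_apply, h.x, h.c]

end Sys

theorem isSemisimple_of_le_iSup_eigenspace {F : Type u} [Field F] {M : Type v} [AddCommGroup M]
    [Module F M] [Module.Finite F M] (f : Module.End F M) (B : Finset F)
    (h : ⊤ ≤ ⨆ r ∈ B, f.eigenspace r) : f.IsSemisimple := by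
  classical
  refine Module.End.isSemisimple_of_squarefree_aeval_eq_zero
    (p := ∏ r ∈ B, (Polynomial.X - Polynomial.C r))
    ((Polynomial.separable_prod_X_sub_C_iff' (f := id)).2 (fun _ _ _ _ h => h)).squarefree ?_
  refine LinearMap.ext fun v => ?_
  have : (⨆ r ∈ B, f.eigenspace r) ≤
      LinearMap.ker (Polynomial.aeval f (∏ r ∈ B, (Polynomial.X - Polynomial.C r))) := by
    refine iSup₂_le fun r hr v hv => ?_
    rw [LinearMap.mem_ker, ← Finset.prod_erase_mul _ _ hr, map_mul, Module.End.mul_apply]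
    have : Polynomial.aeval f (Polynomial.X - Polynomial.C r) v = 0 := by
      simp [Module.End.mem_eigenspace_iff.1 hv]
    rw [this, map_zero]
  exact this (h Submodule.mem_top)

/-- For `r ≠ 0` the two components are `(r v ± f v)/(2r)`. For `r = 0` the square alone says too
little, whence the separate hypothesis. -/
theorem mem_eigenspaces_of_sq {F : Type u} [Field F] {M : Type v} [AddCommGroup M]
    [Module F M] (h2 : (2 : F) ≠ 0) (f : Module.End F M) {r : F} {v : M}
    (h : f (f v) = r ^ 2 • v) (h0 : r = 0 → f v = 0) :
    v ∈ f.eigenspace r ⊔ f.eigenspace (-r) := by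
  by_cases hr : r = 0
  · refine Submodule.mem_sup_left (Module.End.mem_eigenspace_iff.2 ?_)
    rw [h0 hr, hr, zero_smul]
  · refine Submodule.mem_sup.2 ⟨(2 * r)⁻¹ • (r • v + f v), ?_, (2 * r)⁻¹ • (r • v - f v), ?_, ?_⟩
    · refine Submodule.smul_mem _ _ (Module.End.mem_eigenspace_iff.2 ?_)
      rw [map_add, map_smul, h]; module
    · refine Submodule.smul_mem _ _ (Module.End.mem_eigenspace_iff.2 ?_)
      rw [map_sub, map_smul, h]; module
    · rw [← smul_add, add_add_sub_cancel, ← two_smul F (r • v), smul_smul 2 r, smul_smul,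
        inv_mul_cancel₀ (mul_ne_zero h2 hr), one_smul]

section D

variable {F : Type u} [Field F] [IsAlgClosed F] {n : ℕ} {i : Fin n → ℕ}
  {C : SuperRep.{u, w} F n ∅}

/-- The inclusion `z ↦ z^τ` into `D^i`. -/
noncomputable def Dι (i : Fin n → ℕ) (C : SuperRep.{u, w} F n ∅) (τ : {τ // InP i τ}) :
    C.V →ₗ[F] (D i C).V :=
  (Finsupp.lsingle τ : C.V →ₗ[F] ({τ // InP i τ} →₀ C.V))

/-- The component of index `τ` of an element of `D^i`. -/
noncomputable def Dπ (i : Fin n → ℕ) (C : SuperRep.{u, w} F n ∅) (τ : {τ // InP i τ}) :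
    (D i C).V →ₗ[F] C.V :=
  (Finsupp.lapply τ : ({τ // InP i τ} →₀ C.V) →ₗ[F] C.V)

/-- The linear map on `D^i` with given restrictions to the summands. -/
noncomputable def Ddesc {M : Type v} [AddCommGroup M] [Module F M] (i : Fin n → ℕ)
    (C : SuperRep.{u, w} F n ∅) (h : {τ // InP i τ} → C.V →ₗ[F] M) : (D i C).V →ₗ[F] M :=
  (Finsupp.lsum F h : ({τ // InP i τ} →₀ C.V) →ₗ[F] M)

theorem Ddesc_ι {M : Type v} [AddCommGroup M] [Module F M] (h : {τ // InP i τ} → C.V →ₗ[F] M)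
    (τ : {τ // InP i τ}) (z : C.V) : Ddesc i C h (Dι i C τ z) = h τ z :=
  Finsupp.lsum_single F h τ z

theorem Dπ_ι (τ : {τ // InP i τ}) (z : C.V) : Dπ i C τ (Dι i C τ z) = z :=
  Finsupp.single_eq_same

theorem Dπ_ι_ne {τ τ' : {τ // InP i τ}} (h : τ ≠ τ') (z : C.V) :
    Dπ i C τ (Dι i C τ' z) = 0 :=
  Finsupp.single_eq_of_ne h

theorem D_ext {v : (D i C).V} (h : ∀ τ, Dπ i C τ v = 0) : v = 0 :=
  (Finsupp.ext h : (v : {τ // InP i τ} →₀ C.V) = 0)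

@[elab_as_elim]
theorem D_induction {P : (D i C).V → Prop} (v : (D i C).V) (h0 : P 0)
    (hadd : ∀ v w, P v → P w → P (v + w)) (hs : ∀ τ z, P (Dι i C τ z)) : P v :=
  Finsupp.induction_linear (motive := P) v h0 hadd hs

theorem D_op_x (k : Fin n) (τ : {τ // InP i τ}) (z : C.V) :
    (D i C).op (.x k) (Dι i C τ z) = Dι i C τ (C.op (.x (τ.1⁻¹ k)) z) :=
  Finsupp.lsum_single F (fun τ : {τ // InP i τ} =>
    (Finsupp.lsingle τ : C.V →ₗ[F] ({τ // InP i τ} →₀ C.V)) ∘ₗ C.op (.x (τ.1⁻¹ k))) τ z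

theorem D_op_c (k : Fin n) (τ : {τ // InP i τ}) (z : C.V) :
    (D i C).op (.c k) (Dι i C τ z) = Dι i C τ (C.op (.c (τ.1⁻¹ k)) z) :=
  Finsupp.lsum_single F (fun τ : {τ // InP i τ} =>
    (Finsupp.lsingle τ : C.V →ₗ[F] ({τ // InP i τ} →₀ C.V)) ∘ₗ C.op (.c (τ.1⁻¹ k))) τ z

theorem D_θ (τ : {τ // InP i τ}) (z : C.V) :
    (D i C).θ (Dι i C τ z) = Dι i C τ (C.θ z) :=
  Finsupp.lsum_single F (fun τ : {τ // InP i τ} =>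
    (Finsupp.lsingle τ : C.V →ₗ[F] ({τ // InP i τ} →₀ C.V)) ∘ₗ C.θ) τ z

open Classical in
theorem D_op_s (k : ℕ) (hk : k + 1 < n) (τ : {τ // InP i τ}) (z : C.V) :
    (D i C).op (.s k hk (Set.mem_univ k)) (Dι i C τ z) =
      Dι i C τ (C.Xi (τ.1⁻¹ ⟨k, by omega⟩) (τ.1⁻¹ ⟨k + 1, hk⟩)
          (q F (permAct τ.1 i ⟨k, by omega⟩) - q F (permAct τ.1 i ⟨k + 1, hk⟩)) z) +
        if h : Admissible (permAct τ.1 i) k hk then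
          Om F (permAct τ.1 i ⟨k, by omega⟩) (permAct τ.1 i ⟨k + 1, hk⟩) •
            Dι i C ⟨simple k hk * τ.1, InP.step τ.1 k hk τ.2 h⟩ z
        else 0 := by
  have e : (D i C).op (.s k hk (Set.mem_univ k)) = Ddesc i C fun τ =>
      Dι i C τ ∘ₗ C.Xi (τ.1⁻¹ ⟨k, by omega⟩) (τ.1⁻¹ ⟨k + 1, hk⟩)
          (q F (permAct τ.1 i ⟨k, by omega⟩) - q F (permAct τ.1 i ⟨k + 1, hk⟩)) +
        if h : Admissible (permAct τ.1 i) k hk then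
          Om F (permAct τ.1 i ⟨k, by omega⟩) (permAct τ.1 i ⟨k + 1, hk⟩) •
            Dι i C ⟨simple k hk * τ.1, InP.step τ.1 k hk τ.2 h⟩
        else 0 := rfl
  rw [e, Ddesc_ι, LinearMap.add_apply, LinearMap.comp_apply]
  congr 1
  split_ifs <;> rfl

/-- Used with `N` the sum of all weight spaces but that of `τ`: modulo `N`, only the component of
index `τ` is seen. -/
theorem D_map_sub_mem {M : Type v} [AddCommGroup M] [Module F M] {N : Submodule F M}
    (f : (D i C).V →ₗ[F] M) (τ : {τ // InP i τ}) (h : ∀ τ' ≠ τ, ∀ z, f (Dι i C τ' z) ∈ N)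
    (v : (D i C).V) : f v - f (Dι i C τ (Dπ i C τ v)) ∈ N := by
  induction v using D_induction with
  | h0 => simp
  | hadd v w hv hw =>
    simp only [map_add]
    rw [add_sub_add_comm]
    exact N.add_mem hv hw
  | hs τ' z =>
    by_cases e : τ' = τ
    · subst e; rw [Dπ_ι, sub_self]; exact zero_mem _
    · rw [Dπ_ι_ne (Ne.symm e), map_zero, map_zero, sub_zero]; exact h τ' e z

end D

namespace Sys

variable {F : Type u} [Field F] [IsAlgClosed F]
  {M : Type v} [AddCommGroup M] [Module F M] {S : Sys F M}

variable (S) in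
/-- Composites of normalized intertwiners, indexed by `P_i`. -/
structure Family (i : Fin 3 → ℕ) (Φ : Equiv.Perm (Fin 3) → Module.End F M) : Prop where
  one : Φ 1 = 1
  step : ∀ (τ : Equiv.Perm (Fin 3)) (k : Fin 2), InP i τ → Adm (permAct τ i) k →
    ∀ z ∈ S.wt (qs F i),
    Φ (tr k * τ) z = S.T k (permAct τ i) (Φ τ z)
  ne : ∀ (τ : Equiv.Perm (Fin 3)) (k : Fin 2), InP i τ →
    qs F (permAct τ i) k.castSucc ≠ qs F (permAct τ i) k.succ
  Om_ne : ∀ (τ : Equiv.Perm (Fin 3)) (k : Fin 2), InP i τ → Adm (permAct τ i) k →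
    Om F (permAct τ i k.castSucc) (permAct τ i k.succ) ≠ 0
  kill : ∀ (τ : Equiv.Perm (Fin 3)) (k : Fin 2), InP i τ → ¬Adm (permAct τ i) k →
    ∀ z ∈ S.wt (qs F (permAct τ i)),
    S.R k (qs F (permAct τ i)) z = 0
  sep : ∀ τ τ', InP i τ → InP i τ' → qs F (permAct τ i) = qs F (permAct τ' i) → τ = τ'

section Family

variable {i : Fin 3 → ℕ} {Φ : Equiv.Perm (Fin 3) → Module.End F M} (hΦ : S.Family i Φ)
include hΦ

theorem Family.mem {τ : Equiv.Perm (Fin 3)} (hτ : InP i τ) {z : M} (hz : z ∈ S.wt (qs F i)) :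
    Φ τ z ∈ S.wt (qs F (permAct τ i)) := by
  refine InP.rec_tr (P := fun τ => Φ τ z ∈ S.wt (qs F (permAct τ i))) ?_ ?_ hτ
  · rw [hΦ.one]; exact hz
  · intro τ k hτ ih hk
    rw [hΦ.step τ k hτ hk z hz, permAct_tr_mul]
    exact T_mem (hΦ.ne τ k hτ) ih

theorem Family.x {τ : Equiv.Perm (Fin 3)} (hτ : InP i τ) {z : M} (hz : z ∈ S.wt (qs F i)) :
    ∀ m, Φ τ (S.x m z) = S.x (τ m) (Φ τ z) := by
  refine InP.rec_tr (P := fun τ => ∀ m, Φ τ (S.x m z) = S.x (τ m) (Φ τ z)) ?_ ?_ hτ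
  · intro m; rw [hΦ.one]; rfl
  · intro τ k hτ ih hk m
    rw [hΦ.step τ k hτ hk z hz, hΦ.step τ k hτ hk _ ((wt_pstable _).x _ _ hz), ih, T_apply,
      T_apply, R_x k (hΦ.ne τ k hτ) _ (hΦ.mem hτ hz), map_smul]
    rfl

theorem Family.c {τ : Equiv.Perm (Fin 3)} (hτ : InP i τ) {z : M} (hz : z ∈ S.wt (qs F i)) :
    ∀ m, Φ τ (S.c m z) = S.c (τ m) (Φ τ z) := by
  refine InP.rec_tr (P := fun τ => ∀ m, Φ τ (S.c m z) = S.c (τ m) (Φ τ z)) ?_ ?_ hτ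
  · intro m; rw [hΦ.one]; rfl
  · intro τ k hτ ih hk m
    rw [hΦ.step τ k hτ hk z hz, hΦ.step τ k hτ hk _ ((wt_pstable _).c _ _ hz), ih, T_apply,
      T_apply, R_c, map_smul]
    rfl

theorem Family.θ {τ : Equiv.Perm (Fin 3)} (hτ : InP i τ) {z : M} (hz : z ∈ S.wt (qs F i)) :
    Φ τ (S.θ z) = S.θ (Φ τ z) := by
  refine InP.rec_tr (P := fun τ => Φ τ (S.θ z) = S.θ (Φ τ z)) ?_ ?_ hτ
  · rw [hΦ.one]; rfl
  · intro τ k hτ ih hk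
    rw [hΦ.step τ k hτ hk z hz, hΦ.step τ k hτ hk _ ((wt_pstable _).θ _ hz), ih, T_apply,
      T_apply, R_θ, map_smul]

/-- Each step of a word in P_i is admissible, hence invertible by `T_T`. -/
theorem Family.eq_zero {τ : Equiv.Perm (Fin 3)} (hτ : InP i τ) {z : M}
    (hz : z ∈ S.wt (qs F i)) : Φ τ z = 0 → z = 0 := by
  refine InP.rec_tr (P := fun τ => Φ τ z = 0 → z = 0) ?_ ?_ hτ
  · rw [hΦ.one]; exact id
  · intro τ k hτ ih hk h0
    rw [hΦ.step τ k hτ hk z hz] at h0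
    refine ih ?_
    rw [← T_T (hΦ.Om_ne τ k hτ hk) (hΦ.mem hτ hz), h0, map_zero]

theorem Family.s {τ : Equiv.Perm (Fin 3)} (hτ : InP i τ) {z : M} (hz : z ∈ S.wt (qs F i))
    {k : Fin 2} (hk : Adm (permAct τ i) k) :
    S.s k (Φ τ z) = Om F (permAct τ i k.castSucc) (permAct τ i k.succ) • Φ (tr k * τ) z -
      (qs F (permAct τ i) k.castSucc - qs F (permAct τ i) k.succ)⁻¹ • S.ν k (Φ τ z) := by
  rw [hΦ.step τ k hτ hk z hz, T_apply, smul_smul, mul_inv_cancel₀ (hΦ.Om_ne τ k hτ hk), one_smul,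
    ← s_eq]

theorem Family.s' {τ : Equiv.Perm (Fin 3)} (hτ : InP i τ) {z : M} (hz : z ∈ S.wt (qs F i))
    {k : Fin 2} (hk : ¬Adm (permAct τ i) k) :
    S.s k (Φ τ z) =
      -((qs F (permAct τ i) k.castSucc - qs F (permAct τ i) k.succ)⁻¹ • S.ν k (Φ τ z)) := by
  rw [s_eq k (qs F (permAct τ i)), hΦ.kill τ k hτ hk _ (hΦ.mem hτ hz), zero_sub]

theorem Family.ν {τ : Equiv.Perm (Fin 3)} (hτ : InP i τ) {z : M} (hz : z ∈ S.wt (qs F i))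
    (a b : Fin 3) :
    Φ τ (nu (S.x (τ⁻¹ a)) (S.x (τ⁻¹ b)) (S.c (τ⁻¹ a)) (S.c (τ⁻¹ b)) z) =
      nu (S.x a) (S.x b) (S.c a) (S.c b) (Φ τ z) := by
  have h := wt_pstable (S := S) (qs F i)
  have hx (m : Fin 3) := h.x m z hz
  rw [nu_apply, nu_apply, map_add, map_add,
    hΦ.c hτ (h.c _ _ (Submodule.sub_mem _ (hx _) (hx _))),
    hΦ.c hτ (Submodule.sub_mem _ (hx _) (hx _)), map_sub, hΦ.x hτ hz, hΦ.x hτ hz]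
  simp

/-- The maps `Φ τ ∘ g` assemble to a map on D^i. In an admissible step `s_k = R_k - (a - b)⁻¹ ν_k`
is the formula with Ω and Ξ; in a non-admissible one `R_k` vanishes and only Ξ remains. Surjectivity
is irreducibility, and injectivity holds because distinct `τ` land in distinct weight spaces. -/
theorem Family.exists_equiv (hirr : S.Irr) {C : SuperRep.{u, w} F 3 ∅} {g : C.V →ₗ[F] M} {σ : F}
    (hg : S.Hom C g σ) (hinj : Function.Injective g) (hw : ∀ z, g z ∈ S.wt (qs F i))
    (hC : Nontrivial C.V) :
    ∃ f : (D i C).V ≃ₗ[F] M, S.Hom (D i C) f.toLinearMap σ ∧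
      ∀ (τ : {τ // InP i τ}) (z : C.V), f (Dι i C τ z) = Φ τ.1 (g z) := by
  let f : (D i C).V →ₗ[F] M := Ddesc i C fun τ => Φ τ.1 ∘ₗ g
  have fs (τ : {τ // InP i τ}) (z : C.V) : f (Dι i C τ z) = Φ τ.1 (g z) := Ddesc_ι _ τ z
  have hf : S.Hom (D i C) f σ := by
    refine ⟨fun a v => ?_, fun v => ?_, hg.sign⟩
    · induction v using D_induction with
      | h0 => simp only [map_zero]
      | hadd v w hv hw => simp only [map_add, hv, hw]
      | hs τ z =>
      rw [fs]
      cases a with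
      | x k =>
        rw [D_op_x, fs, hg.x, hΦ.x τ.2 (hw z)]
        simp [op, Gen.incl]
      | c k =>
        rw [D_op_c, fs, hg.c, hΦ.c τ.2 (hw z)]
        simp [op, Gen.incl]
      | s k hk hJ =>
        change _ = S.s ⟨k, by omega⟩ (Φ τ.1 (g z))
        rw [D_op_s, map_add, fs, hg.Xi, map_neg, map_smul, hΦ.ν τ.2 (hw z)]
        by_cases h : Admissible (permAct τ.1 i) k hk
        · rw [dif_pos h, hΦ.s τ.2 (hw z) (k := ⟨k, by omega⟩) h, map_smul, fs, neg_add_eq_sub]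
          rfl
        · rw [dif_neg h, hΦ.s' τ.2 (hw z) (k := ⟨k, by omega⟩) h, map_zero, add_zero]
          rfl
    · induction v using D_induction with
      | h0 => simp only [map_zero, smul_zero]
      | hadd v w hv hw => simp only [map_add, hv, hw, smul_add]
      | hs τ z =>
      rw [D_θ, fs, fs, hg.θ, map_smul, hΦ.θ τ.2 (hw z)]
  have hfi : Function.Injective f := by
    rw [injective_iff_map_eq_zero]
    intro v hv
    refine D_ext fun τ => ?_
    have hoff := D_map_sub_mem (N := S.off (qs F (permAct τ.1 i))) f τ (fun τ' hτ' z => by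
      rw [fs]
      exact wt_le_off (fun e => hτ' (Subtype.ext (hΦ.sep _ _ τ'.2 τ.2 e)))
        (hΦ.mem τ'.2 (hw _))) v
    rw [hv, zero_sub, Submodule.neg_mem_iff, fs] at hoff
    have h0 := eq_zero_of_mem_off (hΦ.mem τ.2 (hw _)) hoff
    exact hinj ((hΦ.eq_zero τ.2 (hw _) h0).trans (map_zero g).symm)
  have hf0 : f ≠ 0 := by
    obtain ⟨z, hz⟩ := exists_ne (0 : C.V)
    intro h0
    have := fs ⟨1, InP.one⟩ z
    rw [h0, LinearMap.zero_apply, hΦ.one] at this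
    exact hz (hinj (this.symm.trans (map_zero g).symm))
  exact ⟨LinearEquiv.ofBijective f ⟨hfi, hf.surjective hirr hf0⟩, hf, fs⟩

theorem Family.isSemisimple [Module.Finite F M] (h2 : (2 : F) ≠ 0)
    {C : SuperRep.{u, w} F 3 ∅} {g : C.V →ₗ[F] M} (hw : ∀ z, g z ∈ S.wt (qs F i))
    (hx : ∀ m z, qs F i m = 0 → S.x m (g z) = 0) (f : (D i C).V ≃ₗ[F] M)
    (hf : ∀ (τ : {τ // InP i τ}) (z : C.V), f (Dι i C τ z) = Φ τ.1 (g z)) (k : Fin 3) :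
    (S.x k).IsSemisimple := by
  classical
  refine isSemisimple_of_le_iSup_eigenspace _
    (Finset.univ.image (fun m => root (qs F i m)) ∪
      Finset.univ.image (fun m => -root (qs F i m))) fun v _ => ?_
  obtain ⟨v, rfl⟩ := f.surjective v
  induction v using D_induction with
  | h0 => rw [map_zero]; exact zero_mem _
  | hadd v w hv hw => rw [map_add]; exact Submodule.add_mem _ (hv trivial) (hw trivial)
  | hs τ z =>
  rw [hf]
  have hm := hΦ.mem τ.2 (hw z) k
  have e : qs F (permAct τ.1 i) k = root (qs F i (τ.1⁻¹ k)) ^ 2 := (root_sq _).symm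
  rw [e] at hm
  -- On the summand of index `τ`, `x_k` corresponds to `x_{τ⁻¹ k}` on `C`; where the weight is zero,
  -- it acts as zero by `hx`.
  have := mem_eigenspaces_of_sq h2 (S.x k) hm (fun h => by
    have h1 := hΦ.x τ.2 (hw z) (τ.1⁻¹ k)
    rw [hx, map_zero] at h1
    · simpa using h1.symm
    · rw [← root_sq (qs F i _), h, zero_pow two_ne_zero])
  refine SetLike.le_def.1 (sup_le ?_ ?_) this
  · exact le_iSup₂_of_le _ (by simp) le_rfl
  · exact le_iSup₂_of_le _ (by simp) le_rfl

end Family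

/-- The composites along reduced words form a family for sequences without repetitions. -/
theorem word_family {p : ℕ} [CharP F p] (hp : p ≠ 2) (hirr : S.Irr) {i : Fin 3 → ℕ}
    (hi : Function.Injective i) (hI : ∀ k, i k ∈ II p) : S.Family i (S.word i) := by
  have hinj (τ : Equiv.Perm (Fin 3)) : Function.Injective (qs F (permAct τ i)) := fun _ _ h =>
    permAct_injective hi τ (q_injOn hp (hI _) (hI _) h)
  have hne (τ : Equiv.Perm (Fin 3)) (k : Fin 2) : permAct τ i k.castSucc ≠ permAct τ i k.succ :=
    fun h => k.castSucc_lt_succ.ne (permAct_injective hi τ h)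
  exact
  { one := word_one i
    step := fun τ k _ hk z hz => word_tr_mul hp hi hI hk hz
    ne := fun τ k _ => adjacent_ne (hinj τ) k
    Om_ne := fun τ k _ hk => Om_ne_zero hp (hI _) (hI _) (hne τ k) hk
    kill := fun τ k _ hk z hz => R_eq_zero_of_injective hirr (hinj τ) (discriminant_eq_zero hk) hz
    sep := by
      intro τ τ' _ _ h
      have : τ⁻¹ = τ'⁻¹ := Equiv.ext fun m => hi (q_injOn hp (hI _) (hI _) (congrFun h m))
      exact inv_injective this }

theorem InP_eq_one {i : Fin 3 → ℕ} (h : ∀ k, ¬Adm i k) {τ : Equiv.Perm (Fin 3)} (hτ : InP i τ) :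
    τ = 1 := by
  refine InP.rec_tr (P := fun τ => τ = 1) rfl ?_ hτ
  rintro τ k _ rfl hk
  exact absurd hk (h k)

/-- The trivial family for sequences without admissible transpositions. -/
theorem one_family {i : Fin 3 → ℕ} (h : ∀ k, ¬Adm i k)
    (hne : ∀ k : Fin 2, qs F i k.castSucc ≠ qs F i k.succ)
    (hkill : ∀ k, ∀ z ∈ S.wt (qs F i), S.R k (qs F i) z = 0) : S.Family i (fun _ => 1) where
  one := rfl
  step τ k hτ hk := by rw [InP_eq_one h hτ] at hk; exact absurd hk (h k)
  ne τ k hτ := by rw [InP_eq_one h hτ]; exact hne k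
  Om_ne τ k hτ hk := by rw [InP_eq_one h hτ] at hk; exact absurd hk (h k)
  kill τ k hτ _ := by rw [InP_eq_one h hτ]; exact hkill k
  sep τ τ' hτ hτ' _ := by rw [InP_eq_one h hτ, InP_eq_one h hτ']

end Sys

end HeckeClifford

/-! ### Irreducible modules of the polynomial-Clifford algebra -/

namespace HeckeClifford

/-- A superspace with operators satisfying the relations of `𝒫ᶜ_n`. -/
structure PSys (F : Type u) [Field F] (n : ℕ) (M : Type v) [AddCommGroup M] [Module F M] where
  x : Fin n → Module.End F M
  c : Fin n → Module.End F M
  θ : Module.End F M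
  xx : ∀ i j v, x i (x j v) = x j (x i v)
  cc : ∀ i v, c i (c i v) = v
  cd : ∀ i j, i ≠ j → ∀ v, c i (c j v) = -c j (c i v)
  xc : ∀ i v, x i (c i v) = -c i (x i v)
  xd : ∀ i j, i ≠ j → ∀ v, x i (c j v) = c j (x i v)
  θθ : ∀ v, θ (θ v) = v
  θx : ∀ i v, θ (x i v) = x i (θ v)
  θc : ∀ i v, θ (c i v) = -c i (θ v)

namespace PSys

variable {F : Type u} [Field F] {n : ℕ} {M : Type v} [AddCommGroup M] [Module F M]

/-- Graded subspaces stable under the operators. -/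
structure Stable (P : PSys F n M) (N : Submodule F M) : Prop where
  x : ∀ k, ∀ v ∈ N, P.x k v ∈ N
  c : ∀ k, ∀ v ∈ N, P.c k v ∈ N
  θ : ∀ v ∈ N, P.θ v ∈ N

/-- The operators on a stable subspace. -/
def restrict (P : PSys F n M) {N : Submodule F M} (h : P.Stable N) : PSys F n N where
  x k := (P.x k).restrict (h.x k)
  c k := (P.c k).restrict (h.c k)
  θ := P.θ.restrict h.θ
  xx i j v := Subtype.ext (P.xx i j v)
  cc i v := Subtype.ext (P.cc i v)
  cd i j hij v := Subtype.ext (P.cd i j hij v)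
  xc i v := Subtype.ext (P.xc i v)
  xd i j hij v := Subtype.ext (P.xd i j hij v)
  θθ v := Subtype.ext (P.θθ v)
  θx i v := Subtype.ext (P.θx i v)
  θc i v := Subtype.ext (P.θc i v)

/-- The transposed operators on the dual space. -/
def dual (P : PSys F n M) : PSys F n (Module.Dual F M) where
  x k := (P.x k).dualMap
  c k := (P.c k).dualMap
  θ := P.θ.dualMap
  xx i j v := LinearMap.ext fun m => by simp [P.xx i j]
  cc i v := LinearMap.ext fun m => by simp [P.cc]
  cd i j hij v := LinearMap.ext fun m => by simp [P.cd j i hij.symm]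
  xc i v := LinearMap.ext fun m => by simp [P.xc]
  xd i j hij v := LinearMap.ext fun m => by simp [P.xd i j hij]
  θθ v := LinearMap.ext fun m => by simp [P.θθ]
  θx i v := LinearMap.ext fun m => by simp [P.θx]
  θc i v := LinearMap.ext fun m => by simp [P.θc]

/-- The square roots can be prescribed because `c_m` changes the sign of the eigenvalue of `x_m` and
of no other. One index is treated at a time: either `(x_m + r_m) v` is the required vector, or it is
zero and `c_m v` is. -/
theorem exists_joint_eigenvector (P : PSys F n M) [Nontrivial M] (r : Fin n → F)
    (hr : ∀ k v, P.x k (P.x k v) = r k ^ 2 • v) :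
    ∃ v ≠ 0, (∀ k, P.x k v = r k • v) ∧ ∃ σ : F, (σ = 1 ∨ σ = -1) ∧ P.θ v = σ • v := by
  have key (j : ℕ) : ∃ v ≠ 0, ∀ k : Fin n, k.val < j → P.x k v = r k • v := by
    induction j with
    | zero =>
      obtain ⟨v, hv⟩ := exists_ne (0 : M)
      exact ⟨v, hv, fun k hk => absurd hk (Nat.not_lt_zero _)⟩
    | succ j ih =>
      obtain ⟨v, hv, hv'⟩ := ih
      by_cases hj : j < n
      · set m : Fin n := ⟨j, hj⟩ with hm
        have hcase (k : Fin n) (hk : k.val < j + 1) (hkm : k ≠ m) : k.val < j := by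
          have : k.val ≠ j := fun e => hkm (Fin.ext e)
          omega
        by_cases h0 : P.x m v + r m • v = 0
        · refine ⟨P.c m v, fun h => hv ?_, fun k hk => ?_⟩
          · rw [← P.cc m v, h, map_zero]
          · by_cases hkm : k = m
            · subst hkm
              rw [P.xc, eq_neg_of_add_eq_zero_left h0, map_neg, map_smul, neg_neg]
            · rw [P.xd k m hkm, hv' k (hcase k hk hkm), map_smul]
        · refine ⟨_, h0, fun k hk => ?_⟩
          by_cases hkm : k = m
          · subst hkm
            rw [map_add, map_smul, hr]
            module
          · rw [map_add, map_smul, P.xx, hv' k (hcase k hk hkm), map_smul, smul_add, smul_comm]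
      · exact ⟨v, hv, fun k _ => hv' k (by omega)⟩
  obtain ⟨v, hv, hv'⟩ := key n
  -- The vector is made homogeneous: its even part is used unless that vanishes, in which case it is
  -- already odd.
  by_cases h0 : v + P.θ v = 0
  · refine ⟨v, hv, fun k => hv' k k.2, -1, Or.inr rfl, ?_⟩
    rw [eq_neg_of_add_eq_zero_right h0]; simp
  · refine ⟨_, h0, fun k => ?_, 1, Or.inl rfl, ?_⟩
    · rw [map_add, ← P.θx, hv' k k.2, map_smul, smul_add]
    · rw [map_add, P.θθ, one_smul, add_comm]

/-- The product `c_{j-1}^{b_{j-1}} ⋯ c_0^{b_0}`. -/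
def cw (P : PSys F n M) (b : Fin n → ZMod 2) : ℕ → Module.End F M
  | 0 => 1
  | j + 1 => if h : j < n then
      (if b ⟨j, h⟩ = 0 then P.cw b j else P.c ⟨j, h⟩ * P.cw b j) else P.cw b j

/-- The sum `b_0 + ⋯ + b_{j-1}`. -/
def psum (b : Fin n → ZMod 2) (j : ℕ) : ZMod 2 :=
  ∑ l ∈ Finset.univ.filter (fun l : Fin n => l.val < j), b l

theorem psum_succ (b : Fin n → ZMod 2) {j : ℕ} (h : j < n) :
    psum b (j + 1) = psum b j + b ⟨j, h⟩ := by
  unfold psum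
  have : Finset.univ.filter (fun l : Fin n => l.val < j + 1) =
      insert ⟨j, h⟩ (Finset.univ.filter (fun l : Fin n => l.val < j)) := by
    ext l
    simp only [Finset.mem_filter, Finset.mem_univ, true_and, Finset.mem_insert, Fin.ext_iff]
    omega
  rw [this, Finset.sum_insert (by simp), add_comm]

theorem zmod_two_eq_one {a : ZMod 2} (h : a ≠ 0) : a = 1 := by
  revert a; decide

theorem cw_x (P : PSys F n M) (b : Fin n → ZMod 2) (k : Fin n) (v : M) (j : ℕ) :
    P.cw b j (P.x k v) = (if k.val < j then sgn F (b k) else 1) • P.x k (P.cw b j v) := by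
  induction j with
  | zero => simp [cw]
  | succ j ih =>
    by_cases hj : j < n
    · simp only [cw, dif_pos hj]
      by_cases hb : b ⟨j, hj⟩ = 0
      · rw [if_pos hb, ih]
        congr 1
        by_cases hk : k.val = j
        · have : k = ⟨j, hj⟩ := Fin.ext hk
          subst this
          simp [hb, sgn_zero]
        · simp only [show (k.val < j + 1) = (k.val < j) by rw [eq_iff_iff]; omega]
      · rw [if_neg hb, Module.End.mul_apply, Module.End.mul_apply, ih, map_smul]
        by_cases hk : k.val = j
        · have : k = ⟨j, hj⟩ := Fin.ext hk
          subst this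
          simp [zmod_two_eq_one hb, sgn_one, P.xc]
        · have hne : k ≠ ⟨j, hj⟩ := fun e => hk (congrArg Fin.val e)
          rw [P.xd k _ hne]
          simp only [show (k.val < j + 1) = (k.val < j) by rw [eq_iff_iff]; omega]
    · simp only [cw, dif_neg hj]
      rw [ih, if_pos (by omega), if_pos (by omega)]

theorem cw_θ (P : PSys F n M) (b : Fin n → ZMod 2) (v : M) {j : ℕ} (hj : j ≤ n) :
    P.cw b j (P.θ v) = sgn F (psum b j) • P.θ (P.cw b j v) := by
  induction j with
  | zero => simp [cw, psum, sgn_zero]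
  | succ j ih =>
    rw [psum_succ b (by omega : j < n)]
    simp only [cw, dif_pos (show j < n by omega), sgn_add, mul_smul]
    by_cases hb : b ⟨j, by omega⟩ = 0
    · rw [if_pos hb, ih (by omega), hb, sgn_zero, one_smul]
    · rw [if_neg hb, Module.End.mul_apply, Module.End.mul_apply, ih (by omega), map_smul,
        zmod_two_eq_one hb, sgn_one, P.θc]
      simp

theorem cw_c_of_le (P : PSys F n M) (b : Fin n → ZMod 2) (k : Fin n) (v : M) {j : ℕ}
    (hj : j ≤ k.val) : P.cw b j (P.c k v) = sgn F (psum b j) • P.c k (P.cw b j v) := by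
  induction j with
  | zero => simp [cw, psum, sgn_zero]
  | succ j ih =>
    have hjn : j < n := by omega
    rw [psum_succ b hjn]
    simp only [cw, dif_pos hjn, sgn_add, mul_smul]
    by_cases hb : b ⟨j, hjn⟩ = 0
    · rw [if_pos hb, ih (by omega), hb, sgn_zero, one_smul]
    · rw [if_neg hb, Module.End.mul_apply, Module.End.mul_apply, ih (by omega), map_smul,
        zmod_two_eq_one hb, sgn_one, P.cd _ k (fun e => by rw [← e] at hj; simp at hj)]
      simp

theorem cw_congr (P : PSys F n M) {b b' : Fin n → ZMod 2} {j : ℕ}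
    (h : ∀ l : Fin n, l.val < j → b l = b' l) : P.cw b j = P.cw b' j := by
  induction j with
  | zero => rfl
  | succ j ih =>
    simp only [cw]
    rw [ih fun l hl => h l (by omega)]
    split_ifs with h1 h2 h3 h3
    · rfl
    · exact absurd ((h ⟨j, h1⟩ (Nat.lt_succ_self j)).symm.trans h2) h3
    · exact absurd ((h ⟨j, h1⟩ (Nat.lt_succ_self j)).trans h3) h2
    · rfl
    · rfl

theorem cw_c_of_lt (P : PSys F n M) (b : Fin n → ZMod 2) (k : Fin n) (v : M) {j : ℕ}
    (hj : k.val < j) (hjn : j ≤ n) :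
    P.cw b j (P.c k v) = sgn F (psum b k.val) • P.cw (b + Pi.single k 1) j v := by
  induction j with
  | zero => exact absurd hj (Nat.not_lt_zero _)
  | succ j ih =>
    have hjn' : j < n := by omega
    simp only [cw, dif_pos hjn']
    by_cases hk : k.val = j
    · have hk' : k = ⟨j, hjn'⟩ := Fin.ext hk
      have hcw : P.cw (b + Pi.single k 1) j = P.cw b j := by
        refine P.cw_congr fun l hl => ?_
        have : l ≠ k := fun e => by rw [e, hk] at hl; exact lt_irrefl _ hl
        simp [this]
      rw [hcw, hk]
      have hs : (b + Pi.single k 1 : Fin n → ZMod 2) (⟨j, hjn'⟩ : Fin n) = b ⟨j, hjn'⟩ + 1 := by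
        rw [← hk']; simp
      have h2 : (1 + 1 : ZMod 2) = 0 := by decide
      have h1 := P.cw_c_of_le b k v (le_of_eq hk.symm)
      by_cases hb : b ⟨j, hjn'⟩ = 0
      · rw [if_pos hb, if_neg (by rw [hs, hb]; decide), h1, Module.End.mul_apply, hk']
      · rw [if_neg hb, if_pos (by rw [hs, zmod_two_eq_one hb]; decide), Module.End.mul_apply, h1,
          map_smul, ← hk', P.cc]
    · have hne : (⟨j, hjn'⟩ : Fin n) ≠ k := fun e => hk (congrArg Fin.val e).symm
      have hs : (b + Pi.single k 1 : Fin n → ZMod 2) (⟨j, hjn'⟩ : Fin n) = b ⟨j, hjn'⟩ := by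
        simp [hne]
      rw [hs]
      by_cases hb : b ⟨j, hjn'⟩ = 0
      · rw [if_pos hb, if_pos hb, ih (by omega) (by omega)]
      · rw [if_neg hb, if_neg hb, Module.End.mul_apply, Module.End.mul_apply,
          ih (by omega) (by omega), map_smul]

variable [IsAlgClosed F]

/-- A nonzero homomorphism to the outer tensor product `L(i_1) ⊠ ⋯ ⊠ L(i_n)`. -/
theorem exists_hom_outerL (P : PSys F n M) [Nontrivial M] (i : Fin n → ℕ) (J : Set ℕ)
    (hJ : ∀ k ∈ J, n ≤ k + 1) (hr : ∀ k v, P.x k (P.x k v) = q F (i k) • v) :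
    ∃ (f : M →ₗ[F] (outerL F J hJ i).V) (σ : F), (σ = 1 ∨ σ = -1) ∧ f ≠ 0 ∧
      (∀ k v, f (P.x k v) = (outerL F J hJ i).op (.x k) (f v)) ∧
      (∀ k v, f (P.c k v) = (outerL F J hJ i).op (.c k) (f v)) ∧
      ∀ v, f (P.θ v) = σ • (outerL F J hJ i).θ (f v) := by
  -- A map into the outer tensor product amounts to a functional that picks out the coefficient of
  -- the product of the vectors `v_0`; such a functional is a joint eigenvector in the dual.
  obtain ⟨l, hl0, hlx, σ, hσ, hlθ⟩ := P.dual.exists_joint_eigenvector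
    (fun k => root (q F (i k))) (fun k l => LinearMap.ext fun v => by
      change l (P.x k (P.x k v)) = _
      rw [hr, root_sq, map_smul]; rfl)
  have hx (k : Fin n) (v : M) : l (P.x k v) = root (q F (i k)) * l v :=
    LinearMap.congr_fun (hlx k) v
  have hθ (v : M) : l (P.θ v) = σ * l v := LinearMap.congr_fun hlθ v
  -- The other coordinates are the matrix coefficients of `l` along the Clifford monomials; at `b =
  -- 0` the monomial is `1`, so the map is nonzero. An odd `l` gives the sign `σ = -1`, that is, a
  -- parity shift.
  refine ⟨LinearMap.pi fun b => l ∘ₗ P.cw b n, σ, hσ, ?_, ?_, ?_, ?_⟩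
  · intro h
    apply hl0
    ext v
    have h1 := congrFun (LinearMap.congr_fun h v) 0
    have h2 (j : ℕ) : P.cw 0 j = 1 := by
      induction j with
      | zero => rfl
      | succ j ih => simp [cw, ih]
    change l (P.cw 0 n v) = 0 at h1
    rw [h2] at h1
    exact h1
  · intro k v
    funext b
    change l (P.cw b n (P.x k v)) = (sgn F (b k) * root (q F (i k))) * l (P.cw b n v)
    rw [P.cw_x, if_pos k.2, map_smul, hx, smul_eq_mul, mul_assoc]
  · intro k v
    funext b
    change l (P.cw b n (P.c k v)) = sgn F (∑ l ∈ Finset.univ.filter (· < k), b l) *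
      l (P.cw (b + Pi.single k 1) n v)
    rw [P.cw_c_of_lt b k v k.2 le_rfl, map_smul]
    rfl
  · intro v
    funext b
    change l (P.cw b n (P.θ v)) = σ * (sgn F (∑ l, b l) * l (P.cw b n v))
    have : psum b n = ∑ l, b l := by
      unfold psum
      rw [Finset.filter_true_of_mem fun l _ => l.2]
    rw [P.cw_θ b v le_rfl, map_smul, hθ, this, smul_eq_mul]
    ring

/-- Every irreducible `𝒫ᶜ_n`-module of weight `i` is isomorphic to `L(i_1) ⊛ ⋯ ⊛ L(i_n)`. -/
theorem exists_component (P : PSys F n M) (i : Fin n → ℕ) {N : Submodule F M} (hN : P.Stable N)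
    (h0 : N ≠ ⊥) (hmin : ∀ U ≤ N, P.Stable U → U = ⊥ ∨ U = N)
    (hr : ∀ k, ∀ v ∈ N, P.x k (P.x k v) = q F (i k) • v) :
    ∃ C : SuperRep.{u, u} F n ∅, IsL i C ∧ ∃ (g : C.V →ₗ[F] M) (σ : F), (σ = 1 ∨ σ = -1) ∧
      Function.Injective g ∧ LinearMap.range g = N ∧
      (∀ k z, g (C.op (.x k) z) = P.x k (g z)) ∧ (∀ k z, g (C.op (.c k) z) = P.c k (g z)) ∧
      ∀ z, g (C.θ z) = σ • P.θ (g z) := by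
  have : Nontrivial N := Submodule.nontrivial_iff_ne_bot.2 h0
  set O := outerL F ∅ (fun k hk => absurd hk (Set.notMem_empty k)) i with hO
  obtain ⟨f, σ, hσ, hf0, hfx, hfc, hfθ⟩ := (P.restrict hN).exists_hom_outerL i ∅
    (fun k hk => absurd hk (Set.notMem_empty k)) (fun k v => Subtype.ext (hr k v v.2))
  have hσ2 : σ * σ = 1 := by rcases hσ with rfl | rfl <;> simp
  have hfθ' (v : N) : O.θ (f v) = σ • f ((P.restrict hN).θ v) := by
    rw [hfθ, smul_smul, hσ2, one_smul]
  have submin (U : Submodule F N) (hU : (P.restrict hN).Stable U) : U = ⊥ ∨ U = ⊤ := by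
    have hle : U.map N.subtype ≤ N := Submodule.map_subtype_le N U
    have hst : P.Stable (U.map N.subtype) := by
      refine ⟨fun k => ?_, fun k => ?_, ?_⟩
      · rintro _ ⟨v, hv, rfl⟩; exact ⟨_, hU.x k v hv, rfl⟩
      · rintro _ ⟨v, hv, rfl⟩; exact ⟨_, hU.c k v hv, rfl⟩
      · rintro _ ⟨v, hv, rfl⟩; exact ⟨_, hU.θ v hv, rfl⟩
    rcases hmin _ hle hst with h | h
    · left
      apply Submodule.map_injective_of_injective N.injective_subtype
      rw [h, Submodule.map_bot]
    · right
      apply Submodule.map_injective_of_injective N.injective_subtype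
      rw [h, Submodule.map_subtype_top]
  -- The kernel is stable, so minimality of `N` makes `f` injective; the component sought is its
  -- image.
  have hker : LinearMap.ker f = ⊥ := by
    refine (submin _ ⟨fun k v hv => ?_, fun k v hv => ?_, fun v hv => ?_⟩).resolve_right
      (fun h => hf0 (LinearMap.ker_eq_top.1 h))
    · rw [LinearMap.mem_ker] at hv ⊢; rw [hfx, hv, map_zero]
    · rw [LinearMap.mem_ker] at hv ⊢; rw [hfc, hv, map_zero]
    · rw [LinearMap.mem_ker] at hv ⊢; rw [hfθ, hv, map_zero, smul_zero]
  have hinj : Function.Injective f := LinearMap.ker_eq_bot.1 hker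
  let T : O.Sub :=
    { N := LinearMap.range f
      θ_mem := by rintro _ ⟨v, rfl⟩; rw [hfθ']; exact ⟨_, map_smul f _ _⟩
      op_mem := by
        rintro g _ ⟨v, rfl⟩
        cases g with
        | x k => exact ⟨_, hfx k v⟩
        | c k => exact ⟨_, hfc k v⟩
        | s k hk hJ => exact absurd hJ (Set.notMem_empty k) }
  let e : N ≃ₗ[F] T.N := LinearEquiv.ofInjective f hinj
  have ex (k : Fin n) (v : N) : e ((P.restrict hN).x k v) = T.rep.op (.x k) (e v) :=
    Subtype.ext (hfx k v)
  have ec (k : Fin n) (v : N) : e ((P.restrict hN).c k v) = T.rep.op (.c k) (e v) :=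
    Subtype.ext (hfc k v)
  have eθ (v : N) : T.rep.θ (e v) = e (σ • (P.restrict hN).θ v) :=
    Subtype.ext ((hfθ' v).trans (map_smul f _ _).symm)
  let e' : T.rep.V ≃ₗ[F] N := e.symm
  have e'x (k : Fin n) (z : T.rep.V) : e' (T.rep.op (.x k) z) = (P.restrict hN).x k (e' z) := by
    refine e.symm_apply_eq.2 ?_
    rw [ex]
    exact congrArg _ (e.apply_symm_apply z).symm
  have e'c (k : Fin n) (z : T.rep.V) : e' (T.rep.op (.c k) z) = (P.restrict hN).c k (e' z) := by
    refine e.symm_apply_eq.2 ?_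
    rw [ec]
    exact congrArg _ (e.apply_symm_apply z).symm
  have e'θ (z : T.rep.V) : e' (T.rep.θ z) = σ • (P.restrict hN).θ (e' z) := by
    refine e.symm_apply_eq.2 ?_
    rw [← eθ]
    exact congrArg _ (e.apply_symm_apply z).symm
  refine ⟨T.rep, ⟨⟨e'.toEquiv.nontrivial, fun S => ?_⟩, T, rfl⟩, N.subtype ∘ₗ e'.toLinearMap, σ, hσ,
    N.injective_subtype.comp e'.injective, ?_, fun k z => ?_, fun k z => ?_, fun z => ?_⟩
  · have hst : (P.restrict hN).Stable (S.N.map e'.toLinearMap) := by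
      refine ⟨fun k => ?_, fun k => ?_, ?_⟩
      · rintro _ ⟨v, hv, rfl⟩; exact ⟨_, S.op_mem (.x k) v hv, e'x k v⟩
      · rintro _ ⟨v, hv, rfl⟩; exact ⟨_, S.op_mem (.c k) v hv, e'c k v⟩
      · rintro _ ⟨v, hv, rfl⟩
        refine ⟨σ • T.rep.θ v, S.N.smul_mem _ (S.θ_mem v hv), ?_⟩
        rw [map_smul]
        change σ • e' (T.rep.θ v) = _
        rw [e'θ, smul_smul, hσ2, one_smul]
        rfl
    rcases submin _ hst with h | h
    · left
      apply Submodule.map_injective_of_injective (f := e'.toLinearMap) e'.injective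
      rw [h, Submodule.map_bot]
    · right
      apply Submodule.map_injective_of_injective (f := e'.toLinearMap) e'.injective
      rw [h, Submodule.map_top, LinearEquiv.range]
  · rw [LinearMap.range_comp, LinearEquiv.range, Submodule.map_subtype_top]
  · exact congrArg Subtype.val (e'x k z)
  · exact congrArg Subtype.val (e'c k z)
  · exact congrArg Subtype.val (e'θ z)

theorem exists_minimal_stable {F : Type u} [Field F] {M : Type v} [AddCommGroup M] [Module F M]
    [Module.Finite F M] (Q : Submodule F M → Prop) {W : Submodule F M} (hW : Q W) (h0 : W ≠ ⊥) :
    ∃ N ≤ W, Q N ∧ N ≠ ⊥ ∧ ∀ U ≤ N, Q U → U = ⊥ ∨ U = N := by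
  obtain ⟨N, ⟨hNW, hQ, hN0⟩, hmin⟩ := WellFounded.has_min (wellFounded_lt (α := Submodule F M))
    {U | U ≤ W ∧ Q U ∧ U ≠ ⊥} ⟨W, le_rfl, hW, h0⟩
  refine ⟨N, hNW, hQ, hN0, fun U hU hQU => ?_⟩
  by_contra! h
  exact hmin U ⟨hU.trans hNW, hQU, h.1⟩ (lt_of_le_of_ne hU h.2)

end PSys

end HeckeClifford

/-! ### Induced modules and their universal property -/

namespace HeckeClifford

section Hc

variable {F : Type u} [Field F] {n : ℕ}

theorem Hc.mk_surjective : Function.Surjective (Hc.mk F n) :=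
  RingQuot.mkAlgHom_surjective F (Rel F n)

/-- `ℌᶜ_n` is generated by the generators. -/
theorem Hc.subalgebra_eq_top (A : Subalgebra F (Hc F n)) (h : ∀ g, gen F g ∈ A) (y : Hc F n) :
    y ∈ A := by
  obtain ⟨a, rfl⟩ := Hc.mk_surjective y
  induction a using FreeAlgebra.induction with
  | grade0 r => rw [AlgHom.commutes]; exact A.algebraMap_mem r
  | grade1 g => exact h g
  | mul a b ha hb => rw [map_mul]; exact A.mul_mem ha hb
  | add a b ha hb => rw [map_add]; exact A.add_mem ha hb

variable {M : Type v} [AddCommGroup M] [Module F M]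

theorem Hc.mk_fx (k : Fin n) : Hc.mk F n (fx F n k) = gen F (.x k) := rfl

theorem Hc.mk_fc (k : Fin n) : Hc.mk F n (fc F n k) = gen F (.c k) := rfl

theorem Hc.mk_fs (k : ℕ) (hk : k + 1 < n) :
    Hc.mk F n (fs F n k hk) = gen F (.s k hk (Set.mem_univ k)) := rfl

theorem Hc.map_mem (ρ : Hc F n →ₐ[F] Module.End F M) {N : Submodule F M}
    (h : ∀ g, ∀ v ∈ N, ρ (gen F g) v ∈ N) (y : Hc F n) : ∀ v ∈ N, ρ y v ∈ N := by
  let A : Subalgebra F (Hc F n) :=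
    { carrier := {y | ∀ v ∈ N, ρ y v ∈ N}
      mul_mem' := fun {a b} ha hb v hv => by
        rw [map_mul]; exact ha _ (hb v hv)
      add_mem' := fun {a b} ha hb v hv => by
        rw [map_add]; exact N.add_mem (ha v hv) (hb v hv)
      algebraMap_mem' := fun r v hv => by
        rw [AlgHom.commutes]; exact N.smul_mem r hv }
  exact Hc.subalgebra_eq_top A h y

end Hc

namespace SuperRep

variable {F : Type u} [Field F] {n : ℕ} {J : Set ℕ} (A : SuperRep.{u, v} F n J)

/-- The map `z ↦ 1 ⊗ z` into the induced module. -/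
noncomputable def indι : A.V →ₗ[F] A.ind.V :=
  A.indRel.mkQ ∘ₗ TensorProduct.mk F (Hc F n) A.V 1

/-- The action of the algebra on the induced module. -/
noncomputable def indρ : Hc F n →ₐ[F] Module.End F A.ind.V :=
  AlgHom.ofLinearMap
    { toFun := fun y => Submodule.mapQ _ _
        (TensorProduct.map (LinearMap.mulLeft F y) LinearMap.id) (A.indRel_mul y)
      map_add' := fun y y' => by
        refine Submodule.linearMap_qext _ (TensorProduct.ext' fun h z => ?_)
        change A.indRel.mkQ (((y + y') * h) ⊗ₜ[F] z) =
          A.indRel.mkQ ((y * h) ⊗ₜ[F] z) + A.indRel.mkQ ((y' * h) ⊗ₜ[F] z)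
        rw [add_mul, TensorProduct.add_tmul, map_add]
      map_smul' := fun r y => by
        refine Submodule.linearMap_qext _ (TensorProduct.ext' fun h z => ?_)
        change A.indRel.mkQ (((r • y) * h) ⊗ₜ[F] z) = r • A.indRel.mkQ ((y * h) ⊗ₜ[F] z)
        rw [smul_mul_assoc, ← TensorProduct.smul_tmul', map_smul] }
    (by
      refine Submodule.linearMap_qext _ (TensorProduct.ext' fun h z => ?_)
      change A.indRel.mkQ ((1 * h) ⊗ₜ[F] z) = A.indRel.mkQ (h ⊗ₜ[F] z)
      rw [one_mul])
    (fun y y' => by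
      refine Submodule.linearMap_qext _ (TensorProduct.ext' fun h z => ?_)
      change A.indRel.mkQ (((y * y') * h) ⊗ₜ[F] z) = A.indRel.mkQ ((y * (y' * h)) ⊗ₜ[F] z)
      rw [mul_assoc])

theorem indρ_gen (g : Gen n Set.univ) : A.indρ (gen F g) = A.ind.op g := rfl

theorem indρ_ι (y : Hc F n) (z : A.V) :
    A.indρ y (A.indι z) = A.indRel.mkQ (y ⊗ₜ[F] z) := by
  change A.indRel.mkQ ((y * 1) ⊗ₜ[F] z) = _
  rw [mul_one]

theorem ind_op_ι (g : Gen n J) (z : A.V) : A.ind.op g.incl (A.indι z) = A.indι (A.op g z) := by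
  change A.indRel.mkQ ((gen F g.incl * 1) ⊗ₜ[F] z) = A.indRel.mkQ (1 ⊗ₜ[F] A.op g z)
  rw [← sub_eq_zero, ← map_sub, Submodule.mkQ_apply, Submodule.Quotient.mk_eq_zero, mul_one]
  refine Submodule.subset_span ⟨1, g, z, ?_⟩
  rw [one_mul]

theorem ind_θ_ι (z : A.V) : A.ind.θ (A.indι z) = A.indι (A.θ z) := by
  change A.indRel.mkQ (Hc.parity F n 1 ⊗ₜ[F] A.θ z) = _
  rw [map_one]; rfl

theorem ind_eq_top {N : Submodule F A.ind.V} (h1 : ∀ z, A.indι z ∈ N)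
    (h : ∀ g, ∀ v ∈ N, A.ind.op g v ∈ N) : N = ⊤ := by
  rw [eq_top_iff]
  intro v _
  obtain ⟨t, rfl⟩ := A.indRel.mkQ_surjective v
  induction t with
  | zero => rw [map_zero]; exact zero_mem _
  | tmul y z =>
    rw [← indρ_ι]
    exact Hc.map_mem A.indρ h y _ (h1 z)
  | add t t' ht ht' => rw [map_add]; exact N.add_mem (ht trivial) (ht' trivial)

variable {A} {M : Type w} [AddCommGroup M] [Module F M]

/-- The universal property of the induced module. -/
theorem exists_ind_desc (ρ : Hc F n →ₐ[F] Module.End F M) (g : A.V →ₗ[F] M)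
    (h : ∀ a z, g (A.op a z) = ρ (gen F a.incl) (g z)) :
    ∃ f : A.ind.V →ₗ[F] M, (∀ z, f (A.indι z) = g z) ∧
      ∀ a v, f (A.ind.op a v) = ρ (gen F a) (f v) := by
  let f0 : Hc F n ⊗[F] A.V →ₗ[F] M :=
    TensorProduct.lift ((LinearMap.llcomp F A.V M M).flip g ∘ₗ ρ.toLinearMap)
  have hf0 (y : Hc F n) (z : A.V) : f0 (y ⊗ₜ z) = ρ y (g z) := rfl
  have hle : A.indRel ≤ LinearMap.ker f0 := by
    refine Submodule.span_le.2 ?_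
    rintro _ ⟨y, a, z, rfl⟩
    rw [SetLike.mem_coe, LinearMap.mem_ker, map_sub, hf0, hf0, h, map_mul, Module.End.mul_apply,
      sub_self]
  let f : A.ind.V →ₗ[F] M := A.indRel.liftQ f0 hle
  have hf (y : Hc F n) (z : A.V) : f (A.indρ y (A.indι z)) = ρ y (g z) := by
    rw [indρ_ι]; rfl
  refine ⟨f, fun z => ?_, fun a v => ?_⟩
  · simpa using hf 1 z
  · let N : Submodule F A.ind.V :=
      LinearMap.ker (f ∘ₗ A.ind.op a - ρ (gen F a) ∘ₗ f)
    have hN (y : Hc F n) (z : A.V) : A.indρ y (A.indι z) ∈ N := by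
      rw [LinearMap.mem_ker, LinearMap.sub_apply, LinearMap.comp_apply, LinearMap.comp_apply,
        ← indρ_gen, ← Module.End.mul_apply, ← map_mul, hf, hf, map_mul, Module.End.mul_apply,
        sub_self]
    have hv : v ∈ N := by
      obtain ⟨t, rfl⟩ := A.indRel.mkQ_surjective v
      induction t with
      | zero => rw [map_zero]; exact zero_mem _
      | tmul y z => rw [← indρ_ι]; exact hN y z
      | add t t' ht ht' => rw [map_add]; exact N.add_mem ht ht'
    exact sub_eq_zero.1 hv

end SuperRep

section Pair

variable {F : Type u} [Field F] {M : Type v} [AddCommGroup M] [Module F M]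

/-- The operators by which the generators of `ℌᶜ_2` act. -/
def pairOp (x y c d s : Module.End F M) : Gen 2 Set.univ → Module.End F M
  | .x k => if k = 0 then x else y
  | .c k => if k = 0 then c else d
  | .s _ _ _ => s

variable {x y c d s : Module.End F M}

/-- This makes a module over the rank three algebra into one over the rank two algebra at either
pair of adjacent indices, so that maps out of V(0,0) can be produced by the universal property. -/
theorem Pair.exists_rho (h : Pair x y c d s) :
    ∃ ρ : Hc F 2 →ₐ[F] Module.End F M, ∀ g, ρ (gen F g) = pairOp x y c d s g := by
  let f := FreeAlgebra.lift F (pairOp x y c d s)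
  have fx' (k : Fin 2) : f (fx F 2 k) = if k = 0 then x else y := FreeAlgebra.lift_ι_apply _ _
  have fc' (k : Fin 2) : f (fc F 2 k) = if k = 0 then c else d := FreeAlgebra.lift_ι_apply _ _
  have fs' (k : ℕ) (hk : k + 1 < 2) : f (fs F 2 k hk) = s := FreeAlgebra.lift_ι_apply _ _
  refine ⟨Hc.lift f ?_, fun g => ?_⟩
  · intro a b hab
    have cd' (v : M) : c (d v) = -d (c v) := by rw [h.cd, neg_neg]
    cases hab with
    | s_sq k hk => ext v; simp [fs', h.ss]
    | s_comm k l hk hl hkl => omega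
    | braid k hk hk' => omega
    | x_comm i j => ext v; fin_cases i <;> fin_cases j <;> simp [fx', h.xy]
    | c_sq i => ext v; fin_cases i <;> simp [fc', h.cc, h.dd]
    | c_anti i j hij =>
      ext v; fin_cases i <;> fin_cases j <;> first | exact absurd rfl hij | simp [fc', h.cd]
    | s_x k hk =>
      obtain rfl : k = 0 := by omega
      ext v; simp [fs', fx', fc', h.sx]
    | s_x_far k hk j hj hj' => omega
    | s_c k hk =>
      obtain rfl : k = 0 := by omega
      ext v; simp [fs', fc', h.sc]
    | s_c' k hk =>
      obtain rfl : k = 0 := by omega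
      ext v; simp [fs', fc', h.sd]
    | s_c_far k hk j hj hj' => omega
    | x_c i => ext v; fin_cases i <;> simp [fx', fc', h.xc, h.yd]
    | x_c_far i j hij =>
      ext v; fin_cases i <;> fin_cases j <;>
        first | exact absurd rfl hij | simp [fx', fc', h.xd, h.yc]
  · rw [gen, Hc.lift_mk]
    exact FreeAlgebra.lift_ι_apply _ _

/-- A representation of `ℌᶜ_2` satisfies the relations. -/
theorem Pair.of_rho (ρ : Hc F 2 →ₐ[F] Module.End F M) :
    Pair (ρ (gen F (.x 0))) (ρ (gen F (.x 1))) (ρ (gen F (.c 0))) (ρ (gen F (.c 1)))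
      (ρ (gen F (.s 0 (by omega) (Set.mem_univ _)))) := by
  have key {a b : FreeAlgebra F (Gen 2 Set.univ)} (h : Rel F 2 a b) (v : M) :
      ρ (Hc.mk F 2 a) v = ρ (Hc.mk F 2 b) v := by rw [Hc.mk_rel F 2 h]
  refine ⟨fun v => ?_, fun v => ?_, fun v => ?_, fun v => ?_, fun v => ?_, fun v => ?_,
    fun v => ?_, fun v => ?_, fun v => ?_, fun v => ?_, fun v => ?_, fun v => ?_⟩
  · simpa [Hc.mk_fx, Hc.mk_fc, Hc.mk_fs] using key (Rel.x_comm 1 0) v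
  · simpa [Hc.mk_fx, Hc.mk_fc, Hc.mk_fs] using key (Rel.c_sq 0) v
  · simpa [Hc.mk_fx, Hc.mk_fc, Hc.mk_fs] using key (Rel.c_sq 1) v
  · simpa [Hc.mk_fx, Hc.mk_fc, Hc.mk_fs] using key (Rel.c_anti 1 0 (by decide)) v
  · simpa [Hc.mk_fx, Hc.mk_fc, Hc.mk_fs] using key (Rel.x_c 0) v
  · simpa [Hc.mk_fx, Hc.mk_fc, Hc.mk_fs] using key (Rel.x_c_far 0 1 (by decide)) v
  · simpa [Hc.mk_fx, Hc.mk_fc, Hc.mk_fs] using key (Rel.x_c_far 1 0 (by decide)) v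
  · simpa [Hc.mk_fx, Hc.mk_fc, Hc.mk_fs] using key (Rel.x_c 1) v
  · simpa [Hc.mk_fx, Hc.mk_fc, Hc.mk_fs] using key (Rel.s_sq 0 (by omega)) v
  · simpa [Hc.mk_fx, Hc.mk_fc, Hc.mk_fs] using key (Rel.s_x 0 (by omega)) v
  · simpa [Hc.mk_fx, Hc.mk_fc, Hc.mk_fs] using key (Rel.s_c 0 (by omega)) v
  · simpa [Hc.mk_fx, Hc.mk_fc, Hc.mk_fs] using key (Rel.s_c' 0 (by omega)) v

theorem Pair.sup_map_stable (h : Pair x y c d s) {N : Submodule F M} (hx : ∀ v ∈ N, x v ∈ N)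
    (hy : ∀ v ∈ N, y v ∈ N) (hc : ∀ v ∈ N, c v ∈ N) (hd : ∀ v ∈ N, d v ∈ N)
    (g : Gen 2 Set.univ) : ∀ v ∈ N ⊔ N.map s, pairOp x y c d s g v ∈ N ⊔ N.map s := by
  have lN : N ≤ N ⊔ N.map s := le_sup_left
  have lS : ∀ v ∈ N, s v ∈ N ⊔ N.map s := fun v hv => Submodule.mem_sup_right ⟨v, hv, rfl⟩
  suffices N ⊔ N.map s ≤ (N ⊔ N.map s).comap (pairOp x y c d s g) from fun v hv => this hv
  rcases g with k | k | _
  · by_cases hk : k = 0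
    · simp only [pairOp, if_pos hk]
      refine sup_le (fun v hv => lN (hx v hv)) ?_
      rintro _ ⟨v, hv, rfl⟩
      rw [Submodule.mem_comap, eq_sub_of_add_eq (h.sy v).symm]
      exact Submodule.sub_mem _ (lS _ (hy _ hv)) (lN (N.sub_mem hv (hc _ (hd _ hv))))
    · simp only [pairOp, if_neg hk]
      refine sup_le (fun v hv => lN (hy v hv)) ?_
      rintro _ ⟨v, hv, rfl⟩
      rw [Submodule.mem_comap, sub_eq_iff_eq_add.1 (h.sx v).symm]
      exact Submodule.add_mem _ (lS _ (hx _ hv)) (lN (N.add_mem hv (hc _ (hd _ hv))))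
  · by_cases hk : k = 0
    · simp only [pairOp, if_pos hk]
      refine sup_le (fun v hv => lN (hc v hv)) ?_
      rintro _ ⟨v, hv, rfl⟩
      rw [Submodule.mem_comap, ← h.sd]
      exact lS _ (hd _ hv)
    · simp only [pairOp, if_neg hk]
      refine sup_le (fun v hv => lN (hd v hv)) ?_
      rintro _ ⟨v, hv, rfl⟩
      rw [Submodule.mem_comap, ← h.sc]
      exact lS _ (hc _ hv)
  · refine sup_le lS ?_
    rintro _ ⟨v, hv, rfl⟩
    change s (s v) ∈ N ⊔ N.map s
    rw [h.ss]
    exact lN hv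

/-- Every element of a module induced from `𝒫ᶜ_2` is of the form `1 ⊗ z + s ⊗ z'`. -/
theorem ind_two_eq (C : SuperRep.{u, v} F 2 ∅) (v : C.ind.V) : ∃ z z' : C.V,
    v = C.indι z + C.ind.op (.s 0 (by omega) (Set.mem_univ _)) (C.indι z') := by
  have h := Pair.of_rho C.indρ
  have hop (g : Gen 2 ∅) : ∀ v ∈ LinearMap.range C.indι,
      C.ind.op g.incl v ∈ LinearMap.range C.indι := by
    rintro _ ⟨z, rfl⟩
    exact ⟨_, (C.ind_op_ι g z).symm⟩
  have hs := h.sup_map_stable (N := LinearMap.range C.indι) (hop (.x 0)) (hop (.x 1)) (hop (.c 0))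
    (hop (.c 1))
  have hop' (g : Gen 2 Set.univ) : pairOp (C.indρ (gen F (.x 0))) (C.indρ (gen F (.x 1)))
      (C.indρ (gen F (.c 0))) (C.indρ (gen F (.c 1)))
      (C.indρ (gen F (.s 0 (by omega) (Set.mem_univ _)))) g = C.ind.op g := by
    rcases g with k | k | ⟨k, hk, hJ⟩
    · fin_cases k <;> rfl
    · fin_cases k <;> rfl
    · obtain rfl : k = 0 := by omega
      rfl
  have htop := C.ind_eq_top (N := LinearMap.range C.indι ⊔ (LinearMap.range C.indι).map
    (C.indρ (gen F (.s 0 (by omega) (Set.mem_univ _))))) (fun z => Submodule.mem_sup_left ⟨z, rfl⟩)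
    (fun g v hv => by rw [← hop' g]; exact hs g v hv)
  have hv : v ∈ (⊤ : Submodule F C.ind.V) := trivial
  rw [← htop] at hv
  obtain ⟨_, ⟨z, rfl⟩, _, ⟨_, ⟨z', rfl⟩, rfl⟩, rfl⟩ := Submodule.mem_sup.1 hv
  exact ⟨z, z', rfl⟩

end Pair

namespace Sys

variable {F : Type u} [Field F] {M : Type v} [AddCommGroup M] [Module F M]

/-- A graded representation of `ℌᶜ_3` satisfies the relations. -/
noncomputable def ofHc (ρ : Hc F 3 →ₐ[F] Module.End F M) (θ : Module.End F M)
    (hθθ : ∀ v, θ (θ v) = v)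
    (hθ : ∀ g v, θ (ρ (gen F g) v) = sgn F g.par • ρ (gen F g) (θ v)) : Sys F M :=
  have key {a b : FreeAlgebra F (Gen 3 Set.univ)} (h : Rel F 3 a b) (v : M) :
      ρ (Hc.mk F 3 a) v = ρ (Hc.mk F 3 b) v := by rw [Hc.mk_rel F 3 h]
  { x := fun k => ρ (gen F (.x k))
    c := fun k => ρ (gen F (.c k))
    s := fun k => ρ (gen F (.s k.val (by omega) (Set.mem_univ _)))
    θ := θ
    xx := fun i j v => by
      simpa [Hc.mk_fx, Hc.mk_fc, Hc.mk_fs] using key (Rel.x_comm i j) v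
    cc := fun i v => by simpa [Hc.mk_fx, Hc.mk_fc, Hc.mk_fs] using key (Rel.c_sq i) v
    cd := fun i j h v => by simpa [Hc.mk_fx, Hc.mk_fc, Hc.mk_fs] using key (Rel.c_anti i j h) v
    xc := fun i v => by simpa [Hc.mk_fx, Hc.mk_fc, Hc.mk_fs] using key (Rel.x_c i) v
    xd := fun i j h v => by simpa [Hc.mk_fx, Hc.mk_fc, Hc.mk_fs] using key (Rel.x_c_far i j h) v
    ss := fun k v => by
      have h := key (Rel.s_sq k.val (by omega)) v
      simp only [map_mul, map_sub, map_add, map_one, Module.End.mul_apply, LinearMap.sub_apply,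
        LinearMap.add_apply, Module.End.one_apply] at h
      exact h
    sx := fun k v => by
      have h := key (Rel.s_x k.val (by omega)) v
      simp only [map_mul, map_sub, map_add, map_one, Module.End.mul_apply, LinearMap.sub_apply,
        LinearMap.add_apply, Module.End.one_apply] at h
      exact h
    sc := fun k v => by
      have h := key (Rel.s_c k.val (by omega)) v
      simp only [map_mul, map_sub, map_add, map_one, Module.End.mul_apply, LinearMap.sub_apply,
        LinearMap.add_apply, Module.End.one_apply] at h
      exact h
    sd := fun k v => by
      have h := key (Rel.s_c' k.val (by omega)) v
      simp only [map_mul, map_sub, map_add, map_one, Module.End.mul_apply, LinearMap.sub_apply,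
        LinearMap.add_apply, Module.End.one_apply] at h
      exact h
    sx_far := fun k j hj hj' v => by
      have h := key (Rel.s_x_far k.val (by omega) j (fun e => hj (Fin.ext e))
        (fun e => hj' (Fin.ext e))) v
      simp only [map_mul, Module.End.mul_apply] at h
      exact h
    sc_far := fun k j hj hj' v => by
      have h := key (Rel.s_c_far k.val (by omega) j (fun e => hj (Fin.ext e))
        (fun e => hj' (Fin.ext e))) v
      simp only [map_mul, Module.End.mul_apply] at h
      exact h
    braid := fun v => by
      simpa [Hc.mk_fx, Hc.mk_fc, Hc.mk_fs] using key (Rel.braid 0 (by omega) (by omega)) v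
    θθ := hθθ
    θx := fun i v => by rw [hθ]; simp [Gen.par, sgn_zero]
    θc := fun i v => by rw [hθ]; simp [Gen.par, sgn_one]
    θs := fun k v => by rw [hθ]; simp [Gen.par, sgn_zero] }

theorem ofHc_op (ρ : Hc F 3 →ₐ[F] Module.End F M) (θ : Module.End F M) (hθθ : ∀ v, θ (θ v) = v)
    (hθ : ∀ g v, θ (ρ (gen F g) v) = sgn F g.par • ρ (gen F g) (θ v)) (g : Gen 3 Set.univ) :
    (ofHc ρ θ hθθ hθ).op g = ρ (gen F g) := by
  cases g <;> rfl

end Sys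

end HeckeClifford

/-! ### Copies of V(0,0) inside a module -/

namespace HeckeClifford

namespace Sys

variable {F : Type u} [Field F] {M : Type v} [AddCommGroup M] [Module F M] (S : Sys F M)

/-- The operators `x_k`, `c_k` with indices in the image of `e`. -/
def toPSys {n : ℕ} (e : Fin n → Fin 3) (he : Function.Injective e) : PSys F n M where
  x k := S.x (e k)
  c k := S.c (e k)
  θ := S.θ
  xx i j v := S.xx _ _ v
  cc i v := S.cc _ v
  cd i j h v := S.cd _ _ (he.ne h) v
  xc i v := S.xc _ v
  xd i j h v := S.xd _ _ (he.ne h) v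
  θθ := S.θθ
  θx i v := S.θx _ v
  θc i v := S.θc _ v

variable {S}

theorem PStable.toPSys {N : Submodule F M} (h : S.PStable N) {n : ℕ} (e : Fin n → Fin 3)
    (he : Function.Injective e) : (S.toPSys e he).Stable N :=
  ⟨fun k => h.x (e k), fun k => h.c (e k), h.θ⟩

/-- The subspace of `W` on which the `x_l` act by the scalars `r_l`. -/
def eigen (W : Submodule F M) (r : Fin 3 → F) : Submodule F M where
  carrier := {v | v ∈ W ∧ ∀ l, S.x l v = r l • v}
  zero_mem' := by simp
  add_mem' := by
    rintro v w ⟨hv, hv'⟩ ⟨hw, hw'⟩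
    exact ⟨W.add_mem hv hw, fun l => by rw [map_add, hv', hw', smul_add]⟩
  smul_mem' := by
    rintro a v ⟨hv, hv'⟩
    exact ⟨W.smul_mem a hv, fun l => by rw [map_smul, hv', smul_comm]⟩

theorem eigen_ne_bot [Module.Finite F M] {W : Submodule F M} (hW : S.PStable W) (h0 : W ≠ ⊥)
    {r : Fin 3 → F} (hr : ∀ l, ∀ v ∈ W, S.x l (S.x l v) = r l ^ 2 • v) :
    S.eigen W r ≠ ⊥ := by
  have : Nontrivial W := Submodule.nontrivial_iff_ne_bot.2 h0
  have hst := hW.toPSys id Function.injective_id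
  obtain ⟨v, hv0, hv, -⟩ := ((S.toPSys id Function.injective_id).restrict
    hst).exists_joint_eigenvector r (fun l v => Subtype.ext (hr l v v.2))
  exact (Submodule.ne_bot_iff _).2 ⟨v, ⟨v.2, fun l => congrArg Subtype.val (hv l)⟩,
    fun h => hv0 (Subtype.ext h)⟩

/-- A module `V(0,0)` inside a subspace on which `x_k` and `x_{k+1}` are nilpotent. -/
theorem exists_V00 [IsAlgClosed F] [Module.Finite F M] (h2 : (2 : F) ≠ 0) (k : Fin 2) {m : Fin 3}
    (hm : m ≠ k.castSucc) (hm' : m ≠ k.succ) {W : Submodule F M} (hW : S.PStable W)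
    (hs : ∀ v ∈ W, S.s k v ∈ W) (h0 : W ≠ ⊥) (r : F)
    (ha : ∀ v ∈ W, S.x k.castSucc (S.x k.castSucc v) = 0)
    (hb : ∀ v ∈ W, S.x k.succ (S.x k.succ v) = 0)
    (hr : ∀ v ∈ W, S.x m (S.x m v) = r ^ 2 • v) :
    ∃ B : SuperRep.{u, u} F 2 Set.univ, IsV00 B ∧ Nontrivial B.V ∧ ∃ (G : B.V →ₗ[F] M) (σ : F),
      (σ = 1 ∨ σ = -1) ∧ Function.Injective G ∧ (∀ b, G b ∈ W) ∧ (∀ b, S.x m (G b) = r • G b) ∧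
      (∀ g b, G (B.op g b) = pairOp (S.x k.castSucc) (S.x k.succ) (S.c k.castSucc) (S.c k.succ)
        (S.s k) g (G b)) ∧
      ∀ b, G (B.θ b) = σ • S.θ (G b) := by
  have hne : k.castSucc ≠ k.succ := k.castSucc_lt_succ.ne
  let e : Fin 2 → Fin 3 := ![k.castSucc, k.succ]
  have he : Function.Injective e := by
    intro i j
    fin_cases i <;> fin_cases j <;> simp [e, hne, hne.symm]
  have hem (i : Fin 2) : m ≠ e i := by
    fin_cases i
    · exact hm
    · exact hm'
  -- The eigenvalue `r` of the third `x_m` is fixed as well. The resulting V(0,0) then lies in one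
  -- half of the subspace, and `c_m` carries it to the half with eigenvalue `-r`.
  let ρ : Fin 3 → F := fun l => if l = m then r else 0
  have hρm : ρ m = r := if_pos rfl
  have hρe (i : Fin 2) : ρ (e i) = 0 := if_neg (hem i).symm
  have hcov (l : Fin 3) : l = m ∨ ∃ i, l = e i := by
    by_cases h : l = k.castSucc
    · exact Or.inr ⟨0, h⟩
    by_cases h' : l = k.succ
    · exact Or.inr ⟨1, h'⟩
    left
    fin_cases k <;> fin_cases l <;> fin_cases m <;> simp_all
  have hne0 := eigen_ne_bot (S := S) hW h0 (r := ρ) (fun l v hv => by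
    rcases hcov l with rfl | ⟨i, rfl⟩
    · rw [hρm]; exact hr v hv
    · rw [hρe, zero_pow two_ne_zero, zero_smul]
      fin_cases i
      · exact ha v hv
      · exact hb v hv)
  -- Stability under `c_k` and `c_{k+1}` holds because their eigenvalues are `0` and a sign change
  -- does nothing; `c_m` is not among the operators considered.
  have hst : (S.toPSys e he).Stable (S.eigen W ρ) := by
    refine ⟨fun i v hv => ?_, fun i v hv => ⟨hW.c _ _ hv.1, fun l => ?_⟩,
      fun v hv => ⟨hW.θ _ hv.1, fun l => ?_⟩⟩
    · have : S.x (e i) v = 0 := by rw [hv.2, hρe, zero_smul]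
      change S.x (e i) v ∈ _
      rw [this]
      exact zero_mem _
    · change S.x l (S.c (e i) v) = ρ l • S.c (e i) v
      by_cases h : l = e i
      · subst h; rw [S.xc, hv.2, hρe, zero_smul, zero_smul, map_zero, neg_zero]
      · rw [S.xd _ _ h, hv.2, map_smul]
    · change S.x l (S.θ v) = ρ l • S.θ v
      rw [← S.θx, hv.2, map_smul]
  obtain ⟨N, hNle, hNst, hN0, hNmin⟩ :=
    PSys.exists_minimal_stable (S.toPSys e he).Stable hst hne0
  obtain ⟨C, hC, g, σ, hσ, hg, hgN, hgx, hgc, hgθ⟩ := PSys.exists_component (S.toPSys e he)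
    (fun _ => 0) hNst hN0 hNmin (fun i v hv => by
      change S.x (e i) (S.x (e i) v) = _
      rw [(hNle hv).2 (e i), hρe, zero_smul, map_zero, q]; simp)
  have hgE (z : C.V) : g z ∈ S.eigen W ρ := hNle (hgN ▸ LinearMap.mem_range_self g z)
  have hg0 (i : Fin 2) (z : C.V) : S.x (e i) (g z) = 0 := by rw [(hgE z).2, hρe, zero_smul]
  have hga (z : C.V) : S.x k.castSucc (g z) = 0 := hg0 0 z
  have hgb (z : C.V) : S.x k.succ (g z) = 0 := hg0 1 z
  obtain ⟨R, hR⟩ := (S.pair k).exists_rho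
  obtain ⟨G, hGι, hGop⟩ := SuperRep.exists_ind_desc (A := C) R g (by
    intro a z
    rw [hR]
    rcases a with l | l | ⟨_, _, h⟩
    · rw [hgx]; fin_cases l <;> rfl
    · rw [hgc]; fin_cases l <;> rfl
    · exact absurd h (Set.notMem_empty _))
  have hGs (v) : G (C.ind.op (.s 0 (by omega) (Set.mem_univ _)) v) = S.s k (G v) := by
    rw [hGop, hR]; rfl
  have hCn : Nontrivial C.V := hC.1.1
  have hgn : ∃ z : C.V, g z ≠ 0 := by
    obtain ⟨z, hz⟩ := exists_ne (0 : C.V)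
    exact ⟨z, fun h => hz (hg (h.trans (map_zero g).symm))⟩
  obtain ⟨z0, hz0⟩ := hgn
  refine ⟨C.ind, ⟨C, hC, rfl⟩, ⟨C.indι z0, 0, fun h => hz0 (by rw [← hGι, h, map_zero])⟩, G,
    σ, hσ, ?_, fun b => ?_, fun b => ?_, fun a b => ?_, fun b => ?_⟩
  · rw [injective_iff_map_eq_zero]
    intro b hb0
    obtain ⟨z, z', rfl⟩ := ind_two_eq C b
    rw [map_add, hGs, hGι, hGι] at hb0
    -- If `g z + s g z' = 0`, applying `x_{k+1}` leaves `(1 + c_k c_{k+1}) g z' = 0`. As `c_k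
    -- c_{k+1}` squares to `-1`, this gives `2 g z' = 0`.
    have h1 := congrArg (S.x k.succ) hb0
    rw [map_add, hgb, zero_add, map_zero,
      ← add_eq_of_eq_sub (S.sx k (g z')), hga, map_zero,
      zero_add] at h1
    have h3 : S.c k.castSucc (S.c k.succ (g z')) = -g z' := (neg_eq_of_add_eq_zero_right h1).symm
    have h4 : (2 : F) • g z' = 0 := by
      have h5 := congrArg (fun v => S.c k.castSucc (S.c k.succ v)) h3
      simp only [map_neg] at h5
      rw [S.cd _ _ hne.symm, map_neg, S.cc, S.cc, h3, neg_neg] at h5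
      rw [two_smul]
      nth_rewrite 1 [← h5]
      rw [neg_add_cancel]
    have h5 : g z' = 0 := (smul_eq_zero.1 h4).resolve_left h2
    rw [h5, map_zero, add_zero] at hb0
    rw [hg (hb0.trans (map_zero g).symm), hg (h5.trans (map_zero g).symm), map_zero, map_zero,
      add_zero]
  · obtain ⟨z, z', rfl⟩ := ind_two_eq C b
    rw [map_add, hGs, hGι, hGι]
    exact W.add_mem (hgE z).1 (hs _ (hgE z').1)
  · obtain ⟨z, z', rfl⟩ := ind_two_eq C b
    rw [map_add, hGs, hGι, hGι, map_add, ← S.sx_far k m hm hm', (hgE z).2, (hgE z').2, hρm,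
      map_smul, smul_add]
  · rw [hGop, hR]
  · obtain ⟨z, z', rfl⟩ := ind_two_eq C b
    simp only [map_add, C.ind.θ_op, Gen.par, sgn_zero, one_smul, SuperRep.ind_θ_ι, hGι, hGs, hgθ]
    rw [smul_add, S.θs, map_smul]
    rfl
/-- A representation that is embedded as a minimal stable subspace is irreducible. -/
theorem Hom.irreducible {J : Set ℕ} {A : SuperRep.{u, w} F 3 J} {f : A.V →ₗ[F] M} {σ : F}
    (h : S.Hom A f σ) (hf : Function.Injective f) (h0 : LinearMap.range f ≠ ⊥)
    (hmin : ∀ U ≤ LinearMap.range f, (∀ (g : Gen 3 J), ∀ v ∈ U, S.op g.incl v ∈ U) →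
      (∀ v ∈ U, S.θ v ∈ U) → U = ⊥ ∨ U = LinearMap.range f) : A.Irreducible := by
  refine ⟨?_, fun T => ?_⟩
  · by_contra hn
    rw [not_nontrivial_iff_subsingleton] at hn
    refine h0 (LinearMap.range_eq_bot.2 (LinearMap.ext fun v => ?_))
    exact (congrArg f (Subsingleton.elim v 0)).trans (map_zero f)
  · have hinj := Submodule.map_injective_of_injective hf
    have key := hmin (T.N.map f) LinearMap.map_le_range
      (fun g => by
        rintro _ ⟨v, hv, rfl⟩
        exact ⟨_, T.op_mem g v hv, h.op g v⟩)
      (by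
        rintro _ ⟨v, hv, rfl⟩
        exact ⟨_, T.N.smul_mem _ (T.θ_mem v hv), (h.θ_apply v).symm⟩)
    refine key.imp (fun h1 => hinj (h1.trans (Submodule.map_bot f).symm)) (fun h1 => hinj ?_)
    rw [h1, Submodule.map_top]

end Sys

/-- The space of a representation, as a stable subspace of itself. -/
def SuperRep.topSub {F : Type u} [Field F] {n : ℕ} {J : Set ℕ} (A : SuperRep.{u, v} F n J) :
    A.Sub :=
  ⟨⊤, fun _ _ => trivial, fun _ _ _ => trivial⟩

/-- The inclusion of the space of `A.topSub.rep`. -/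
def SuperRep.topIncl {F : Type u} [Field F] {n : ℕ} {J : Set ℕ} (A : SuperRep.{u, v} F n J) :
    A.topSub.rep.V →ₗ[F] A.V :=
  Submodule.subtype (⊤ : Submodule F A.V)

theorem SuperRep.topIncl_injective {F : Type u} [Field F] {n : ℕ} {J : Set ℕ}
    (A : SuperRep.{u, v} F n J) : Function.Injective A.topIncl :=
  Subtype.val_injective

theorem SuperRep.topIncl_surjective {F : Type u} [Field F] {n : ℕ} {J : Set ℕ}
    (A : SuperRep.{u, v} F n J) : Function.Surjective A.topIncl :=
  fun v => ⟨⟨v, trivial⟩, rfl⟩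

theorem Sys.Hom.top {F : Type u} [Field F] {M : Type v} [AddCommGroup M] [Module F M]
    {S : Sys F M} {J : Set ℕ} {A : SuperRep.{u, w} F 3 J} {f : A.V →ₗ[F] M} {σ : F}
    (h : S.Hom A f σ) : S.Hom A.topSub.rep (f ∘ₗ A.topIncl) σ :=
  ⟨fun g v => h.op g v.1, fun v => h.θ v.1, h.sign⟩

/-! ### Outer tensor products of V(0,0) with L(j) -/

section Box

variable {F : Type u} [Field F] [IsAlgClosed F]

namespace SuperRep

variable {m n : ℕ} {A : SuperRep.{u, v} F m Set.univ} {B : SuperRep.{u, w} F n Set.univ}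

/-- The pure tensors in `A ⊠ B`. -/
noncomputable def tm (A : SuperRep.{u, v} F m Set.univ) (B : SuperRep.{u, w} F n Set.univ) :
    A.V →ₗ[F] B.V →ₗ[F] (A.box B).V :=
  TensorProduct.mk F A.V B.V

@[elab_as_elim]
theorem box_induction {P : (A.box B).V → Prop} (t : (A.box B).V) (h0 : P 0)
    (ht : ∀ a b, P (tm A B a b)) (hadd : ∀ t t', P t → P t' → P (t + t')) : P t :=
  TensorProduct.induction_on t h0 ht hadd

theorem box_θ (a : A.V) (b : B.V) : (A.box B).θ (tm A B a b) = tm A B (A.θ a) (B.θ b) := rfl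

theorem box_op_inl {g : Gen (m + n) (levi m)} {a' : Gen m Set.univ} (h : split m n g = .inl a')
    (a : A.V) (b : B.V) : (A.box B).op g (tm A B a b) = tm A B (A.op a' a) b := by
  change (match split m n g with
    | .inl a => TensorProduct.map (A.op a) LinearMap.id
    | .inr b => TensorProduct.map (if b.par = 0 then LinearMap.id else A.θ) (B.op b)) (a ⊗ₜ b) = _
  rw [h]; rfl

theorem box_op_inr {g : Gen (m + n) (levi m)} {b' : Gen n Set.univ} (h : split m n g = .inr b')
    (a : A.V) (b : B.V) :
    (A.box B).op g (tm A B a b) = tm A B (if b'.par = 0 then a else A.θ a) (B.op b' b) := by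
  change (match split m n g with
    | .inl a => TensorProduct.map (A.op a) LinearMap.id
    | .inr b => TensorProduct.map (if b.par = 0 then LinearMap.id else A.θ) (B.op b)) (a ⊗ₜ b) = _
  rw [h]
  split_ifs with h0
  · simp only [if_pos h0]; rfl
  · simp only [if_neg h0]; rfl

end SuperRep

/-- The coordinates on the space of `L(j)`. -/
def L1.coord (j : ℕ) (a : ZMod 2) : (L1 F j).V →ₗ[F] F :=
  (LinearMap.proj (fun _ => a) : ((Fin 1 → ZMod 2) → F) →ₗ[F] F)

/-- The standard basis of the space of `L(j)`. -/
def L1.vec (j : ℕ) (a : ZMod 2) : (L1 F j).V :=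
  (Pi.single (fun _ => a) 1 : (Fin 1 → ZMod 2) → F)

namespace L1

theorem coord_x (j : ℕ) (φ : (L1 F j).V) (a : ZMod 2) :
    coord j a ((L1 F j).op (.x 0) φ) = sgn F a * root (q F j) * coord j a φ := rfl

theorem coord_c (j : ℕ) (φ : (L1 F j).V) (a : ZMod 2) :
    coord j a ((L1 F j).op (.c 0) φ) = coord j (a + 1) φ := by
  have h : (fun _ : Fin 1 => a) + Pi.single 0 1 = fun _ => a + 1 := by
    funext l
    obtain rfl := Subsingleton.elim l 0
    simp
  change sgn F (∑ l ∈ Finset.univ.filter (· < (0 : Fin 1)), a) *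
    (φ : (Fin 1 → ZMod 2) → F) ((fun _ : Fin 1 => a) + Pi.single 0 1) = _
  rw [h, show Finset.univ.filter (· < (0 : Fin 1)) = ∅ by decide, Finset.sum_empty, sgn_zero,
    one_mul]
  rfl

theorem coord_θ (j : ℕ) (φ : (L1 F j).V) (a : ZMod 2) :
    coord j a ((L1 F j).θ φ) = sgn F a * coord j a φ := by
  change sgn F (∑ _ : Fin 1, a) * _ = _
  rw [Fin.sum_univ_one]
  rfl

theorem coord_vec (j : ℕ) (a : ZMod 2) : coord j a (vec (F := F) j a) = 1 :=
  Pi.single_eq_same (M := fun _ => F) _ _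

theorem coord_vec_ne (j : ℕ) {a a' : ZMod 2} (h : a ≠ a') : coord j a (vec (F := F) j a') = 0 :=
  Pi.single_eq_of_ne (M := fun _ => F) (fun e => h (congrFun e 0)) _

theorem eq_coord (j : ℕ) (φ : (L1 F j).V) :
    φ = coord j 0 φ • vec j 0 + coord j 1 φ • vec j 1 := by
  have key (a : ZMod 2) :
      coord j a φ = coord j a (coord j 0 φ • vec j 0 + coord j 1 φ • vec j 1) := by
    by_cases ha : a = 0
    · subst ha
      rw [map_add, map_smul, map_smul, coord_vec, coord_vec_ne j zero_ne_one, smul_zero, add_zero,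
        smul_eq_mul, mul_one]
    · obtain rfl := PSys.zmod_two_eq_one ha
      rw [map_add, map_smul, map_smul, coord_vec, coord_vec_ne j one_ne_zero, smul_zero, zero_add,
        smul_eq_mul, mul_one]
  refine funext fun b : Fin 1 → ZMod 2 => ?_
  obtain ⟨a, rfl⟩ : ∃ a : ZMod 2, b = fun _ => a :=
    ⟨b 0, funext fun i => by rw [Subsingleton.elim i 0]⟩
  exact key a

/-- The bilinear map `(b, φ) ↦ φ(0) g b + φ(1) g' b`. -/
noncomputable def pairing (j : ℕ) {V : Type v} [AddCommGroup V] [Module F V] {M : Type w}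
    [AddCommGroup M] [Module F M] (g g' : V →ₗ[F] M) : V →ₗ[F] (L1 F j).V →ₗ[F] M :=
  LinearMap.mk₂ F (fun b φ => coord j 0 φ • g b + coord j 1 φ • g' b)
    (fun b b' f => by simp only [map_add, smul_add]; abel)
    (fun r b f => by simp only [map_smul, smul_add, smul_comm r])
    (fun b f f' => by simp only [map_add, add_smul]; abel)
    (fun r b f => by simp only [map_smul, smul_assoc, smul_add])

theorem exists_eq_tmul_add (j : ℕ) {V : Type v} [AddCommGroup V] [Module F V]
    (t : V ⊗[F] (L1 F j).V) : ∃ b b' : V, t = b ⊗ₜ vec j 0 + b' ⊗ₜ vec j 1 := by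
  induction t with
  | zero => exact ⟨0, 0, by simp⟩
  | tmul b f =>
    refine ⟨coord j 0 f • b, coord j 1 f • b, ?_⟩
    rw [TensorProduct.smul_tmul, TensorProduct.smul_tmul, ← TensorProduct.tmul_add, ← eq_coord]
  | add t t' ht ht' =>
    obtain ⟨b, b', rfl⟩ := ht
    obtain ⟨d, d', rfl⟩ := ht'
    exact ⟨b + d, b' + d', by simp only [TensorProduct.add_tmul]; abel⟩

/-- The images of `g` and `g'` lie in the eigenspaces of `x` for `r` and `-r`, which are independent
because `2r ≠ 0`. In the applications `r` is a root of `q(j)`, so `j` has to be nonzero. -/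
theorem pairing_lift_injective (j : ℕ) {V : Type v} [AddCommGroup V] [Module F V] {M : Type w}
    [AddCommGroup M] [Module F M] (h2 : (2 : F) ≠ 0) {g g' : V →ₗ[F] M}
    (hg : Function.Injective g) (hg' : Function.Injective g') {r : F} (hr : r ≠ 0)
    (x : Module.End F M) (hx : ∀ b, x (g b) = r • g b) (hx' : ∀ b, x (g' b) = -(r • g' b)) :
    Function.Injective (TensorProduct.lift (pairing j g g')) := by
  rw [injective_iff_map_eq_zero]
  intro t ht
  obtain ⟨b, b', rfl⟩ := exists_eq_tmul_add j t
  have h : g b + g' b' = 0 := by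
    simpa [pairing, coord_vec, coord_vec_ne j zero_ne_one, coord_vec_ne j one_ne_zero] using ht
  have h3 := congrArg x h
  rw [map_add, hx, hx', map_zero, ← sub_eq_add_neg, ← smul_sub] at h3
  have h4 : g b - g' b' = 0 := (smul_eq_zero.1 h3).resolve_left hr
  have h5 : (2 : F) • g b = 0 := by
    rw [two_smul]
    calc g b + g b = (g b + g' b') + (g b - g' b') := by abel
      _ = 0 := by rw [h, h4, add_zero]
  have h6 := (smul_eq_zero.1 h5).resolve_left h2
  rw [h6, zero_add] at h
  rw [hg (h6.trans (map_zero g).symm), hg' (h.trans (map_zero g').symm), TensorProduct.zero_tmul,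
    TensorProduct.zero_tmul, add_zero]

end L1

namespace Sys

variable {M : Type v} [AddCommGroup M] [Module F M] {S : Sys F M}

theorem PStable.range_eq {W : Submodule F M} {J : Set ℕ} {A : SuperRep.{u, u} F 3 J}
    {f : A.V →ₗ[F] M} {σ : F} (hf : S.Hom A f σ) (hfi : Function.Injective f)
    (hA : Nontrivial A.V)
    (hmin : ∀ U ≤ W, S.PStable U → (∀ (g : Gen 3 J), ∀ v ∈ U, S.op g.incl v ∈ U) →
      U = ⊥ ∨ U = W) (hle : ∀ t, f t ∈ W) : LinearMap.range f = W := by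
  refine (hmin _ ?_ hf.range_pstable ?_).resolve_left ?_
  · rintro _ ⟨t, rfl⟩
    exact hle t
  · rintro g _ ⟨t, rfl⟩
    exact ⟨_, hf.op g t⟩
  · intro h
    obtain ⟨t, ht⟩ := exists_ne (0 : A.V)
    exact ht (hfi ((LinearMap.congr_fun (LinearMap.range_eq_bot.1 h) t).trans (map_zero f).symm))

/-- Minimality of `W` makes the image of `f` all of `W`, so the outer tensor product is already
irreducible and is its own component. It appears as `A.topSub.rep` because components are stable
subspaces. -/
theorem Hom.isComponent {W : Submodule F M} {J : Set ℕ} {A : SuperRep.{u, u} F 3 J}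
    {f : A.V →ₗ[F] M} {σ : F} (hf : S.Hom A f σ) (hfi : Function.Injective f)
    (h0 : W ≠ ⊥) (hA : Nontrivial A.V)
    (hmin : ∀ U ≤ W, S.PStable U → (∀ (g : Gen 3 J), ∀ v ∈ U, S.op g.incl v ∈ U) →
      U = ⊥ ∨ U = W) (hle : ∀ t, f t ∈ W) :
    A.topSub.rep.IsComponent A ∧ ∃ (f' : A.topSub.rep.V →ₗ[F] M) (σ : F),
      S.Hom A.topSub.rep f' σ ∧ Function.Injective f' ∧ LinearMap.range f' = W := by
  have hinj := hfi.comp A.topIncl_injective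
  have hrange : LinearMap.range (f ∘ₗ A.topIncl) = W := by
    rw [LinearMap.range_comp_of_range_eq_top _
      (LinearMap.range_eq_top.2 A.topIncl_surjective),
      PStable.range_eq hf hfi hA hmin hle]
  refine ⟨⟨hf.top.irreducible hinj (by rwa [hrange]) (fun U hU hop hθ => ?_), _, rfl⟩,
    _, σ, hf.top, hinj, hrange⟩
  rw [hrange] at hU ⊢
  exact hmin U hU ⟨fun l => hop (.x l), fun l => hop (.c l), hθ⟩ hop

/-- A minimal subspace of weight `(0, 0, j)` is of the form `V(0,0) ⊛ L(j)`. -/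
theorem exists_V00L [Module.Finite F M] (h2 : (2 : F) ≠ 0) {j : ℕ} (hj : q F j ≠ 0)
    {W : Submodule F M} (hW : S.PStable W) (hs : ∀ v ∈ W, S.s 0 v ∈ W) (h0 : W ≠ ⊥)
    (hmin : ∀ U ≤ W, S.PStable U → (∀ v ∈ U, S.s 0 v ∈ U) → U = ⊥ ∨ U = W)
    (hwt : W ≤ S.wt (qs F ![0, 0, j])) :
    ∃ A : SuperRep.{u, u} F 3 (levi 2), IsV00L j A ∧ ∃ (f : A.V →ₗ[F] M) (σ : F),
      S.Hom A f σ ∧ Function.Injective f ∧ LinearMap.range f = W := by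
  have hr : root (q F j) ≠ 0 := fun h => hj (by rw [← root_sq (q F j), h]; simp)
  obtain ⟨B, hB, hBn, G, σ, hσ, hG, hGW, hGx, hGop, hGθ⟩ := S.exists_V00 h2 0 (m := 2)
    (by decide) (by decide) hW hs h0 (root (q F j))
    (fun v hv => by have := hwt hv 0; simpa [qs, q] using this)
    (fun v hv => by have := hwt hv 1; simpa [qs, q] using this)
    (fun v hv => by rw [root_sq]; exact hwt hv 2)
  -- This is the value at `b ⊗ v_1`: since the odd `c_2` passes the first factor with a sign, `b ⊗
  -- v_1 = c_2 (θ b ⊗ v_0)`.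
  let g' : B.V →ₗ[F] M := S.c 2 ∘ₗ G ∘ₗ B.θ
  have hg'a (b) : g' b = S.c 2 (G (B.θ b)) := rfl
  let f : (B.box (L1 F j)).V →ₗ[F] M := TensorProduct.lift (L1.pairing j G g')
  have hft (b : B.V) (φ : (L1 F j).V) : f (B.tm (L1 F j) b φ) =
      L1.coord j 0 φ • G b + L1.coord j 1 φ • S.c 2 (G (B.θ b)) := rfl
  have hg' : Function.Injective g' := by
    rw [injective_iff_map_eq_zero]
    intro b hb
    have h1 := congrArg (S.c 2) hb
    rw [hg'a, S.cc, map_zero] at h1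
    rw [← B.θ_θ b, hG (h1.trans (map_zero G).symm), map_zero]
  have hfi : Function.Injective f := L1.pairing_lift_injective j h2 hG hg' hr (S.x 2) hGx
    (fun b => by rw [hg'a, S.xc, hGx, map_smul])
  have comm {X : Module.End F M} {a : Gen 2 Set.univ} {ε : F} (h : ∀ b, G (B.op a b) = X (G b))
      (hε : sgn F a.par = ε) (hc : ∀ v, X (S.c 2 v) = ε • S.c 2 (X v)) (b φ) :
      f (B.tm (L1 F j) (B.op a b) φ) = X (f (B.tm (L1 F j) b φ)) := by
    rw [hft, hft, h, B.θ_op, map_smul, h, map_add, map_smul X, map_smul X, hc, map_smul, hε]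
  have hf : S.Hom (B.box (L1 F j)) f σ := by
    refine ⟨fun a t => ?_, fun t => ?_, hσ⟩
    · induction t using SuperRep.box_induction with
      | h0 => simp only [map_zero]
      | hadd t t' ht ht' => simp only [map_add, ht, ht']
      | ht b φ =>
        rcases a with l | l | ⟨l, hl, hJ⟩
        · have hx (l : Fin 2) (m : Fin 3) (hm : m ≠ 2) (h : ∀ b, G (B.op (.x l) b) = S.x m (G b)) :=
            comm h (sgn_zero F) (fun v => by rw [S.xd _ _ hm, one_smul]) b φ
          have h2 : f (B.tm (L1 F j) b ((L1 F j).op (.x 0) φ)) = S.x 2 (f (B.tm (L1 F j) b φ)) := by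
            rw [hft, hft, L1.coord_x, L1.coord_x, sgn_zero, sgn_one, map_add, map_smul (S.x 2),
              map_smul (S.x 2), S.xc, hGx, hGx, map_smul]
            module
          fin_cases l
          · exact (congrArg f (SuperRep.box_op_inl (g := .x 0) (a' := .x 0) rfl b φ)).trans
              (hx 0 0 (by decide) (hGop (.x 0)))
          · exact (congrArg f (SuperRep.box_op_inl (g := .x 1) (a' := .x 1) rfl b φ)).trans
              (hx 1 1 (by decide) (hGop (.x 1)))
          · exact (congrArg f (SuperRep.box_op_inr (g := .x 2) (b' := .x 0) rfl b φ)).trans h2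
        · have hc (l : Fin 2) (m : Fin 3) (hm : m ≠ 2) (h : ∀ b, G (B.op (.c l) b) = S.c m (G b)) :=
            comm h (sgn_one F) (fun v => by rw [S.cd _ _ hm, neg_one_smul]) b φ
          have h2 : f (B.tm (L1 F j) (B.θ b) ((L1 F j).op (.c 0) φ)) =
              S.c 2 (f (B.tm (L1 F j) b φ)) := by
            have h11 : (1 + 1 : ZMod 2) = 0 := by decide
            simp [hft, L1.coord_c, S.cc, B.θ_θ, h11, add_comm]
          fin_cases l
          · exact (congrArg f (SuperRep.box_op_inl (g := .c 0) (a' := .c 0) rfl b φ)).trans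
              (hc 0 0 (by decide) (hGop (.c 0)))
          · exact (congrArg f (SuperRep.box_op_inl (g := .c 1) (a' := .c 1) rfl b φ)).trans
              (hc 1 1 (by decide) (hGop (.c 1)))
          · exact (congrArg f (SuperRep.box_op_inr (g := .c 2) (b' := .c 0) rfl b φ)).trans h2
        · obtain rfl : l = 0 := by have : l + 1 ≠ 2 := hJ; omega
          exact (congrArg f (SuperRep.box_op_inl (g := .s 0 hl hJ)
            (a' := .s 0 (by omega) (Set.mem_univ _)) rfl b φ)).trans
            (comm (X := S.s 0) (hGop (.s 0 (by omega) (Set.mem_univ _))) (sgn_zero F) (fun v => by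
              rw [S.sc_far 0 2 (by decide) (by decide), one_smul]) b φ)
    · induction t using SuperRep.box_induction with
      | h0 => simp only [map_zero, smul_zero]
      | hadd t t' ht ht' => simp only [map_add, ht, ht', smul_add]
      | ht b φ =>
        rw [SuperRep.box_θ, hft, hft]
        simp only [L1.coord_θ, sgn_zero, sgn_one, map_add, map_smul, hGθ, B.θ_θ, S.θc, S.θθ]
        rcases hσ with rfl | rfl <;> simp
  have hbox : Nontrivial (B.box (L1 F j)).V := by
    obtain ⟨b, hb⟩ := exists_ne (0 : B.V)
    refine ⟨B.tm (L1 F j) b (L1.vec j 0), 0, fun h => hb (hG ?_)⟩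
    have h1 := congrArg f h
    rwa [hft, L1.coord_vec, L1.coord_vec_ne j one_ne_zero, one_smul, zero_smul, add_zero,
      map_zero, ← map_zero G] at h1
  obtain ⟨hcomp, f', σ', h⟩ := hf.isComponent (W := W) hfi h0 hbox
    (fun U hU hP hop => hmin U hU hP (hop (.s 0 (by omega) (by simp [levi])))) (fun t => by
      induction t using SuperRep.box_induction with
      | h0 => rw [map_zero]; exact W.zero_mem
      | hadd t t' ht ht' => rw [map_add]; exact W.add_mem ht ht'
      | ht b φ =>
        rw [hft]
        exact W.add_mem (W.smul_mem _ (hGW _)) (W.smul_mem _ (hW.c _ _ (hGW _))))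
  exact ⟨_, ⟨B, hB, hcomp⟩, f', σ', h⟩

set_option maxHeartbeats 1000000 in
/-- A minimal subspace of weight `(j, 0, 0)` is of the form `L(j) ⊛ V(0,0)`. -/
theorem exists_LV00 [Module.Finite F M] (h2 : (2 : F) ≠ 0) {j : ℕ} (hj : q F j ≠ 0)
    {W : Submodule F M} (hW : S.PStable W) (hs : ∀ v ∈ W, S.s 1 v ∈ W) (h0 : W ≠ ⊥)
    (hmin : ∀ U ≤ W, S.PStable U → (∀ v ∈ U, S.s 1 v ∈ U) → U = ⊥ ∨ U = W)
    (hwt : W ≤ S.wt (qs F ![j, 0, 0])) :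
    ∃ A : SuperRep.{u, u} F 3 (levi 1), IsLV00 j A ∧ ∃ (f : A.V →ₗ[F] M) (σ : F),
      S.Hom A f σ ∧ Function.Injective f ∧ LinearMap.range f = W := by
  have hr : root (q F j) ≠ 0 := fun h => hj (by rw [← root_sq (q F j), h]; simp)
  obtain ⟨B, hB, hBn, G, σ, hσ, hG, hGW, hGx, hGop, hGθ⟩ := S.exists_V00 h2 1 (m := 0)
    (by decide) (by decide) hW hs h0 (root (q F j))
    (fun v hv => by have := hwt hv 1; simpa [qs, q] using this)
    (fun v hv => by have := hwt hv 2; simpa [qs, q] using this)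
    (fun v hv => by rw [root_sq]; exact hwt hv 0)
  -- Now L(j) is the first factor, so `c_0` acts on it without a sign; the sign moves to the odd
  -- operators of the second factor, which act together with `θ` on L(j).
  let g' : B.V →ₗ[F] M := S.c 0 ∘ₗ G
  have hg'a (b) : g' b = S.c 0 (G b) := rfl
  let f : ((L1 F j).box B).V →ₗ[F] M := TensorProduct.lift (L1.pairing j G g') ∘ₗ
    (TensorProduct.comm F (L1 F j).V B.V).toLinearMap
  have hft (b : B.V) (φ : (L1 F j).V) : f ((L1 F j).tm B φ b) =
      L1.coord j 0 φ • G b + L1.coord j 1 φ • S.c 0 (G b) := rfl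
  have hg' : Function.Injective g' := by
    rw [injective_iff_map_eq_zero]
    intro b hb
    have h1 := congrArg (S.c 0) hb
    rw [hg'a, S.cc, map_zero] at h1
    exact hG (h1.trans (map_zero G).symm)
  have hfi : Function.Injective f := (L1.pairing_lift_injective j h2 hG hg' hr (S.x 0) hGx
    (fun b => by rw [hg'a, S.xc, hGx, map_smul])).comp (TensorProduct.comm F _ _).injective
  have even {X : Module.End F M} {a : Gen 2 Set.univ} (h : ∀ b, G (B.op a b) = X (G b))
      (hc : ∀ v, X (S.c 0 v) = S.c 0 (X v)) (φ b) :
      f ((L1 F j).tm B φ (B.op a b)) = X (f ((L1 F j).tm B φ b)) := by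
    rw [hft, hft, h, map_add, map_smul X, map_smul X, hc]
  have odd {X : Module.End F M} {a : Gen 2 Set.univ} (h : ∀ b, G (B.op a b) = X (G b))
      (hc : ∀ v, X (S.c 0 v) = -S.c 0 (X v)) (φ b) :
      f ((L1 F j).tm B ((L1 F j).θ φ) (B.op a b)) = X (f ((L1 F j).tm B φ b)) := by
    rw [hft, hft, h, map_add, map_smul X, map_smul X, hc, L1.coord_θ, L1.coord_θ, sgn_zero, sgn_one]
    module
  have hf : S.Hom ((L1 F j).box B) f σ := by
    refine ⟨fun a t => ?_, fun t => ?_, hσ⟩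
    · induction t using SuperRep.box_induction with
      | h0 => simp only [map_zero]
      | hadd t t' ht ht' => simp only [map_add, ht, ht']
      | ht φ b =>
        rcases a with l | l | ⟨l, hl, hJ⟩
        · have hx (l : Fin 2) (m : Fin 3) (hm : m ≠ 0) (h : ∀ b, G (B.op (.x l) b) = S.x m (G b)) :=
            even h (S.xd _ _ hm) φ b
          have h0 : f ((L1 F j).tm B ((L1 F j).op (.x 0) φ) b) = S.x 0 (f ((L1 F j).tm B φ b)) := by
            rw [hft, hft, L1.coord_x, L1.coord_x, sgn_zero, sgn_one, map_add, map_smul (S.x 0),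
              map_smul (S.x 0), S.xc, hGx, map_smul]
            module
          fin_cases l
          · exact (congrArg f (SuperRep.box_op_inl (g := .x 0) (a' := .x 0) rfl φ b)).trans h0
          · exact (congrArg f (SuperRep.box_op_inr (g := .x 1) (b' := .x 0) rfl φ b)).trans
              (hx 0 1 (by decide) (hGop (.x 0)))
          · exact (congrArg f (SuperRep.box_op_inr (g := .x 2) (b' := .x 1) rfl φ b)).trans
              (hx 1 2 (by decide) (hGop (.x 1)))
        · have hc (l : Fin 2) (m : Fin 3) (hm : m ≠ 0) (h : ∀ b, G (B.op (.c l) b) = S.c m (G b)) :=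
            odd h (S.cd _ _ hm) φ b
          have h0 : f ((L1 F j).tm B ((L1 F j).op (.c 0) φ) b) = S.c 0 (f ((L1 F j).tm B φ b)) := by
            have h11 : (1 + 1 : ZMod 2) = 0 := by decide
            simp [hft, L1.coord_c, S.cc, h11, add_comm]
          fin_cases l
          · exact (congrArg f (SuperRep.box_op_inl (g := .c 0) (a' := .c 0) rfl φ b)).trans h0
          · exact (congrArg f (SuperRep.box_op_inr (g := .c 1) (b' := .c 0) rfl φ b)).trans
              (hc 0 1 (by decide) (hGop (.c 0)))
          · exact (congrArg f (SuperRep.box_op_inr (g := .c 2) (b' := .c 1) rfl φ b)).trans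
              (hc 1 2 (by decide) (hGop (.c 1)))
        · obtain rfl : l = 1 := by have : l + 1 ≠ 1 := hJ; omega
          exact (congrArg f (SuperRep.box_op_inr (g := .s 1 hl hJ)
            (b' := .s 0 (by omega) (Set.mem_univ _)) rfl φ b)).trans
            (even (X := S.s 1) (hGop (.s 0 (by omega) (Set.mem_univ _)))
              (S.sc_far 1 0 (by decide) (by decide)) φ b)
    · induction t using SuperRep.box_induction with
      | h0 => simp only [map_zero, smul_zero]
      | hadd t t' ht ht' => simp only [map_add, ht, ht', smul_add]
      | ht φ b =>
        rw [SuperRep.box_θ, hft, hft]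
        simp only [L1.coord_θ, sgn_zero, sgn_one, map_add, map_smul, hGθ, S.θc]
        rcases hσ with rfl | rfl <;> simp
  have hbox : Nontrivial ((L1 F j).box B).V := by
    obtain ⟨b, hb⟩ := exists_ne (0 : B.V)
    refine ⟨(L1 F j).tm B (L1.vec j 0) b, 0, fun h => hb (hG ?_)⟩
    have h1 := congrArg f h
    rwa [hft, L1.coord_vec, L1.coord_vec_ne j one_ne_zero, one_smul, zero_smul, add_zero,
      map_zero, ← map_zero G] at h1
  obtain ⟨hcomp, f', σ', h⟩ := hf.isComponent (W := W) hfi h0 hbox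
    (fun U hU hP hop => hmin U hU hP (hop (.s 1 (by omega) (by simp [levi])))) (fun t => by
      induction t using SuperRep.box_induction with
      | h0 => rw [map_zero]; exact W.zero_mem
      | hadd t t' ht ht' => rw [map_add]; exact W.add_mem ht ht'
      | ht φ b =>
        rw [hft]
        exact W.add_mem (W.smul_mem _ (hGW _)) (W.smul_mem _ (hW.c _ _ (hGW _))))
  exact ⟨_, ⟨B, hB, hcomp⟩, f', σ', h⟩

end Sys

end Box

end HeckeClifford

/-! ### Weights with two adjacent zeros: the extended and the induced modules -/

namespace HeckeClifford

namespace Sys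

variable {F : Type u} [Field F] {M : Type v} [AddCommGroup M] [Module F M] {S : Sys F M}

theorem θ_op (g : Gen 3 Set.univ) (v : M) : S.θ (S.op g v) = sgn F g.par • S.op g (S.θ v) := by
  rcases g with k | k | k
  · rw [Gen.par, sgn_zero, one_smul]; exact S.θx k v
  · rw [Gen.par, sgn_one, neg_one_smul]; exact S.θc k v
  · rw [Gen.par, sgn_zero, one_smul]; exact S.θs _ v

theorem Hom.extend {m : ℕ} {A : SuperRep.{u, w} F 3 (levi m)} {f : A.V →ₗ[F] M} {σ d : F}
    (h : S.Hom A f σ)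
    (hd : ∀ k : Fin 2, (k : ℕ) + 1 = m → ∀ v, S.s k v = -(d⁻¹ • S.ν k v)) :
    S.Hom (A.extend d) f σ := by
  refine ⟨fun g v => ?_, h.θ, h.sign⟩
  rcases g with k | k | ⟨k, hk, -⟩
  · exact h.op (.x k) v
  · exact h.op (.c k) v
  · change f ((if hm : k + 1 = m then A.Xi ⟨k, by omega⟩ ⟨k + 1, hk⟩ d
      else A.op (.s k hk hm) : Module.End F A.V) v) = S.s ⟨k, by omega⟩ (f v)
    split_ifs with hm
    · exact (h.Xi _ _ d v).trans (hd ⟨k, by omega⟩ hm (f v)).symm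
    · exact h.op (.s k hk hm) v

/-- If the intertwiner of `k` vanishes on a weight space with equal adjacent weights at the other
place, this is the whole space. -/
theorem wt_eq_top (hS : S.SS) (hirr : S.Irr) {k l : Fin 2} (h : k ≠ l) {β : Fin 3 → F}
    (hl : β l.castSucc = β l.succ) (hR : ∀ z ∈ S.wt β, S.R k β z = 0) (h0 : S.wt β ≠ ⊥) :
    S.wt β = ⊤ := by
  refine (hirr.2 _ (wt_pstable β) fun m v hv => ?_).resolve_left h0
  rcases eq_or_eq_of_ne h m with rfl | rfl
  · exact (wt_pstable β).s_mem hv (by rw [hR v hv]; exact zero_mem _)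
  · exact s_mem_of_eq hS hl hv

/-- Here the scalar of `R_R` is nonzero, so the intertwiner has a left inverse on the weight space.
-/
theorem R_eq_zero_iff {k : Fin 2} {β : Fin 3 → F} (hβ : β k.castSucc ≠ β k.succ)
    (hΩ : 2 * (β k.castSucc + β k.succ) ≠ (β k.castSucc - β k.succ) ^ 2) {v : M}
    (hv : v ∈ S.wt β) : S.R k β v = 0 ↔ v = 0 := by
  refine ⟨fun h => ?_, fun h => by rw [h, map_zero]⟩
  have h1 := R_R k hv
  rw [h, map_zero, eq_comm, smul_eq_zero] at h1
  refine h1.resolve_left fun h2 => hΩ ?_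
  rwa [sub_eq_zero, eq_comm, div_eq_one_iff_eq (pow_ne_zero 2 (sub_ne_zero.2 hβ))] at h2

variable [IsAlgClosed F] [Module.Finite F M] {p : ℕ} [CharP F p]

theorem q_zero : q F 0 = 0 := by simp [q]

/-- The labels `0` and `1` are neighbours, so the intertwiner between them vanishes and the module
is one weight space on which the last simple transposition is Ξ. Hence a subspace stable under the
Levi subalgebra is stable under everything, and the whole module is already irreducible over that
subalgebra. -/
theorem exists_extend_right (hp : p ≠ 2) (hS : S.SS) (hirr : S.Irr)
    (h0 : S.wt (qs F ![0, 0, 1]) ≠ ⊥) :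
    ∃ A : SuperRep.{u, u} F 3 (levi 2), IsV00L 1 A ∧ ∃ (f : A.V →ₗ[F] M) (σ : F),
      S.Hom (A.extend (q F 0 - q F 1)) f σ ∧ Function.Bijective f := by
  have h2 := two_ne_zero_of_char F p hp
  have hq : q F 1 = 2 := by simp [q]; norm_num
  have hq1 : q F 1 ≠ 0 := by rw [hq]; exact h2
  have hR : ∀ z : M, S.R 1 (qs F ![0, 0, 1]) z = 0 := by
    have key : ∀ z ∈ S.wt (qs F ![0, 0, 1]), S.R 1 (qs F ![0, 0, 1]) z = 0 := fun z hz =>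
      R_eq_zero_of_eq hS hirr (k := 1) (l := 0) (by decide) rfl
        (fun e => hq1 (e.symm.trans q_zero)) (discriminant_eq_zero (a := 0) (b := 1) (by simp)) hz
    have htop := wt_eq_top hS hirr (k := 1) (l := 0) (by decide) rfl key h0
    exact fun z => key z (htop ▸ trivial)
  have htop := wt_eq_top hS hirr (k := 1) (l := 0) (by decide) rfl (fun z _ => hR z) h0
  obtain ⟨A, hA, f, σ, hf, hfi, hfr⟩ := exists_V00L (S := S) h2 hq1 (W := ⊤)
    ⟨fun _ _ _ => trivial, fun _ _ _ => trivial, fun _ _ => trivial⟩ (fun _ _ => trivial)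
    (htop ▸ h0) (fun U _ hU hs => hirr.2 U hU fun m v hv => by
      rcases eq_or_eq_of_ne (by decide : (0 : Fin 2) ≠ 1) m with rfl | rfl
      · exact hs v hv
      · exact hU.s_mem hv (by rw [hR]; exact U.zero_mem)) htop.ge
  refine ⟨A, hA, f, σ, hf.extend fun k hk v => ?_, hfi, LinearMap.range_eq_top.1 hfr⟩
  obtain rfl : k = 1 := Fin.ext (by simpa using hk)
  rw [s_eq 1 (qs F ![0, 0, 1]), hR, zero_sub]
  rfl

theorem exists_extend_left (hp : p ≠ 2) (hS : S.SS) (hirr : S.Irr)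
    (h0 : S.wt (qs F ![1, 0, 0]) ≠ ⊥) :
    ∃ A : SuperRep.{u, u} F 3 (levi 1), IsLV00 1 A ∧ ∃ (f : A.V →ₗ[F] M) (σ : F),
      S.Hom (A.extend (q F 1 - q F 0)) f σ ∧ Function.Bijective f := by
  have h2 := two_ne_zero_of_char F p hp
  have hq : q F 1 = 2 := by simp [q]; norm_num
  have hq1 : q F 1 ≠ 0 := by rw [hq]; exact h2
  have hR : ∀ z : M, S.R 0 (qs F ![1, 0, 0]) z = 0 := by
    have key : ∀ z ∈ S.wt (qs F ![1, 0, 0]), S.R 0 (qs F ![1, 0, 0]) z = 0 := fun z hz =>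
      R_eq_zero_of_eq hS hirr (k := 0) (l := 1) (by decide) rfl
        (fun e => hq1 (e.trans q_zero)) (discriminant_eq_zero (a := 1) (b := 0) (by simp)) hz
    have htop := wt_eq_top hS hirr (k := 0) (l := 1) (by decide) rfl key h0
    exact fun z => key z (htop ▸ trivial)
  have htop := wt_eq_top hS hirr (k := 0) (l := 1) (by decide) rfl (fun z _ => hR z) h0
  obtain ⟨A, hA, f, σ, hf, hfi, hfr⟩ := exists_LV00 (S := S) h2 hq1 (W := ⊤)
    ⟨fun _ _ _ => trivial, fun _ _ _ => trivial, fun _ _ => trivial⟩ (fun _ _ => trivial)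
    (htop ▸ h0) (fun U _ hU hs => hirr.2 U hU fun m v hv => by
      rcases eq_or_eq_of_ne (by decide : (0 : Fin 2) ≠ 1) m with rfl | rfl
      · exact hU.s_mem hv (by rw [hR]; exact U.zero_mem)
      · exact hs v hv) htop.ge
  refine ⟨A, hA, f, σ, hf.extend fun k hk v => ?_, hfi, LinearMap.range_eq_top.1 hfr⟩
  obtain rfl : k = 0 := Fin.ext (by simpa using hk)
  rw [s_eq 0 (qs F ![1, 0, 0]), hR, zero_sub]
  rfl

omit [IsAlgClosed F] [Module.Finite F M] in
theorem Hom.ind {J : Set ℕ} {A : SuperRep.{u, w} F 3 J} {g : A.V →ₗ[F] M} {σ : F}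
    (h : S.Hom A g σ) {ρ : Hc F 3 →ₐ[F] Module.End F M} (hρ : ∀ g, ρ (gen F g) = S.op g) :
    ∃ f : A.ind.V →ₗ[F] M, S.Hom A.ind f σ ∧ ∀ z, f (A.indι z) = g z := by
  obtain ⟨f, hf, hop⟩ := SuperRep.exists_ind_desc ρ g (fun a z => by rw [hρ]; exact h.op a z)
  have hop' (a : Gen 3 Set.univ) (v : A.ind.V) : f (A.ind.op a v) = S.op a (f v) := by
    rw [hop, hρ]
  refine ⟨f, ⟨fun a v => ?_, fun v => ?_, h.sign⟩, hf⟩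
  · rw [hop']; cases a <;> rfl
  · let N : Submodule F A.ind.V := LinearMap.ker (f ∘ₗ A.ind.θ - σ • S.θ ∘ₗ f)
    have hN (v) : v ∈ N ↔ f (A.ind.θ v) = σ • S.θ (f v) := by
      rw [LinearMap.mem_ker, LinearMap.sub_apply, sub_eq_zero]; rfl
    have htop : N = ⊤ := SuperRep.ind_eq_top A (fun z => by
      rw [hN, SuperRep.ind_θ_ι, hf, hf, h.θ]) (fun a v hv => by
      rw [hN] at hv ⊢
      rw [A.ind.θ_op, map_smul, hop', hv, hop', map_smul, θ_op, smul_comm])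
    exact (hN v).1 (htop ▸ trivial)

omit [IsAlgClosed F] [Module.Finite F M] in
/-- Every element of a module induced from `ℌᶜ_{2,1}` has the form
`1 ⊗ z₀ + s_1 ⊗ z₁ + s_0 s_1 ⊗ z₂`. -/
theorem ind_three_eq (A : SuperRep.{u, w} F 3 (levi 2)) (v : A.ind.V) : ∃ z z' z'' : A.V,
    v = A.indι z + A.ind.op (.s 1 (by omega) (Set.mem_univ _)) (A.indι z') +
      A.ind.op (.s 0 (by omega) (Set.mem_univ _))
        (A.ind.op (.s 1 (by omega) (Set.mem_univ _)) (A.indι z'')) := by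
  let T : Sys F A.ind.V := ofHc A.indρ A.ind.θ A.ind.θ_θ A.ind.θ_op
  have hT (g : Gen 3 Set.univ) : T.op g = A.ind.op g := ofHc_op _ _ _ _ g
  let Q : Submodule F A.ind.V := LinearMap.range A.indι
  have hQs : ∀ v ∈ Q, T.s 0 v ∈ Q := by
    rintro _ ⟨z, rfl⟩
    exact ⟨_, (A.ind_op_ι (.s 0 (by omega) (by simp [levi])) z).symm⟩
  have hQ : T.PStable Q := by
    refine ⟨fun k => ?_, fun k => ?_, ?_⟩
    · rintro _ ⟨z, rfl⟩; exact ⟨_, (A.ind_op_ι (.x k) z).symm⟩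
    · rintro _ ⟨z, rfl⟩; exact ⟨_, (A.ind_op_ι (.c k) z).symm⟩
    · rintro _ ⟨z, rfl⟩; exact ⟨_, (A.ind_θ_ι z).symm⟩
  have hQ1 := hQ.sup_map_s 1
  have hK := hQ1.sup_map_s 0
  have s1Q : ∀ v ∈ Q, T.s 1 v ∈ Q ⊔ Q.map (T.s 1) := fun v hv =>
    Submodule.mem_sup_right ⟨v, hv, rfl⟩
  have s0Q1 : ∀ v ∈ Q ⊔ Q.map (T.s 1), T.s 0 v ∈
      (Q ⊔ Q.map (T.s 1)) ⊔ (Q ⊔ Q.map (T.s 1)).map (T.s 0) := fun v hv =>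
    Submodule.mem_sup_right ⟨v, hv, rfl⟩
  -- The only word needing care is `s_1 s_0 s_1 = s_0 s_1 s_0`, whose last `s_0` is absorbed by `Q`.
  have hs1 : ∀ v ∈ (Q ⊔ Q.map (T.s 1)) ⊔ (Q ⊔ Q.map (T.s 1)).map (T.s 0), T.s 1 v ∈
      (Q ⊔ Q.map (T.s 1)) ⊔ (Q ⊔ Q.map (T.s 1)).map (T.s 0) := by
    intro v hv
    obtain ⟨a, ha, _, ⟨b, hb, rfl⟩, rfl⟩ := Submodule.mem_sup.1 hv
    obtain ⟨b0, hb0, _, ⟨b1, hb1, rfl⟩, rfl⟩ := Submodule.mem_sup.1 hb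
    rw [map_add, map_add, map_add, ← T.braid]
    refine Submodule.add_mem _ (Submodule.mem_sup_left (T.s_sup_map_s Q 1 a ha))
      (Submodule.add_mem _ (Submodule.mem_sup_left (s1Q _ (hQs _ hb0)))
        (s0Q1 _ (s1Q _ (hQs _ hb1))))
  have htop := A.ind_eq_top (N := (Q ⊔ Q.map (T.s 1)) ⊔ (Q ⊔ Q.map (T.s 1)).map (T.s 0))
    (fun z => Submodule.mem_sup_left (Submodule.mem_sup_left ⟨z, rfl⟩)) (fun g v hv => by
      rw [← hT]
      rcases g with k | k | ⟨k, hk, -⟩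
      · exact hK.x k v hv
      · exact hK.c k v hv
      · obtain rfl | rfl : k = 0 ∨ k = 1 := by omega
        · exact T.s_sup_map_s _ 0 v hv
        · exact hs1 v hv)
  have hv : v ∈ (⊤ : Submodule F A.ind.V) := trivial
  rw [← htop] at hv
  obtain ⟨a, ha, _, ⟨b, hb, rfl⟩, rfl⟩ := Submodule.mem_sup.1 hv
  obtain ⟨_, ⟨z, rfl⟩, _, ⟨_, ⟨z', rfl⟩, rfl⟩, rfl⟩ := Submodule.mem_sup.1 ha
  obtain ⟨b0, hb0, _, ⟨_, ⟨z'', rfl⟩, rfl⟩, rfl⟩ := Submodule.mem_sup.1 hb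
  obtain ⟨z0, hz0⟩ := hQs b0 hb0
  refine ⟨z + z0, z', z'', ?_⟩
  rw [map_add, map_add, hz0]
  change A.indι z + T.s 1 (A.indι z') + (T.s 0 b0 + T.s 0 (T.s 1 (A.indι z''))) =
    A.indι z + T.s 0 b0 + T.s 1 (A.indι z') + T.s 0 (T.s 1 (A.indι z''))
  abel

omit [IsAlgClosed F] [Module.Finite F M] in
/-- A sum `w₀ + s_1 w₁ + s_0 s_1 w₂` of vectors of weights `(a, a, b)` is direct. -/
theorem eq_zero_of_sum_eq_zero (hS : S.SS) {β : Fin 3 → F} (h0 : β 0 = β 1) (h1 : β 1 ≠ β 2)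
    (hΩ : 2 * (β 1 + β 2) ≠ (β 1 - β 2) ^ 2) {w w' w'' : M} (hw : w ∈ S.wt β)
    (hw' : w' ∈ S.wt β) (hw'' : w'' ∈ S.wt β)
    (h : w + S.s 1 w' + S.s 0 (S.s 1 w'') = 0) : w = 0 ∧ w' = 0 ∧ w'' = 0 := by
  have hl : β (0 : Fin 2).castSucc = β (0 : Fin 2).succ := h0
  have hk : β (1 : Fin 2).castSucc ≠ β (1 : Fin 2).succ := h1
  have n1 : β ∘ tr 1 ≠ β := comp_tr_ne hk
  have n2 : (β ∘ tr 1) ∘ tr 0 ≠ β := comp_tr_tr_ne hl hk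
  have n3 : (β ∘ tr 1) ∘ tr 0 ≠ β ∘ tr 1 := comp_tr_tr_ne' (by decide) hl hk
  have e0 : (β ∘ tr 1) (0 : Fin 2).castSucc = β 1 := h0
  have e1 : (β ∘ tr 1) (0 : Fin 2).succ = β 2 := rfl
  have hk' : (β ∘ tr 1) (0 : Fin 2).castSucc ≠ (β ∘ tr 1) (0 : Fin 2).succ := by
    rw [e0, e1]; exact h1
  have s1 {v : M} (hv : v ∈ S.wt β) := s_mem 1 hk hv
  -- For weights `(a,a,b)`, only the third summand has a component of weight `(b,a,a)`, namely `R_0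
  -- R_1 w''`. Injectivity of the intertwiners gives `w'' = 0`, and then the component of weight
  -- `(a,b,a)` gives `w' = 0` in the same way.
  have key : S.R 0 (β ∘ tr 1) (S.R 1 β w'') = 0 := by
    refine eq_zero_of_mem_off (R_mem 0 hk' (R_mem 1 hk hw'')) ?_
    have l1 : S.wt β ≤ S.off ((β ∘ tr 1) ∘ tr 0) := wt_le_off n2.symm
    have l2 : S.wt (β ∘ tr 1) ≤ S.off ((β ∘ tr 1) ∘ tr 0) := wt_le_off n3.symm
    have hsum : S.R 0 (β ∘ tr 1) (S.R 1 β w'') =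
        (((β ∘ tr 1) (0 : Fin 2).castSucc - (β ∘ tr 1) (0 : Fin 2).succ)⁻¹ •
          S.ν 0 (S.R 1 β w'') + S.s 0 ((β (1 : Fin 2).castSucc - β (1 : Fin 2).succ)⁻¹ •
            S.ν 1 w'')) - (w + S.s 1 w') := by
      have e := h
      rw [s_eq 1 β w'', map_sub, s_eq 0 (β ∘ tr 1) (S.R 1 β w'')] at e
      rw [eq_sub_iff_add_eq, ← sub_eq_zero, ← e]
      abel
    rw [hsum]
    refine Submodule.sub_mem _ (Submodule.add_mem _ (l2 ?_) (l1 ?_))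
      (Submodule.add_mem _ (l1 hw) (sup_le l1 l2 (s1 hw')))
    · exact Submodule.smul_mem _ _ ((wt_pstable _).ν 0 (R_mem 1 hk hw''))
    · exact s_mem_of_eq hS hl (Submodule.smul_mem _ _ ((wt_pstable _).ν 1 hw''))
  rw [R_eq_zero_iff hk' (by rw [e0, e1]; exact hΩ) (R_mem 1 hk hw''),
    R_eq_zero_iff hk hΩ hw''] at key
  rw [key, map_zero, map_zero, add_zero] at h
  have key' : S.R 1 β w' = 0 := by
    refine eq_zero_of_mem_off (R_mem 1 hk hw') (wt_le_off n1.symm ?_)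
    rw [s_eq 1 β w'] at h
    have : S.R 1 β w' = (β (1 : Fin 2).castSucc - β (1 : Fin 2).succ)⁻¹ • S.ν 1 w' - w := by
      rw [eq_sub_iff_add_eq, ← sub_eq_zero, ← h]
      abel
    rw [this]
    exact Submodule.sub_mem _ (Submodule.smul_mem _ _ ((wt_pstable _).ν 1 hw')) hw
  rw [R_eq_zero_iff hk hΩ hw'] at key'
  rw [key', map_zero, add_zero] at h
  exact ⟨h, key', key⟩

/-- A minimal subspace of weight `(0,0,j)` stable under the Levi subalgebra is V(0,0) ⊛ L(j), and
the universal property extends its inclusion to the induced module. Injectivity is directness of the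
sum over the three coset representatives; it uses that `0` and `j` are distinct and not neighbours.
-/
theorem exists_ind (hp : p ≠ 2) (hS : S.SS) (hirr : S.Irr) {ρ : Hc F 3 →ₐ[F] Module.End F M}
    (hρ : ∀ g, ρ (gen F g) = S.op g) {j : ℕ} (hj : j ∈ II p) (hj0 : j ≠ 0) (hj1 : j ≠ 1)
    (h0 : S.wt (qs F ![0, 0, j]) ≠ ⊥) :
    ∃ A : SuperRep.{u, u} F 3 (levi 2), IsV00L j A ∧ ∃ (f : A.ind.V →ₗ[F] M) (σ : F),
      S.Hom A.ind f σ ∧ Function.Bijective f := by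
  have h2 := two_ne_zero_of_char F p hp
  have hqj : q F j ≠ 0 := fun h => hj0 (q_eq_zero hp hj h)
  obtain ⟨W, hWle, ⟨hWP, hWs⟩, hW0, hWmin⟩ := PSys.exists_minimal_stable
    (fun U : Submodule F M => S.PStable U ∧ ∀ v ∈ U, S.s 0 v ∈ U)
    ⟨wt_pstable (S := S) (qs F ![0, 0, j]), fun v hv => s_mem_of_eq hS rfl hv⟩ h0
  obtain ⟨A, hA, g, σ, hg, hgi, hgr⟩ := exists_V00L h2 hqj hWP hWs hW0
    (fun U hU hP hs => hWmin U hU ⟨hP, hs⟩) hWle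
  obtain ⟨f, hf, hfg⟩ := hg.ind hρ
  have hgw (z : A.V) : g z ∈ S.wt (qs F ![0, 0, j]) := hWle (hgr ▸ LinearMap.mem_range_self g z)
  have hfs (k : ℕ) (hk : k + 1 < 3) (v) : f (A.ind.op (.s k hk (Set.mem_univ _)) v) =
      S.s ⟨k, by omega⟩ (f v) := hf.op _ v
  have hinj : Function.Injective f := by
    rw [injective_iff_map_eq_zero]
    intro v hv
    obtain ⟨z, z', z'', rfl⟩ := ind_three_eq A v
    rw [map_add, map_add, hfs, hfs, hfs, hfg, hfg, hfg] at hv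
    obtain ⟨e, e', e''⟩ := eq_zero_of_sum_eq_zero hS (β := qs F ![0, 0, j]) rfl
      (fun e => hqj (e.symm.trans q_zero))
      (discriminant_ne_zero (a := 0) (b := j) hp (by simp [II]) hj hj0.symm
        ⟨by omega, by omega⟩) (hgw z) (hgw z') (hgw z'') hv
    rw [← map_zero g] at e e' e''
    rw [hgi e, hgi e', hgi e'', map_zero, map_zero, map_zero, add_zero, add_zero]
  refine ⟨A, hA, f, σ, hf, hinj, hf.surjective hirr fun h => ?_⟩
  refine hW0 ?_
  rw [← hgr, LinearMap.range_eq_bot]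
  ext z
  rw [← hfg, h]; rfl

end Sys

end HeckeClifford

/-! ### The weights (0,0,0) and (a,b,a) -/

namespace HeckeClifford

namespace Sys

variable {F : Type u} [Field F] {M : Type v} [AddCommGroup M] [Module F M] {S : Sys F M}

/-- The `x_k ^ 2` cannot all be nilpotent. -/
theorem wt_zero_eq_bot [Module.Finite F M] (h2 : (2 : F) ≠ 0) (hS : S.SS) (hirr : S.Irr)
    {β : Fin 3 → F} (hβ : ∀ k, β k = 0) : S.wt β = ⊥ := by
  have hadj (k : Fin 2) : β k.castSucc = β k.succ := by rw [hβ, hβ]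
  refine (hirr.2 _ (wt_pstable β) fun k v hv => s_mem_of_eq hS (hadj k) hv).resolve_right
    fun htop => ?_
  have hx (k : Fin 2) (v : M) := x_eq_of_adjacent hS h2 (hadj k) (v := v) (htop ▸ trivial)
  have := hirr.1
  obtain ⟨v, ⟨-, hv⟩, hv0⟩ := (Submodule.ne_bot_iff _).1 (eigen_ne_bot (S := S) (W := ⊤)
    ⟨fun _ _ _ => trivial, fun _ _ _ => trivial, fun _ _ => trivial⟩ top_ne_bot
    (r := fun _ => 0) (fun l w _ => by
      have hw : w ∈ S.wt β := htop ▸ trivial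
      rw [hw, hβ, zero_pow two_ne_zero]))
  simp only [zero_smul] at hv
  -- For `v` killed by all `x`, `x_1 s_0 v = c_1 c_2 x_2 s_0 v = c_1 c_2 s_0 x_2 v = 0`. The
  -- relation between `s_0` and `x_1` then reads `s_0 v = c_0 c_1 s_0 v`, which is impossible since
  -- `c_0 c_1` squares to `-1`.
  have e1 := (S.pair 0).sy (S.s 0 v)
  have e2 : S.x (0 : Fin 2).succ (S.s 0 v) = S.c 1 (S.c 2 (S.x 2 (S.s 0 v))) := hx 1 _
  rw [e2, ← S.sx_far 0 2 (by decide) (by decide), hv, map_zero, map_zero, map_zero, map_zero,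
    S.ss, hv, zero_add, eq_comm, sub_eq_zero] at e1
  have e3 := congrArg (fun w => S.c (0 : Fin 2).castSucc (S.c (0 : Fin 2).succ w)) e1
  simp only [(S.pair 0).cd, (S.pair 0).cc, (S.pair 0).dd, map_neg] at e3
  rw [← e1] at e3
  have e4 : (2 : F) • S.s 0 v = 0 := by
    rw [two_smul]; nth_rewrite 1 [e3]; exact neg_add_cancel _
  have e5 := (smul_eq_zero.1 e4).resolve_left h2
  exact hv0 (by rw [← S.ss 0 v, e5, map_zero])

/-- The braid relation on vectors of weight `(a, b, a)` on which all intertwiners vanish. -/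
theorem three_mul_add_eq_zero (h2 : (2 : F) ≠ 0) {β : Fin 3 → F} (h02 : β 0 = β 2)
    (h01 : β 0 ≠ β 1) (hR : ∀ k, ∀ z ∈ S.wt β, S.R k β z = 0) (h0 : S.wt β ≠ ⊥) :
    β 0 = 0 ∨ 3 * β 1 + β 0 = 0 := by
  obtain ⟨z, hz, hz0⟩ := (Submodule.ne_bot_iff _).1 h0
  have hP := wt_pstable (S := S) β
  have hd : β 0 - β 1 ≠ 0 := sub_ne_zero.2 h01
  have s0 {v : M} (hv : v ∈ S.wt β) : S.s 0 v = -((β 0 - β 1)⁻¹ • S.ν 0 v) := by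
    rw [s_eq 0 β, hR 0 v hv, zero_sub]; rfl
  have s1 {v : M} (hv : v ∈ S.wt β) : S.s 1 v = (β 0 - β 1)⁻¹ • S.ν 1 v := by
    rw [s_eq 1 β, hR 1 v hv, zero_sub, ← neg_smul, ← inv_neg, neg_sub, h02]; rfl
  have hν (k : Fin 2) {v : M} (hv : v ∈ S.wt β) : S.ν k v ∈ S.wt β := hP.ν k hv
  have hb := S.braid z
  rw [s0 hz, map_neg, map_smul, s1 (hν 0 hz), map_neg, map_smul, map_smul, s0 (hν 1 (hν 0 hz)),
    s1 hz, map_smul, s0 (hν 1 hz), map_smul, map_neg, map_smul, s1 (hν 0 (hν 1 hz))] at hb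
  -- The plus sign arises because the two Ξ's have opposite denominators: the weights at positions
  -- `0` and `2` agree.
  have hb' : S.ν 0 (S.ν 1 (S.ν 0 z)) + S.ν 1 (S.ν 0 (S.ν 1 z)) = 0 := by
    have : ((β 0 - β 1)⁻¹ ^ 3) • (S.ν 0 (S.ν 1 (S.ν 0 z)) + S.ν 1 (S.ν 0 (S.ν 1 z))) = 0 := by
      rw [smul_add, ← sub_neg_eq_add, sub_eq_zero]
      simp only [smul_neg, neg_neg, smul_smul] at hb
      rw [pow_three, hb]
    exact (smul_eq_zero.1 this).resolve_left (pow_ne_zero _ (inv_ne_zero hd))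
  have xx (k : Fin 3) {w : M} (hw : w ∈ S.wt β) : S.x k (S.x k w) = β k • w := hw k
  have hx (k : Fin 3) := hP.x k z hz
  have x10 := S.xx 1 0
  have x20 := S.xx 2 0
  have x21 := S.xx 2 1
  have c10 := S.cd 1 0 (by decide)
  have c20 := S.cd 2 0 (by decide)
  have c21 := S.cd 2 1 (by decide)
  have e01 := S.xd 0 1 (by decide)
  have e02 := S.xd 0 2 (by decide)
  have e10 := S.xd 1 0 (by decide)
  have e12 := S.xd 1 2 (by decide)
  have e20 := S.xd 2 0 (by decide)
  have e21 := S.xd 2 1 (by decide)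
  have hsum : S.ν 0 (S.ν 1 (S.ν 0 z)) + S.ν 1 (S.ν 0 (S.ν 1 z)) =
      (2 * (3 * β 1 + β 0)) • nu (S.x 0) (S.x 2) (S.c 0) (S.c 2) z := by
    simp only [ν, nu_apply, show (0 : Fin 2).castSucc = (0 : Fin 3) from rfl,
      show (0 : Fin 2).succ = (1 : Fin 3) from rfl, show (1 : Fin 2).castSucc = (1 : Fin 3) from rfl,
      show (1 : Fin 2).succ = (2 : Fin 3) from rfl, map_add, map_sub, map_neg, x10, x20, x21, c10,
      c20, c21, e01, e02, e10, e12, e20, e21, S.xc, S.cc, xx _ hz, xx _ (hx _), map_smul, ← h02]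
    module
  rw [hb', eq_comm, smul_eq_zero] at hsum
  rcases hsum with h | h
  -- If this scalar is nonzero, the element `ν` of the indices `0` and `2` kills `z`; its square is
  -- four times `β 0`, which therefore vanishes.
  · exact Or.inr ((mul_eq_zero.1 h).resolve_left h2)
  · left
    have h4 : nu (S.x 0) (S.x 2) (S.c 0) (S.c 2) (nu (S.x 0) (S.x 2) (S.c 0) (S.c 2) z) =
        (2 * (2 * β 0)) • z := by
      simp only [nu_apply, map_add, map_sub, map_neg, x20, c20, e02, e20, S.xc, S.cc, xx _ hz,
        ← h02]
      module
    rw [h, map_zero, eq_comm, smul_eq_zero] at h4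
    simpa [h2, hz0] using h4

variable [IsAlgClosed F] [Module.Finite F M] {p : ℕ} [CharP F p]

/-- The modules `D^i` from families of intertwiners. -/
theorem Family.exists_D (h2 : (2 : F) ≠ 0) (hirr : S.Irr) {i : Fin 3 → ℕ}
    {Φ : Equiv.Perm (Fin 3) → Module.End F M} (hΦ : S.Family i Φ) (h0 : S.wt (qs F i) ≠ ⊥) :
    ∃ C : SuperRep.{u, u} F 3 ∅, IsL i C ∧ (∃ (f : (D i C).V →ₗ[F] M) (σ : F),
      S.Hom (D i C) f σ ∧ Function.Bijective f) ∧ ∀ k, (S.x k).IsSemisimple := by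
  obtain ⟨N, hNle, hNP, hN0, hNmin⟩ := PSys.exists_minimal_stable S.PStable
    (wt_pstable (S := S) (qs F i)) h0
  have hid := Function.injective_id (α := Fin 3)
  obtain ⟨C, hC, g, σ, hσ, hgi, hgr, hgx, hgc, hgθ⟩ := PSys.exists_component (S.toPSys id hid) i
    (hNP.toPSys id hid) hN0 (fun U hU h => hNmin U hU ⟨h.x, h.c, h.θ⟩)
    (fun k v hv => hNle hv k)
  have hg : S.Hom C g σ := by
    refine ⟨fun a z => ?_, hgθ, hσ⟩
    rcases a with k | k | ⟨_, _, h⟩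
    · exact hgx k z
    · exact hgc k z
    · exact absurd h (Set.notMem_empty _)
  have hgN (z : C.V) : g z ∈ N := hgr ▸ LinearMap.mem_range_self g z
  -- Where the weight is zero, `x_m` itself and not only its square must vanish for `x_m` to be
  -- semisimple. The vectors of `N` with this property form a nonzero stable subspace, so they are
  -- all of `N`.
  let U : Submodule F M := N ⊓ ⨅ m : {m // qs F i m = 0}, LinearMap.ker (S.x m)
  have hU (v : M) : v ∈ U ↔ v ∈ N ∧ ∀ m, qs F i m = 0 → S.x m v = 0 := by
    simp [U, Submodule.mem_iInf]
  have hUP : S.PStable U := by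
    refine ⟨fun k v hv => ?_, fun k v hv => ?_, fun v hv => ?_⟩
    · rw [hU] at hv ⊢
      exact ⟨hNP.x k v hv.1, fun m hm => by rw [S.xx, hv.2 m hm, map_zero]⟩
    · rw [hU] at hv ⊢
      refine ⟨hNP.c k v hv.1, fun m hm => ?_⟩
      by_cases h : m = k
      · subst h; rw [S.xc, hv.2 m hm, map_zero, neg_zero]
      · rw [S.xd _ _ h, hv.2 m hm, map_zero]
    · rw [hU] at hv ⊢
      exact ⟨hNP.θ v hv.1, fun m hm => by rw [← S.θx, hv.2 m hm, map_zero]⟩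
  have hroot {a : F} (ha : a = 0) : root a = 0 := by
    have := root_sq a
    rw [ha] at this ⊢
    exact pow_eq_zero_iff two_ne_zero |>.1 this
  have hUN : U = N := by
    refine (hNmin U inf_le_left hUP).resolve_left fun hbot => ?_
    obtain ⟨v, ⟨hvN, hv⟩, hv0⟩ := (Submodule.ne_bot_iff _).1 (eigen_ne_bot (S := S) hNP hN0
      (r := fun m => root (qs F i m)) (fun l w hw => by rw [root_sq]; exact hNle hw l))
    have hvU : v ∈ U := (hU v).2 ⟨hvN, fun m hm => (hv m).trans
      ((congrArg (· • v) (hroot hm)).trans (zero_smul F v))⟩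
    rw [hbot] at hvU
    exact hv0 ((Submodule.mem_bot F).1 hvU)
  have hCn : Nontrivial C.V := hC.1.1
  obtain ⟨f, hf, hfs⟩ := hΦ.exists_equiv hirr hg hgi (fun z => hNle (hgN z)) hCn
  refine ⟨C, hC, ⟨f, σ, hf, f.bijective⟩, fun k => ?_⟩
  exact hΦ.isSemisimple h2 (fun z => hNle (hgN z))
    (fun m z hm => ((hU _).1 (hUN ▸ hgN z)).2 m hm) f hfs k

end Sys

/-! ### Membership in W' -/

section InW

variable {F : Type u} [Field F] {p : ℕ} [CharP F p]

theorem InW'.of_injective {i : Fin 3 → ℕ} (hI : ∀ k, i k ∈ II p) (hi : Function.Injective i) :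
    InW' p 3 i where
  mem := hI
  zero k l h hk hl := absurd (hi (hk.trans hl.symm)) h.ne
  char_zero _ k l h hkl := absurd (hi hkl) h.ne
  char_pos _ k l h hkl := absurd (hi hkl) h.ne

theorem eq_zero_two {i : Fin 3 → ℕ} (h1 : i 0 ≠ i 1) (h2 : i 2 ≠ i 1) {k l : Fin 3} (hkl : k < l)
    (h : i k = i l) : k = 0 ∧ l = 2 := by
  fin_cases k <;> fin_cases l <;> simp_all

theorem InW'.of_eq_zero {i : Fin 3 → ℕ} (hI : ∀ k, i k ∈ II p) (h0 : i 0 = 0) (h1 : i 1 = 1)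
    (h2 : i 2 = 0) : InW' p 3 i := by
  have key {k l : Fin 3} (hkl : k < l) (h : i k = i l) : k = 0 ∧ l = 2 :=
    eq_zero_two (by omega) (by omega) hkl h
  refine ⟨hI, fun k l h hk hl => ?_, fun _ k l h hkl hk => ?_, fun _ k l h hkl hk => ?_⟩
  · obtain ⟨rfl, rfl⟩ := key h (hk.trans hl.symm)
    exact ⟨1, by decide, by decide, h1⟩
  · obtain ⟨rfl, rfl⟩ := key h hkl; omega
  · obtain ⟨rfl, rfl⟩ := key h hkl; omega

theorem InW'.of_char {i : Fin 3 → ℕ} (hI : ∀ k, i k ∈ II p) (h02 : i 0 = i 2)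
    (h0 : 1 ≤ i 0) (h1 : i 1 = i 0 + 1) (hip : 2 * i 0 + 3 = p) : InW' p 3 i := by
  have key {k l : Fin 3} (hkl : k < l) (h : i k = i l) : k = 0 ∧ l = 2 :=
    eq_zero_two (by omega) (by omega) hkl h
  refine ⟨hI, fun k l h hk hl => ?_, fun h0 => by omega, fun _ k l h hkl hk => ?_⟩
  · obtain ⟨rfl, rfl⟩ := key h (hk.trans hl.symm); omega
  · obtain ⟨rfl, rfl⟩ := key h hkl
    -- The second alternative in degenerate form: `d = 0`, the two outer positions carry `(p - 3)/2`
    -- and the middle one `(p - 1)/2`.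
    refine Or.inr ⟨0, fun _ => 0, fun _ => 2, 1, by omega,
      fun a b hab => absurd hab (by rw [Fin.lt_def]; omega),
      fun a b hab => absurd hab (by rw [Fin.lt_def]; omega), le_rfl, by decide, by decide, le_rfl,
      by omega, fun j => ?_⟩
    have hj : (j : ℕ) = 0 := by omega
    rw [hj, add_zero]
    refine ⟨rfl, h02.symm, fun m hm hm' => ?_⟩
    obtain rfl : m = 1 := by
      have h1 : (0 : ℕ) < m := hm
      have h2 : (m : ℕ) < 2 := hm'
      exact Fin.ext (by change (m : ℕ) = 1; omega)
    omega

/-- Write `u = i 0`, `v = i 1`. If `u = v + 1`, then `3q(v) + q(u) = 2u(2v + 1)`, which cannot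
vanish in 𝕀. If `v = u + 1`, it is `2v(2u + 3)`, and the bound on `v` leaves only `2u + 3 = p`. The
case `u = 0` forces `(0,1,0)`. -/
theorem InW'.of_three_mul (hp : p ≠ 2) {i : Fin 3 → ℕ} (hI : ∀ k, i k ∈ II p) (h02 : i 0 = i 2)
    (hadm : i 0 = i 1 + 1 ∨ i 0 + 1 = i 1)
    (h : q F (i 0) = 0 ∨ 3 * q F (i 1) + q F (i 0) = 0) : InW' p 3 i := by
  have hp' := char_eq_zero_or_three_le F p hp
  have b0 : p = 0 ∨ i 0 ≤ (p - 1) / 2 := hI 0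
  have b1 : p = 0 ∨ i 1 ≤ (p - 1) / 2 := hI 1
  have h2 : ((2 : ℕ) : F) ≠ 0 := by exact_mod_cast two_ne_zero_of_char F p hp
  by_cases hu : i 0 = 0
  · exact InW'.of_eq_zero hI hu (by omega) (by omega)
  replace h := h.resolve_left fun h => hu (q_eq_zero hp (hI 0) h)
  rcases hadm with hv | hv
  · exfalso
    have e : 3 * q F (i 1) + q F (i 0) =
        ((2 : ℕ) : F) * ((i 0 : ℕ) : F) * ((2 * i 1 + 1 : ℕ) : F) := by
      rw [hv]; simp only [q]; push_cast; ring
    rw [e] at h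
    exact mul_ne_zero (mul_ne_zero h2 (cast_ne_zero_of_lt (p := p) hu (by omega)))
      (cast_ne_zero_of_lt (p := p) (by omega) (by omega)) h
  · have e : 3 * q F (i 1) + q F (i 0) =
        ((2 : ℕ) : F) * ((i 1 : ℕ) : F) * ((2 * i 0 + 3 : ℕ) : F) := by
      rw [← hv]; simp only [q]; push_cast; ring
    rw [e] at h
    have h3 : ((2 * i 0 + 3 : ℕ) : F) = 0 := (mul_eq_zero.1 h).resolve_left
      (mul_ne_zero h2 (cast_ne_zero_of_lt (p := p) (by omega) (by omega)))
    have h4 : ¬(p = 0 ∨ 2 * i 0 + 3 < p) := fun h4 =>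
      cast_ne_zero_of_lt (p := p) (by omega) h4 h3
    exact InW'.of_char hI h02 (by omega) hv.symm (by omega)

end InW

/-! ### The classification for operators -/

namespace Sys

variable {F : Type u} [Field F] {M : Type v} [AddCommGroup M] [Module F M] {S : Sys F M}
  [IsAlgClosed F] [Module.Finite F M] {p : ℕ} [CharP F p]

omit [Module.Finite F M] in
theorem wt_comp_ne_bot (hp : p ≠ 2) {i : Fin 3 → ℕ} (hI : ∀ k, i k ∈ II p) {k : Fin 2}
    (hne : i k.castSucc ≠ i k.succ) (hk : Adm i k) (h0 : S.wt (qs F i) ≠ ⊥) :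
    S.wt (qs F (i ∘ tr k)) ≠ ⊥ := by
  obtain ⟨v, hv, hv0⟩ := (Submodule.ne_bot_iff _).1 h0
  have hq : qs F i k.castSucc ≠ qs F i k.succ := fun h => hne (q_injOn hp (hI _) (hI _) h)
  refine (Submodule.ne_bot_iff _).2 ⟨_, R_mem k hq hv, fun h => hv0 ?_⟩
  exact (R_eq_zero_iff hq (discriminant_ne_zero hp (hI _) (hI _) hne hk) hv).1 h

/-- The modules all of whose weights have distinct adjacent entries. -/
theorem exists_D (hp : p ≠ 2) (hirr : S.Irr)
    (hadj : ∀ i : Fin 3 → ℕ, (∀ k, i k ∈ II p) → S.wt (qs F i) ≠ ⊥ →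
      ∀ k : Fin 2, i k.castSucc ≠ i k.succ)
    {i : Fin 3 → ℕ} (hI : ∀ k, i k ∈ II p) (h0 : S.wt (qs F i) ≠ ⊥) :
    ∃ C : SuperRep.{u, u} F 3 ∅, InW' p 3 i ∧ IsL i C ∧ (∃ (f : (D i C).V →ₗ[F] M) (σ : F),
      S.Hom (D i C) f σ ∧ Function.Bijective f) ∧ ∀ k, (S.x k).IsSemisimple := by
  have h2 := two_ne_zero_of_char F p hp
  have n0 : i 0 ≠ i 1 := hadj i hI h0 0
  have n1 : i 1 ≠ i 2 := hadj i hI h0 1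
  by_cases h02 : i 0 = i 2
  · have hcomp (k : Fin 2) : S.wt (qs F (i ∘ tr k)) = ⊥ := by
      by_contra hne
      obtain ⟨l, hl⟩ := exists_ne_index k
      refine hadj _ (fun m => hI _) hne l ?_
      rcases eq_or_eq_of_ne (by decide : (0 : Fin 2) ≠ 1) k with rfl | rfl
      · obtain rfl : l = 1 := (eq_or_eq_of_ne hl 1).resolve_left (by decide) |>.symm
        exact h02
      · obtain rfl : l = 0 := (eq_or_eq_of_ne hl 0).resolve_left (by decide) |>.symm
        exact h02
    have hadm (k : Fin 2) : ¬Adm i k := fun h =>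
      wt_comp_ne_bot hp hI (hadj i hI h0 k) h h0 (hcomp k)
    have hq (k : Fin 2) : qs F i k.castSucc ≠ qs F i k.succ := fun h =>
      hadj i hI h0 k (q_injOn hp (hI _) (hI _) h)
    have hR (k) : ∀ z ∈ S.wt (qs F i), S.R k (qs F i) z = 0 := by
      intro z hz
      have := R_mem k (hq k) hz
      rwa [← qs_comp, hcomp] at this
    obtain ⟨C, hC⟩ := (one_family hadm hq hR).exists_D h2 hirr h0
    refine ⟨C, InW'.of_three_mul hp hI h02 ?_ (three_mul_add_eq_zero h2 (congrArg (q F) h02)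
      (hq 0) hR h0), hC⟩
    exact Classical.or_iff_not_imp_left.2 fun h1 => not_not.1 fun h2 => hadm 0 ⟨h1, h2⟩
  · have hi : Function.Injective i := by
      intro k l h
      have n0' := n0.symm
      have n1' := n1.symm
      have h02' : i 2 ≠ i 0 := fun e => h02 e.symm
      clear hadj hirr hp h0
      fin_cases k <;> fin_cases l <;> simp_all
    obtain ⟨C, hC⟩ := (word_family hp hirr hi hI).exists_D h2 hirr h0
    exact ⟨C, InW'.of_injective hI hi, hC⟩

theorem eq_vec {α : Type*} {a b c : α} {i : Fin 3 → α} (h0 : i 0 = a) (h1 : i 1 = b)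
    (h2 : i 2 = c) : i = ![a, b, c] := by
  funext m; fin_cases m <;> assumption

theorem classification (hp : p ≠ 2) (hS : S.SS) (hirr : S.Irr)
    {ρ : Hc F 3 →ₐ[F] Module.End F M} (hρ : ∀ g, ρ (gen F g) = S.op g)
    (hex : ∃ i : Fin 3 → ℕ, (∀ k, i k ∈ II p) ∧ S.wt (qs F i) ≠ ⊥) :
    ((∀ k, (S.x k).IsSemisimple) ∧ ∃ (i : Fin 3 → ℕ) (C : SuperRep.{u, u} F 3 ∅),
      InW' p 3 i ∧ IsL i C ∧ ∃ (f : (D i C).V →ₗ[F] M) (σ : F),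
        S.Hom (D i C) f σ ∧ Function.Bijective f) ∨
    (∃ A : SuperRep.{u, u} F 3 (levi 2), IsV00L 1 A ∧ ∃ (f : A.V →ₗ[F] M) (σ : F),
      S.Hom (A.extend (q F 0 - q F 1)) f σ ∧ Function.Bijective f) ∨
    (∃ A : SuperRep.{u, u} F 3 (levi 1), IsLV00 1 A ∧ ∃ (f : A.V →ₗ[F] M) (σ : F),
      S.Hom (A.extend (q F 1 - q F 0)) f σ ∧ Function.Bijective f) ∨
    (∃ j ∈ II p, j ≠ 0 ∧ j ≠ 1 ∧ ∃ A : SuperRep.{u, u} F 3 (levi 2), IsV00L j A ∧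
      ∃ (f : A.ind.V →ₗ[F] M) (σ : F), S.Hom A.ind f σ ∧ Function.Bijective f) := by
  have h2 := two_ne_zero_of_char F p hp
  by_cases hadj : ∀ i : Fin 3 → ℕ, (∀ k, i k ∈ II p) → S.wt (qs F i) ≠ ⊥ →
      ∀ k : Fin 2, i k.castSucc ≠ i k.succ
  · obtain ⟨i, hI, h0⟩ := hex
    obtain ⟨C, hW, hC, hf, hss⟩ := exists_D hp hirr hadj hI h0
    exact Or.inl ⟨hss, i, C, hW, hC, hf⟩
  right
  push Not at hadj
  obtain ⟨i, hI, h0, k, hk⟩ := hadj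
  obtain ⟨v, hv, hv0⟩ := (Submodule.ne_bot_iff _).1 h0
  have hz : i k.castSucc = 0 := q_eq_zero hp (hI _)
    (eq_zero_of_adjacent hS h2 (congrArg (q F) hk) hv hv0)
  have hz' : i k.succ = 0 := hk.symm.trans hz
  have h000 : ∀ j, j = 0 → i ≠ ![0, 0, j] ∧ i ≠ ![j, 0, 0] := by
    rintro _ rfl
    have : i ≠ ![0, 0, 0] := by
      rintro rfl
      exact h0 (wt_zero_eq_bot h2 hS hirr fun m => by fin_cases m <;> exact q_zero)
    exact ⟨this, this⟩
  rcases eq_or_eq_of_ne (by decide : (0 : Fin 2) ≠ 1) k with rfl | rfl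
  · obtain ⟨j, hj⟩ : ∃ j, j = i 2 := ⟨_, rfl⟩
    have hi : i = ![0, 0, j] := eq_vec hz hz' hj.symm
    have hj0 : j ≠ 0 := fun h => (h000 j h).1 hi
    by_cases hj1 : j = 1
    · subst hj1
      exact Or.inl (exists_extend_right hp hS hirr (hi ▸ h0))
    · exact Or.inr (Or.inr ⟨j, hj ▸ hI 2, hj0, hj1,
        exists_ind hp hS hirr hρ (hj ▸ hI 2) hj0 hj1 (hi ▸ h0)⟩)
  · obtain ⟨j, hj⟩ : ∃ j, j = i 0 := ⟨_, rfl⟩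
    have hi : i = ![j, 0, 0] := eq_vec hj.symm hz hz'
    have hj0 : j ≠ 0 := fun h => (h000 j h).2 hi
    by_cases hj1 : j = 1
    · subst hj1
      exact Or.inr (Or.inl (exists_extend_left hp hS hirr (hi ▸ h0)))
    · have hI0 : ∀ m, (i ∘ tr 0) m ∈ II p := fun m => hI _
      have e : (i ∘ tr 0) ∘ tr 1 = ![0, 0, j] := eq_vec hz hz' hj.symm
      have a0 : Adm i 0 := by
        refine ⟨?_, ?_⟩
        · change i 0 ≠ i 1 + 1
          rw [show i 1 = 0 from hz, ← hj]; omega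
        · change i 0 + 1 ≠ i 1
          rw [show i 1 = 0 from hz]; omega
      have a1 : Adm (i ∘ tr 0) 1 := by
        refine ⟨?_, ?_⟩
        · change i 0 ≠ i 2 + 1
          rw [show i 2 = 0 from hz', ← hj]; omega
        · change i 0 + 1 ≠ i 2
          rw [show i 2 = 0 from hz']; omega
      -- Two injective intertwiners carry the weight `(j,0,0)` through `(0,j,0)` to `(0,0,j)`.
      have w0 := wt_comp_ne_bot hp hI (k := 0) (fun h => hj0 (hj.trans (h.trans hz))) a0 h0
      have w1 := wt_comp_ne_bot hp hI0 (k := 1) (fun h => hj0 (hj.trans (h.trans hz'))) a1 w0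
      rw [e] at w1
      exact Or.inr (Or.inr ⟨j, hj ▸ hI 0, hj0, hj1,
        exists_ind hp hS hirr hρ (hj ▸ hI 0) hj0 hj1 w1⟩)

end Sys

end HeckeClifford

/-! ### From graded modules to operators and back -/

namespace HeckeClifford

section Grading

variable {F : Type u} [Field F] {M : Type v} [AddCommGroup M] [Module F M]

/-- The parity involution of a superspace. -/
theorem exists_involution {gr : ZMod 2 → Submodule F M} (h : IsCompl (gr 0) (gr 1)) :
    ∃ θ : Module.End F M, ∀ a, ∀ m ∈ gr a, θ m = sgn F a • m := by
  let e := Submodule.prodEquivOfIsCompl (gr 0) (gr 1) h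
  refine ⟨(gr 0).subtype ∘ₗ LinearMap.fst F _ _ ∘ₗ e.symm.toLinearMap -
    (gr 1).subtype ∘ₗ LinearMap.snd F _ _ ∘ₗ e.symm.toLinearMap, fun a m hm => ?_⟩
  by_cases ha : a = 0
  · subst ha
    have : e.symm m = (⟨m, hm⟩, 0) := by
      rw [LinearEquiv.symm_apply_eq]
      simp [e]
    simp [this, sgn_zero]
  · obtain rfl := PSys.zmod_two_eq_one ha
    have : e.symm m = (0, ⟨m, hm⟩) := by
      rw [LinearEquiv.symm_apply_eq]
      simp [e]
    simp [this, sgn_one]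

theorem exists_add_of_isCompl {gr : ZMod 2 → Submodule F M} (h : IsCompl (gr 0) (gr 1)) (m : M) :
    ∃ m₀ ∈ gr 0, ∃ m₁ ∈ gr 1, m₀ + m₁ = m :=
  Submodule.mem_sup.1 (h.sup_eq_top ▸ trivial : m ∈ gr 0 ⊔ gr 1)

theorem mem_gr_iff (h2 : (2 : F) ≠ 0) {gr : ZMod 2 → Submodule F M} (h : IsCompl (gr 0) (gr 1))
    {θ : Module.End F M} (hθ : ∀ a, ∀ m ∈ gr a, θ m = sgn F a • m) (a : ZMod 2) (m : M) :
    m ∈ gr a ↔ θ m = sgn F a • m := by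
  refine ⟨hθ a m, fun hm => ?_⟩
  obtain ⟨m₀, h₀, m₁, h₁, rfl⟩ := exists_add_of_isCompl h m
  rw [map_add, hθ 0 _ h₀, hθ 1 _ h₁, sgn_zero, sgn_one, smul_add] at hm
  by_cases ha : a = 0
  · subst ha
    have : (2 : F) • m₁ = 0 := by
      rw [sgn_zero] at hm
      rw [← sub_eq_zero] at hm
      rw [← neg_eq_zero, ← hm]
      module
    rw [(smul_eq_zero.1 this).resolve_left h2, add_zero]
    exact h₀
  · obtain rfl := PSys.zmod_two_eq_one ha
    have : (2 : F) • m₀ = 0 := by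
      rw [sgn_one] at hm
      rw [← sub_eq_zero] at hm
      rw [← hm]
      module
    rw [(smul_eq_zero.1 this).resolve_left h2, zero_add]
    exact h₁

theorem exists_eigenvector_mem [IsAlgClosed F] [Module.Finite F M] {W : Submodule F M}
    (h0 : W ≠ ⊥) (f : Module.End F M) (hf : ∀ v ∈ W, f v ∈ W) :
    ∃ μ, W ⊓ f.eigenspace μ ≠ ⊥ := by
  have : Nontrivial W := Submodule.nontrivial_iff_ne_bot.2 h0
  obtain ⟨μ, hμ⟩ := Module.End.exists_eigenvalue (f.restrict hf)
  obtain ⟨v, hv⟩ := hμ.exists_hasEigenvector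
  exact ⟨μ, (Submodule.ne_bot_iff _).2 ⟨v, ⟨v.2, Module.End.mem_eigenspace_iff.2
    (congrArg Subtype.val hv.apply_eq_smul)⟩, fun h => hv.2 (Subtype.ext h)⟩⟩

theorem Sys.exists_wt_ne_bot [IsAlgClosed F] [Module.Finite F M] {S : Sys F M} [Nontrivial M] :
    ∃ β, S.wt β ≠ ⊥ := by
  let f (k : Fin 3) : Module.End F M := S.x k * S.x k
  have hf (k l : Fin 3) (v : M) : f k (f l v) = f l (f k v) := by
    change S.x k (S.x k (S.x l (S.x l v))) = S.x l (S.x l (S.x k (S.x k v)))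
    simp only [S.xx k l]
  have st (k l : Fin 3) (μ : F) : ∀ v ∈ (f l).eigenspace μ, f k v ∈ (f l).eigenspace μ := by
    intro v hv
    rw [Module.End.mem_eigenspace_iff] at hv ⊢
    rw [hf, hv, map_smul]
  obtain ⟨μ, h0⟩ := exists_eigenvector_mem (W := (⊤ : Submodule F M)) top_ne_bot (f 0)
    fun _ _ => trivial
  obtain ⟨μ', h1⟩ := exists_eigenvector_mem h0 (f 1) fun v hv => ⟨trivial, st 1 0 μ v hv.2⟩
  obtain ⟨μ'', h2⟩ := exists_eigenvector_mem h1 (f 2) fun v hv =>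
    ⟨⟨trivial, st 2 0 μ v hv.1.2⟩, st 2 1 μ' v hv.2⟩
  obtain ⟨v, ⟨⟨⟨-, e0⟩, e1⟩, e2⟩, hv0⟩ := (Submodule.ne_bot_iff _).1 h2
  refine ⟨![μ, μ', μ''], (Submodule.ne_bot_iff _).2 ⟨v, fun k => ?_, hv0⟩⟩
  fin_cases k
  · exact Module.End.mem_eigenspace_iff.1 e0
  · exact Module.End.mem_eigenspace_iff.1 e1
  · exact Module.End.mem_eigenspace_iff.1 e2

/-- The vector `v` is a generalized eigenvector, and for a semisimple operator these are
eigenvectors. -/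
theorem eq_zero_of_isSemisimple [Module.Finite F M] {f : Module.End F M} (hf : f.IsSemisimple)
    {a : F} {v w : M} (hv : f v = a • v + w) (hw : f w = a • w) : w = 0 := by
  have h : v ∈ f.maxGenEigenspace a := by
    refine (Module.End.mem_maxGenEigenspace _ _ _).2 ⟨2, ?_⟩
    have h1 : (f - a • (1 : Module.End F M)) v = w := by
      simp [hv]
    rw [pow_two, Module.End.mul_apply, h1]
    simp [hw]
  rw [hf.isFinitelySemisimple.maxGenEigenspace_eq_eigenspace, Module.End.mem_eigenspace_iff] at h
  rw [h] at hv
  exact (add_eq_left.1 hv.symm)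

end Grading

section Bridge

variable {F : Type u} [Field F] {M : Type v} [AddCommGroup M] [Module F M] [Module (Hc F 3) M]
  [IsScalarTower F (Hc F 3) M]

/-- A bijective homomorphism to the operators on `M` gives an isomorphism of supermodules. -/
theorem IsoTo.of_hom (h2 : (2 : F) ≠ 0) {gr : ZMod 2 → Submodule F M}
    (hc : IsCompl (gr 0) (gr 1)) {S : Sys F M} (hop : ∀ g m, S.op g m = gen F g • m)
    (hθ : ∀ a, ∀ m ∈ gr a, S.θ m = sgn F a • m) {A : SuperRep.{u, w} F 3 Set.univ}
    {f : A.V →ₗ[F] M} {σ : F} (hf : S.Hom A f σ) (hb : Function.Bijective f) : IsoTo gr A := by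
  let e := LinearEquiv.ofBijective f hb
  have he (v) : e v = f v := rfl
  have hincl (g : Gen 3 Set.univ) : g.incl = g := by cases g <;> rfl
  have hes (g m) : e.symm (gen F g • m) = A.op g (e.symm m) := by
    rw [LinearEquiv.symm_apply_eq, he, hf.op, hincl, hop, ← he, e.apply_symm_apply]
  have hgr (ε : ZMod 2) (hε : sgn F ε = σ) (a : ZMod 2) (v : A.V) :
      f v ∈ gr a ↔ v ∈ A.gr (a + ε) := by
    rw [mem_gr_iff h2 hc hθ, hf.θ_apply, ← map_smul f, hb.1.eq_iff]
    change _ ↔ A.θ v = sgn F (a + ε) • v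
    rw [sgn_add, hε]
    rcases hf.sign with h | h <;> subst h
    · rw [one_smul, mul_one]
    · rw [neg_one_smul, neg_eq_iff_eq_neg, mul_neg_one, neg_smul]
  rcases hf.sign with h | h
  · refine ⟨0, e.symm, fun a => Submodule.ext fun v => ?_, fun g m => ?_⟩
    · rw [← hgr 0 (by rw [h, sgn_zero])]
      refine ⟨?_, fun hv => ⟨f v, hv, e.symm_apply_apply v⟩⟩
      rintro ⟨m, hm, rfl⟩
      have : f (e.symm m) = m := e.apply_symm_apply m
      rwa [LinearEquiv.coe_coe, this]
    · rw [zero_mul, sgn_zero, one_smul, hes]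
  -- Here `f` reverses parity but commutes with the generators without signs. Composing its inverse
  -- with `θ` introduces the sign that an odd isomorphism must have at the `c_k`.
  · let t : A.V ≃ₗ[F] A.V := LinearEquiv.ofInvolutive A.θ A.θ_θ
    have ht (v) : t v = A.θ v := rfl
    have hgrt (b : ZMod 2) (v : A.V) (hv : v ∈ A.gr b) : A.θ v ∈ A.gr b := by
      have : A.θ v = sgn F b • v := hv
      rw [this]
      exact Submodule.smul_mem _ _ hv
    refine ⟨1, e.symm.trans t, fun a => Submodule.ext fun v => ?_, fun g m => ?_⟩
    · constructor
      · rintro ⟨m, hm, rfl⟩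
        refine hgrt _ _ ((hgr 1 (by rw [h, sgn_one]) a _).1 ?_)
        have : f (e.symm m) = m := e.apply_symm_apply m
        rwa [LinearEquiv.coe_coe, this]
      · intro hv
        refine ⟨f (A.θ v), (hgr 1 (by rw [h, sgn_one]) a _).2 (hgrt _ _ hv), ?_⟩
        change A.θ (e.symm (e (A.θ v))) = v
        rw [e.symm_apply_apply, A.θ_θ]
    · change A.θ (e.symm (gen F g • m)) = _ • A.op g (A.θ (e.symm m))
      rw [hes, A.θ_op, one_mul]

theorem Hc.gen_mem_deg (g : Gen 3 Set.univ) : gen F g ∈ Hc.deg F 3 g.par :=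
  Hc.parity_gen F 3 g

theorem θ_gen_smul {gr : ZMod 2 → Submodule F M} (hs : IsSupermodule F 3 gr)
    {θ : Module.End F M} (hθ : ∀ a, ∀ m ∈ gr a, θ m = sgn F a • m) (g : Gen 3 Set.univ) (m : M) :
    θ (Algebra.lsmul F F M (gen F g) m) = sgn F g.par • Algebra.lsmul F F M (gen F g) (θ m) := by
  have key (b : ZMod 2) (m : M) (hm : m ∈ gr b) : θ (Algebra.lsmul F F M (gen F g) m) =
      sgn F g.par • Algebra.lsmul F F M (gen F g) (θ m) := by
    rw [hθ b m hm, map_smul, smul_smul, ← sgn_add]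
    exact hθ (g.par + b) _ (hs.smul_mem _ _ _ _ (Hc.gen_mem_deg g) hm)
  obtain ⟨m₀, h₀, m₁, h₁, rfl⟩ := exists_add_of_isCompl hs.compl m
  simp only [map_add, smul_add, key 0 m₀ h₀, key 1 m₁ h₁]

/-- As `2` is invertible, a subspace stable under the parity involution contains the homogeneous
parts of its vectors; stability under the generators gives stability under the algebra. -/
theorem Sys.irr_of_isIrreducible (h2 : (2 : F) ≠ 0) {gr : ZMod 2 → Submodule F M}
    (hs : IsSupermodule F 3 gr) (hirr : IsIrreducible F 3 gr) {S : Sys F M}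
    (hop : ∀ g, Algebra.lsmul F F M (gen F g) = S.op g)
    (hθ : ∀ a, ∀ m ∈ gr a, S.θ m = sgn F a • m) : S.Irr := by
  refine ⟨hirr.1, fun N hN hNs => ?_⟩
  have hNop (g : Gen 3 Set.univ) : ∀ v ∈ N, Algebra.lsmul F F M (gen F g) v ∈ N := by
    rw [hop]
    rcases g with k | k | k
    · exact hN.x k
    · exact hN.c k
    · exact hNs _
  let N' : Submodule (Hc F 3) M :=
    { N.toAddSubmonoid with
      smul_mem' := fun y v hv => Hc.map_mem (Algebra.lsmul F F M) hNop y v hv }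
  have hmem (m : M) : m ∈ N' ↔ m ∈ N := Iff.rfl
  have key := hirr.2 N' fun m hm => by
    obtain ⟨m₀, h₀, m₁, h₁, rfl⟩ := exists_add_of_isCompl hs.compl m
    have hθm : m₀ - m₁ ∈ N := by
      have := hN.θ _ hm
      rwa [map_add, hθ 0 _ h₀, hθ 1 _ h₁, sgn_zero, sgn_one, one_smul, neg_one_smul,
        ← sub_eq_add_neg] at this
    have e₀ : m₀ = (2 : F)⁻¹ • ((m₀ + m₁) + (m₀ - m₁)) := by
      rw [show (m₀ + m₁) + (m₀ - m₁) = (2 : F) • m₀ by module, inv_smul_smul₀ h2]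
    have hm₀ : m₀ ∈ N := e₀ ▸ N.smul_mem _ (N.add_mem hm hθm)
    refine ⟨m₀, hm₀, m₁, ?_, h₀, h₁, rfl⟩
    exact (N.add_mem_iff_right hm₀).1 hm
  refine key.imp (fun h => ?_) (fun h => ?_)
  · exact (Submodule.eq_bot_iff N).2 fun m hm =>
      (Submodule.mem_bot (Hc F 3)).1 (h ▸ (hmem m).2 hm)
  · exact (Submodule.eq_top_iff').2 fun m => (hmem m).1 (h ▸ trivial)

end Bridge

end HeckeClifford

theorem mainTheorem11 {F : Type u} [Field F] [IsAlgClosed F] (p : ℕ) [CharP F p] (hp : p ≠ 2)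
    {M : Type v} [AddCommGroup M] [Module F M] [Module (HeckeClifford.Hc F 3) M]
    [IsScalarTower F (HeckeClifford.Hc F 3) M]
    (gr : ZMod 2 → Submodule F M)
    (hsuper : HeckeClifford.IsSupermodule F 3 gr)
    (hint : HeckeClifford.IsIntegralModule F p 3 M)
    (hirr : HeckeClifford.IsIrreducible F 3 gr)
    (hss : ∀ k : Fin 3, (HeckeClifford.act F M
      (HeckeClifford.gen F (HeckeClifford.Gen.x k) ^ 2 : HeckeClifford.Hc F 3)).IsSemisimple) :
    (HeckeClifford.IsCompletelySplittable F 3 M ∧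
      ∃ (i : Fin 3 → ℕ) (C : HeckeClifford.SuperRep.{u, u} F 3 ∅),
        HeckeClifford.InW' p 3 i ∧ HeckeClifford.IsL i C ∧
        HeckeClifford.IsoTo gr (HeckeClifford.D i C)) ∨
    (∃ A : HeckeClifford.SuperRep.{u, u} F 3 (HeckeClifford.levi 2),
      HeckeClifford.IsV00L 1 A ∧
      HeckeClifford.IsoTo gr (A.extend (HeckeClifford.q F 0 - HeckeClifford.q F 1))) ∨
    (∃ A : HeckeClifford.SuperRep.{u, u} F 3 (HeckeClifford.levi 1),
      HeckeClifford.IsLV00 1 A ∧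
      HeckeClifford.IsoTo gr (A.extend (HeckeClifford.q F 1 - HeckeClifford.q F 0))) ∨
    (∃ j ∈ HeckeClifford.II p, j ≠ 0 ∧ j ≠ 1 ∧
      ∃ A : HeckeClifford.SuperRep.{u, u} F 3 (HeckeClifford.levi 2),
        HeckeClifford.IsV00L j A ∧ HeckeClifford.IsoTo gr A.ind) := by
  have h2 := HeckeClifford.two_ne_zero_of_char F p hp
  obtain ⟨hfin, heig⟩ := hint
  have hnt := hirr.1
  obtain ⟨θ, hθ⟩ := HeckeClifford.exists_involution hsuper.compl
  have hθθ (m : M) : θ (θ m) = m := by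
    obtain ⟨m₀, h₀, m₁, h₁, rfl⟩ := HeckeClifford.exists_add_of_isCompl hsuper.compl m
    simp [hθ 0 _ h₀, hθ 1 _ h₁, HeckeClifford.sgn_zero, HeckeClifford.sgn_one]
  let ρ : HeckeClifford.Hc F 3 →ₐ[F] Module.End F M := Algebra.lsmul F F M
  let S : HeckeClifford.Sys F M :=
    HeckeClifford.Sys.ofHc ρ θ hθθ (HeckeClifford.θ_gen_smul hsuper hθ)
  have hρ (g) : ρ (HeckeClifford.gen F g) = S.op g :=
    (HeckeClifford.Sys.ofHc_op ρ θ hθθ (HeckeClifford.θ_gen_smul hsuper hθ) g).symm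
  have hop (g) (m : M) : S.op g m = HeckeClifford.gen F g • m := by rw [← hρ]; rfl
  have hSirr : S.Irr := HeckeClifford.Sys.irr_of_isIrreducible h2 hsuper hirr hρ hθ
  have hx (k : Fin 3) (v : M) : HeckeClifford.act F M
      (HeckeClifford.gen F (HeckeClifford.Gen.x k) ^ 2 : HeckeClifford.Hc F 3) v =
        S.x k (S.x k v) := by
    change ρ (HeckeClifford.gen F (HeckeClifford.Gen.x k) ^ 2) v = _
    rw [pow_two, map_mul]; rfl
  have hSS : S.SS := fun k a v w hv hw =>
    HeckeClifford.eq_zero_of_isSemisimple (hss k) (by rw [hx, hv]) (by rw [hx, hw])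
  have hex : ∃ i : Fin 3 → ℕ, (∀ k, i k ∈ HeckeClifford.II p) ∧
      S.wt (HeckeClifford.qs F i) ≠ ⊥ := by
    obtain ⟨β, hβ⟩ := HeckeClifford.Sys.exists_wt_ne_bot (S := S)
    obtain ⟨v, hv, hv0⟩ := (Submodule.ne_bot_iff _).1 hβ
    have key (k : Fin 3) : ∃ i ∈ HeckeClifford.II p, β k = HeckeClifford.q F i :=
      heig k (β k) (Module.End.hasEigenvalue_of_hasEigenvector
        ⟨Module.End.mem_eigenspace_iff.2 ((hx k v).trans (hv k)), hv0⟩)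
    choose i hi hiβ using key
    refine ⟨i, hi, ?_⟩
    rwa [show HeckeClifford.qs F i = β from funext fun k => (hiβ k).symm]
  have iso {A : HeckeClifford.SuperRep.{u, u} F 3 Set.univ} {f : A.V →ₗ[F] M} {σ : F}
      (hf : S.Hom A f σ) (hb : Function.Bijective f) : HeckeClifford.IsoTo gr A :=
    HeckeClifford.IsoTo.of_hom h2 hsuper.compl hop hθ hf hb
  rcases HeckeClifford.Sys.classification hp hSS hSirr hρ hex with
    ⟨hsemi, i, C, hW, hC, f, σ, hf, hb⟩ | ⟨A, hA, f, σ, hf, hb⟩ | ⟨A, hA, f, σ, hf, hb⟩ |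
    ⟨j, hj, hj0, hj1, A, hA, f, σ, hf, hb⟩
  · exact Or.inl ⟨hsemi, i, C, hW, hC, iso hf hb⟩
  · exact Or.inr (Or.inl ⟨A, hA, iso hf hb⟩)
  · exact Or.inr (Or.inr (Or.inl ⟨A, hA, iso hf hb⟩))
  · exact Or.inr (Or.inr (Or.inr ⟨j, hj, hj0, hj1, A, hA, iso hf hb⟩))
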